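/- Robust Knapsack Center (RKC): given a finite metric space \((V,d)\), weights \(w_j\in[0,1]\) (\(j\in V\)) and an integer \(0\le z<|V|\), find \(S\subseteq V\) with \(\sum_{j\in S}w_j\le 1\) minimizing \(r(S,V,z)=\min_{X\subseteq V,\,|X|\ge |V|-z}\ \max_{i\in X} d(i,S)\), where \(d(i,S)=\min_{c\in S}d(i,c)\) (and \(d(i,\emptyset)=\infty\)). In the version with multiplicities (RKCM) on \(T\subseteq V\), every \(i\in T\) has a positive integer multiplicity \(m_i\), solutions are the \(S\subseteq T\) with \(\sum_{j\in S}w_j\le1\), and the cost is \(\min\{\max_{i\in X}d(i,S): X\subseteq T,\ \sum_{i\in X}m_i\ge \sum_{i\in T}m_i-z\}\). A \(\rho\)-approximate solution is a feasible one of cost at most \(\rho\) times the optimum. The procedure CoresetComputeAndTest\((\tau)\), with approximation factors \(\alpha,\beta\): compute a \(\beta\)-approximate solution \(\Gamma\) of \(\tau\)-center on \(V\) (a set of \(\min(\tau,|V|)\) centers), assign each point to a closest center, let \(r_1=\max_{j\in V}d(j,\Gamma)\), let \(T\) contain one point of minimum weight of each cluster, with the size of the cluster as its multiplicity, compute an \(\alpha\)-approximate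 solution \(S\) of RKCM on \(T\), let \(r_2\) be the RKCM cost of \(S\), and return \((S,r_1,r_2)\). The strategy RKnapCenter\((\epsilon,\alpha)\) runs CoresetComputeAndTest\((\tau)\) for \(\tau=1,2,4,\dots\), stops as soon as \(\alpha(4\alpha+2)r_1\le\epsilon(r_2-4\alpha r_1)\), and returns the last \(S\). Algorithms are sequential unit-cost random access (real RAM) programs with constant-time access to \(d\) and \(\mathbf w\). The doubling dimension of \(V\) is the smallest \(D\) such that every ball of radius \(r\) centered at a point of \(V\) is contained in the union of at most \(2^D\) balls of radius \(r/2\) centered at points of \(V\). Let \(k\) be the minimum cardinality of an optimal solution of the RKC instance. Then: (1) For every \(\epsilon\in(0,1)\), every \(\beta\), and every program that implements CoresetComputeAndTest with factors \(\alpha=3\) and \(\beta\), RKnapCenter\((\epsilon,3)\) halts on every RKC instance and returns a \((3+\epsilon)\)-approximate solution. (2) There is a program implementing CoresetComputeAndTest with factors \(\alpha=3\) and \(\beta=2\), and an exponent \(c\), such that for every \(\epsilon\in(0,1)\) and every \(D\) there is a constant \(C\) for which RKnapCenter\((\epsilon,3)\), using this program (which does not depend on \(\epsilon\), \(D\) or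 \(k\)), returns a \((3+\epsilon)\)-approximate solution on every RKC instance, and takes at most \(C\,|V|\,(k+z)^c\) steps on every RKC instance of doubling dimension at most \(D\). That is, for fixed \(\epsilon\) and constant doubling dimension the sequential running time is \(O(|V|\,\mathrm{poly}(k,z))\). -/

import Mathlib

open scoped ENNReal

noncomputable section

/-! ### Robust Knapsack Center -/

/-- An instance of Robust Knapsack Center: a finite metric space on the points `0, …, n - 1`,
weights in `[0,1]`, and a number `z < n` of permitted outliers. -/
structure RKCInstance where
  n : ℕ
  d : Fin n → Fin n → ℝ
  d_self : ∀ i, d i i = 0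
  eq_of_d_eq_zero : ∀ i j, d i j = 0 → i = j
  d_symm : ∀ i j, d i j = d j i
  d_triangle : ∀ i j l, d i l ≤ d i j + d j l
  w : Fin n → ℝ
  w_nonneg : ∀ i, 0 ≤ w i
  w_le_one : ∀ i, w i ≤ 1
  z : ℕ
  z_lt : z < n

namespace RKCInstance

variable (I : RKCInstance)

/-- `d(i,S) = min_{c ∈ S} d(i,c)`, which is `∞` for `S = ∅`. -/
def distTo (i : Fin I.n) (S : Finset (Fin I.n)) : ℝ≥0∞ :=
  S.inf fun c => ENNReal.ofReal (I.d i c)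

/-- The knapsack constraint. -/
def Fits (S : Finset (Fin I.n)) : Prop := ∑ j ∈ S, I.w j ≤ 1

/-- `r(S,V,z)`: the minimum, over the `X ⊆ V` with `|X| ≥ |V| - z`, of `max_{i ∈ X} d(i,S)`. -/
def cost (S : Finset (Fin I.n)) : ℝ≥0∞ :=
  ⨅ (X : Finset (Fin I.n)) (_ : I.n ≤ X.card + I.z), X.sup fun i => I.distTo i S

/-- The cost of an optimal solution. -/
def opt : ℝ≥0∞ := ⨅ (S : Finset (Fin I.n)) (_ : I.Fits S), I.cost S

/-- `S` is a feasible solution of cost at most `ρ` times the optimum. -/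
def IsApprox (ρ : ℝ) (S : Finset (Fin I.n)) : Prop :=
  I.Fits S ∧ I.cost S ≤ ENNReal.ofReal ρ * I.opt

/-- The minimum cardinality of an optimal solution. -/
def minOptCard : ℕ :=
  sInf {k | ∃ S : Finset (Fin I.n), I.Fits S ∧ I.cost S = I.opt ∧ S.card = k}

/-! ### The version with multiplicities, on a subset `T` of the points -/

/-- The minimum, over the `X ⊆ T` with `∑_{i ∈ X} m i ≥ (∑_{i ∈ T} m i) - z`, of
`max_{i ∈ X} d(i,S)`. -/
def costMult (T : Finset (Fin I.n)) (m : Fin I.n → ℕ) (S : Finset (Fin I.n)) : ℝ≥0∞ :=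
  ⨅ (X : Finset (Fin I.n)) (_ : X ⊆ T ∧ ∑ i ∈ T, m i ≤ ∑ i ∈ X, m i + I.z),
    X.sup fun i => I.distTo i S

def optMult (T : Finset (Fin I.n)) (m : Fin I.n → ℕ) : ℝ≥0∞ :=
  ⨅ (S : Finset (Fin I.n)) (_ : S ⊆ T ∧ I.Fits S), I.costMult T m S

def IsApproxMult (α : ℝ) (T : Finset (Fin I.n)) (m : Fin I.n → ℕ) (S : Finset (Fin I.n)) : Prop :=
  S ⊆ T ∧ I.Fits S ∧ I.costMult T m S ≤ ENNReal.ofReal α * I.optMult T m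

/-! ### `τ`-center and doubling dimension -/

/-- `max_{j ∈ V} d(j,Γ)`. -/
def radius (Γ : Finset (Fin I.n)) : ℝ≥0∞ := Finset.univ.sup fun j => I.distTo j Γ

/-- The optimum of `τ`-center (all points are centers if `τ ≥ |V|`). -/
def centerOpt (τ : ℕ) : ℝ≥0∞ :=
  ⨅ (Γ : Finset (Fin I.n)) (_ : Γ.card = min τ I.n), I.radius Γ

/-- The smallest `D` such that every ball of radius `r` around a point is contained in the union
of at most `2 ^ D` balls of radius `r / 2` around points. -/
def doublingDim : ℝ :=
  sInf {D : ℝ | ∀ (i : Fin I.n) (r : ℝ), ∃ B : Finset (Fin I.n), (B.card : ℝ) ≤ (2 : ℝ) ^ D ∧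
    ∀ j, I.d i j ≤ r → ∃ b ∈ B, I.d b j ≤ r / 2}

/-! ### The procedure CoresetComputeAndTest -/

/-- `(S, r₁, r₂)` is a possible result of CoresetComputeAndTest with granularity `τ`, a
`β`-approximate `τ`-center subroutine and an `α`-approximate subroutine for the problem with
multiplicities. Here `Γ` is the set of centers, `cl j` is the center of the cluster of `j`, and
`rep c` is the point of minimum weight that is selected from the cluster of `c`. -/
def IsCoresetTest (α β : ℝ) (τ : ℕ) (S : Finset (Fin I.n)) (r₁ r₂ : ℝ) : Prop :=
  ∃ (Γ : Finset (Fin I.n)) (cl rep : Fin I.n → Fin I.n)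
    (T : Finset (Fin I.n)) (m : Fin I.n → ℕ),
    Γ.card = min τ I.n ∧
    I.radius Γ ≤ ENNReal.ofReal β * I.centerOpt τ ∧
    (∀ j, cl j ∈ Γ ∧ ∀ c ∈ Γ, I.d j (cl j) ≤ I.d j c) ∧
    (∀ c ∈ Γ, cl (rep c) = c ∧ ∀ j, cl j = c → I.w (rep c) ≤ I.w j) ∧
    T = Γ.image rep ∧
    (∀ i, m i = (Finset.univ.filter fun j => rep (cl j) = i).card) ∧
    I.IsApproxMult α T m S ∧
    r₁ = (I.radius Γ).toReal ∧
    r₂ = (I.costMult T m S).toReal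

end RKCInstance

/-! ### The machine model: a unit-cost real RAM with oracles for distances and weights

A program uses registers and arrays of natural numbers (addition and truncated subtraction; no
multiplication, so that numbers cannot grow abusively) and registers and arrays of real numbers
(field operations and comparison; no rounding). Its only constants are natural numbers. -/

inductive NExp where
  | lit (c : ℕ)
  | var (x : ℕ)
  | get (a : ℕ) (i : NExp)
  | add (e f : NExp)
  | sub (e f : NExp)

inductive RExp where
  | var (x : ℕ)
  | get (a : ℕ) (i : NExp)
  | ofNat (e : NExp)
  | dist (i j : NExp)
  | weight (i : NExp)
  | add (e f : RExp)
  | sub (e f : RExp)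
  | mul (e f : RExp)
  | div (e f : RExp)

inductive BExp where
  | nle (e f : NExp)
  | rle (e f : RExp)
  | not (b : BExp)
  | and (b c : BExp)

inductive Cmd where
  | setN (x : ℕ) (e : NExp)
  | setR (x : ℕ) (e : RExp)
  | putN (a : ℕ) (i e : NExp)
  | putR (a : ℕ) (i : NExp) (e : RExp)
  | seq (p q : Cmd)
  | ite (b : BExp) (p q : Cmd)
  | while (b : BExp) (p : Cmd)

/-- Registers `nv`, `rv` and arrays `na`, `ra`. -/
structure RAMState where
  nv : ℕ → ℕ
  rv : ℕ → ℝ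
  na : ℕ → ℕ → ℕ
  ra : ℕ → ℕ → ℝ

def NExp.eval (σ : RAMState) : NExp → ℕ
  | lit c => c
  | var x => σ.nv x
  | get a i => σ.na a (i.eval σ)
  | add e f => e.eval σ + f.eval σ
  | sub e f => e.eval σ - f.eval σ

def NExp.cost : NExp → ℕ
  | lit _ => 1
  | var _ => 1
  | get _ i => i.cost + 1
  | add e f => e.cost + f.cost + 1
  | sub e f => e.cost + f.cost + 1

def RExp.eval (I : RKCInstance) (σ : RAMState) : RExp → ℝ
  | var x => σ.rv x
  | get a i => σ.ra a (i.eval σ)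
  | ofNat e => (e.eval σ : ℝ)
  | dist i j =>
      if h : i.eval σ < I.n ∧ j.eval σ < I.n then I.d ⟨i.eval σ, h.1⟩ ⟨j.eval σ, h.2⟩ else 0
  | weight i => if h : i.eval σ < I.n then I.w ⟨i.eval σ, h⟩ else 0
  | add e f => e.eval I σ + f.eval I σ
  | sub e f => e.eval I σ - f.eval I σ
  | mul e f => e.eval I σ * f.eval I σ
  | div e f => e.eval I σ / f.eval I σ

def RExp.cost : RExp → ℕ
  | var _ => 1
  | get _ i => i.cost + 1
  | ofNat e => e.cost + 1
  | dist i j => i.cost + j.cost + 1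
  | weight i => i.cost + 1
  | add e f => e.cost + f.cost + 1
  | sub e f => e.cost + f.cost + 1
  | mul e f => e.cost + f.cost + 1
  | div e f => e.cost + f.cost + 1

def BExp.Holds (I : RKCInstance) (σ : RAMState) : BExp → Prop
  | nle e f => e.eval σ ≤ f.eval σ
  | rle e f => e.eval I σ ≤ f.eval I σ
  | not b => ¬ b.Holds I σ
  | and b c => b.Holds I σ ∧ c.Holds I σ

def BExp.cost : BExp → ℕ
  | nle e f => e.cost + f.cost + 1
  | rle e f => e.cost + f.cost + 1
  | not b => b.cost + 1
  | and b c => b.cost + c.cost + 1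

/-- Store `v` in position `i` of the array `a`. -/
def update₂ {R : Type} (A : ℕ → ℕ → R) (a i : ℕ) (v : R) : ℕ → ℕ → R :=
  Function.update A a (Function.update (A a) i v)

/-- `Exec I p σ t σ'`: on the instance `I`, the program `p` started in the state `σ` halts after
`t` elementary operations in the state `σ'`. -/
inductive Exec (I : RKCInstance) : Cmd → RAMState → ℕ → RAMState → Prop
  | setN (x : ℕ) (e : NExp) (σ : RAMState) :
      Exec I (.setN x e) σ (e.cost + 1)
        { σ with nv := Function.update σ.nv x (e.eval σ) }
  | setR (x : ℕ) (e : RExp) (σ : RAMState) :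
      Exec I (.setR x e) σ (e.cost + 1)
        { σ with rv := Function.update σ.rv x (e.eval I σ) }
  | putN (a : ℕ) (i e : NExp) (σ : RAMState) :
      Exec I (.putN a i e) σ (i.cost + e.cost + 1)
        { σ with na := update₂ σ.na a (i.eval σ) (e.eval σ) }
  | putR (a : ℕ) (i : NExp) (e : RExp) (σ : RAMState) :
      Exec I (.putR a i e) σ (i.cost + e.cost + 1)
        { σ with ra := update₂ σ.ra a (i.eval σ) (e.eval I σ) }
  | seq {p q : Cmd} {σ σ₁ σ₂ : RAMState} {t₁ t₂ : ℕ} :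
      Exec I p σ t₁ σ₁ → Exec I q σ₁ t₂ σ₂ → Exec I (.seq p q) σ (t₁ + t₂) σ₂
  | ite_true {b : BExp} {p q : Cmd} {σ σ₁ : RAMState} {t : ℕ} :
      b.Holds I σ → Exec I p σ t σ₁ → Exec I (.ite b p q) σ (b.cost + 1 + t) σ₁
  | ite_false {b : BExp} {p q : Cmd} {σ σ₁ : RAMState} {t : ℕ} :
      ¬ b.Holds I σ → Exec I q σ t σ₁ → Exec I (.ite b p q) σ (b.cost + 1 + t) σ₁
  | while_false {b : BExp} {p : Cmd} {σ : RAMState} :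
      ¬ b.Holds I σ → Exec I (.while b p) σ (b.cost + 1) σ
  | while_true {b : BExp} {p : Cmd} {σ σ₁ σ₂ : RAMState} {t₁ t₂ : ℕ} :
      b.Holds I σ → Exec I p σ t₁ σ₁ → Exec I (.while b p) σ₁ t₂ σ₂ →
      Exec I (.while b p) σ (b.cost + 1 + t₁ + t₂) σ₂

/-! ### RKnapCenter as a program

Conventions: the natural registers `0`, `1`, `2` hold `|V|`, `z`, `τ`; the real registers
`0`, `1`, `2` hold `ε`, `r₁`, `r₂`; the natural array `0` holds the indicator of `S`. -/

/-- The initial state on input `(V, z, w)` and `ε`: everything else is zero. -/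
def initState (I : RKCInstance) (ε : ℝ) : RAMState where
  nv := Function.update (Function.update (fun _ => 0) 0 I.n) 1 I.z
  rv := Function.update (fun _ => 0) 0 ε
  na := fun _ _ => 0
  ra := fun _ _ => 0

/-- The set `S` stored in a state. -/
def RAMState.sol (I : RKCInstance) (σ : RAMState) : Finset (Fin I.n) :=
  Finset.univ.filter fun i => σ.na 0 i ≠ 0

/-- `body` implements CoresetComputeAndTest (with approximation factors `α` and `β` of its two
subroutines): started in any state that holds `|V|`, `z` and any `τ ≥ 1`, it halts with a result
`(S, r₁, r₂)` of the procedure, and it preserves `|V|`, `z`, `τ` and `ε`. -/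
def ImplementsCoresetTest (α β : ℝ) (body : Cmd) : Prop :=
  ∀ (I : RKCInstance) (τ : ℕ) (σ : RAMState), 1 ≤ τ →
    σ.nv 0 = I.n → σ.nv 1 = I.z → σ.nv 2 = τ →
    ∃ (t : ℕ) (σ' : RAMState), Exec I body σ t σ' ∧
      σ'.nv 0 = I.n ∧ σ'.nv 1 = I.z ∧ σ'.nv 2 = τ ∧ σ'.rv 0 = σ.rv 0 ∧
      I.IsCoresetTest α β τ (σ'.sol I) (σ'.rv 1) (σ'.rv 2)

/-- The stopping test `α (4 α + 2) r₁ ≤ ε (r₂ - 4 α r₁)`. -/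
def stopTest (α : ℕ) : BExp :=
  .rle (.mul (.ofNat (.lit (α * (4 * α + 2)))) (.var 1))
    (.mul (.var 0) (.sub (.var 2) (.mul (.ofNat (.lit (4 * α))) (.var 1))))

/-- `τ ← 2 τ`. -/
def doubleTau : Cmd := .setN 2 (.add (.var 2) (.var 2))

/-- RKnapCenter: `τ ← 1; do { body; τ ← 2 τ } while not stopTest; return S`. -/
def rknapCenter (α : ℕ) (body : Cmd) : Cmd :=
  .seq (.setN 2 (.lit 1))
    (.seq (.seq body doubleTau) (.while (.not (stopTest α)) (.seq body doubleTau)))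

end

/-! The coreset radius `r₁` controls both the quality and the number of rounds. A point and the
representative of its cluster are at distance at most `2 r₁`. Hence passing to the coreset raises
the optimum by at most `4 r₁`, and serving all points instead of the representatives raises a cost
by at most `2 r₁` (`IsCoresetTest.bounds`). With factor 3 on the coreset, the returned set costs at
most `3 opt + 14 r₁`, and the stopping test forces `14 r₁ ≤ ε opt` (`IsCoresetTest.isApprox`).

The loop halts because `r₁ = 0` once `τ ≥ |V|`. In small doubling dimension it halts much earlier:
each of the `k` optimal balls is covered by boundedly many balls of radius `opt / 2 ^ j`, and the at
most `z` outliers become centers themselves. So a `τ` linear in `k + z` makes `r₁` small enough for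
the test (`Doubling.centerOpt_le`, `IsCoresetTest.stops_of_centerOpt_le`). A body with running time
`|V| poly(τ, z)` therefore suffices (`rknapCenter_time`).

Such a body takes farthest-first traversal as the 2-approximation of `τ`-center
(`FarthestFirst.radius_le_centerOpt`). On the coreset the optimum is a distance of two points
(`Indexing.exists_feasible_opt`), so all of these are tried as radii `r`; each test either finds a
solution of radius `3 r` or proves that none of radius `r` exists (`testRadius_spec`).

The test needs no linear programming. Given scores `X`, cluster greedily with balls of radius `2 r`,
always opening a point of least score, and ask by dynamic programming for clusters to serve, each
paid for by the lightest point within `r` of its center. If a selection exists, it is a solution of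
radius `3 r` (`Selectable.feasible`). If not, every solution of radius `r` leaves centers uncovered
whose clusters have total multiplicity above `z` (`Feasible.lt_sum_clusterMult`). This is a linear
inequality that holds for the uncovered sets of all solutions and fails for the scores, so a
perceptron step on `X` approaches a multiple of every such indicator (`potential_step`). After
polynomially many failures no solution can exist. Truncating multiplicities at `z + 1` makes this
number independent of `|V|`.

The programs are verified in a small Hoare logic, `Runs`, where time is bounded by program size
times a factor `K`, and `Frame` keeps track of everything a command does not write. -/

/-! ### Program logic: running time, frames and Hoare-style rules -/

/-- The number of operations in the text of a program. -/
def Cmd.size : Cmd → ℕ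
  | setN _ e => e.cost + 1
  | setR _ e => e.cost + 1
  | putN _ i e => i.cost + e.cost + 1
  | putR _ i e => i.cost + e.cost + 1
  | seq p q => p.size + q.size
  | ite b p q => b.cost + 1 + p.size + q.size
  | .while b p => b.cost + 1 + p.size

/-- Write sets are Boolean functions built from `Nat.beq`, so for concrete commands and registers
the frame conditions hold by `rfl`. This lemma serves commands with variable registers. -/
theorem nat_beq_of_ne {x y : ℕ} (h : x ≠ y) : Nat.beq x y = false := by
  cases hb : Nat.beq x y
  · rfl
  · exact absurd (Nat.eq_of_beq_eq_true hb) h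

/-- Whether a program writes a natural register. -/
def Cmd.wN : Cmd → ℕ → Bool
  | setN y _, x => Nat.beq y x
  | setR _ _, _ => false
  | putN _ _ _, _ => false
  | putR _ _ _, _ => false
  | seq p q, x => p.wN x || q.wN x
  | ite _ p q, x => p.wN x || q.wN x
  | .while _ p, x => p.wN x

/-- Whether a program writes a real register. -/
def Cmd.wR : Cmd → ℕ → Bool
  | setN _ _, _ => false
  | setR y _, x => Nat.beq y x
  | putN _ _ _, _ => false
  | putR _ _ _, _ => false
  | seq p q, x => p.wR x || q.wR x
  | ite _ p q, x => p.wR x || q.wR x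
  | .while _ p, x => p.wR x

/-- Whether a program writes a natural array. -/
def Cmd.wNA : Cmd → ℕ → Bool
  | setN _ _, _ => false
  | setR _ _, _ => false
  | putN y _ _, x => Nat.beq y x
  | putR _ _ _, _ => false
  | seq p q, x => p.wNA x || q.wNA x
  | ite _ p q, x => p.wNA x || q.wNA x
  | .while _ p, x => p.wNA x

/-- Whether a program writes a real array. -/
def Cmd.wRA : Cmd → ℕ → Bool
  | setN _ _, _ => false
  | setR _ _, _ => false
  | putN _ _ _, _ => false
  | putR y _ _, x => Nat.beq y x
  | seq p q, x => p.wRA x || q.wRA x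
  | ite _ p q, x => p.wRA x || q.wRA x
  | .while _ p, x => p.wRA x

/-- The states agree on everything that the program does not write. -/
structure Frame (p : Cmd) (σ σ' : RAMState) : Prop where
  nv : ∀ x, p.wN x = false → σ'.nv x = σ.nv x
  rv : ∀ x, p.wR x = false → σ'.rv x = σ.rv x
  na : ∀ x, p.wNA x = false → σ'.na x = σ.na x
  ra : ∀ x, p.wRA x = false → σ'.ra x = σ.ra x

theorem Frame.refl (p : Cmd) (σ : RAMState) : Frame p σ σ :=
  ⟨fun _ _ => rfl, fun _ _ => rfl, fun _ _ => rfl, fun _ _ => rfl⟩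

theorem Frame.trans {p : Cmd} {σ₁ σ₂ σ₃ : RAMState} (h : Frame p σ₁ σ₂) (h' : Frame p σ₂ σ₃) :
    Frame p σ₁ σ₃ :=
  ⟨fun x hx => (h'.nv x hx).trans (h.nv x hx), fun x hx => (h'.rv x hx).trans (h.rv x hx),
   fun x hx => (h'.na x hx).trans (h.na x hx), fun x hx => (h'.ra x hx).trans (h.ra x hx)⟩

theorem Frame.of_imp {p q : Cmd} {σ σ' : RAMState} (h : Frame p σ σ')
    (h1 : ∀ x, q.wN x = false → p.wN x = false) (h2 : ∀ x, q.wR x = false → p.wR x = false)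
    (h3 : ∀ x, q.wNA x = false → p.wNA x = false) (h4 : ∀ x, q.wRA x = false → p.wRA x = false) :
    Frame q σ σ' :=
  ⟨fun x hx => h.nv x (h1 x hx), fun x hx => h.rv x (h2 x hx),
   fun x hx => h.na x (h3 x hx), fun x hx => h.ra x (h4 x hx)⟩

theorem update₂_self {R : Type} (A : ℕ → ℕ → R) (a i : ℕ) (v : R) :
    update₂ A a i v a = Function.update (A a) i v := by simp [update₂]

theorem update₂_of_ne {R : Type} (A : ℕ → ℕ → R) {a b : ℕ} (i : ℕ) (v : R) (h : b ≠ a) :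
    update₂ A a i v b = A b := by simp [update₂, h]

theorem Exec.frame {I : RKCInstance} {p : Cmd} {σ σ' : RAMState} {t : ℕ} (h : Exec I p σ t σ') :
    Frame p σ σ' := by
  induction h with
  | setN x e σ =>
    refine ⟨fun y hy => ?_, fun _ _ => rfl, fun _ _ => rfl, fun _ _ => rfl⟩
    have : y ≠ x := by rintro rfl; simp [Cmd.wN] at hy
    simp [this]
  | setR x e σ =>
    refine ⟨fun _ _ => rfl, fun y hy => ?_, fun _ _ => rfl, fun _ _ => rfl⟩
    have : y ≠ x := by rintro rfl; simp [Cmd.wR] at hy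
    simp [this]
  | putN a i e σ =>
    refine ⟨fun _ _ => rfl, fun _ _ => rfl, fun y hy => ?_, fun _ _ => rfl⟩
    have : y ≠ a := by rintro rfl; simp [Cmd.wNA] at hy
    simp [update₂_of_ne _ _ _ this]
  | putR a i e σ =>
    refine ⟨fun _ _ => rfl, fun _ _ => rfl, fun _ _ => rfl, fun y hy => ?_⟩
    have : y ≠ a := by rintro rfl; simp [Cmd.wRA] at hy
    simp [update₂_of_ne _ _ _ this]
  | seq _ _ ih1 ih2 =>
    exact (ih1.of_imp (by simp +contextual [Cmd.wN]) (by simp +contextual [Cmd.wR])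
      (by simp +contextual [Cmd.wNA]) (by simp +contextual [Cmd.wRA])).trans
      (ih2.of_imp (by simp +contextual [Cmd.wN]) (by simp +contextual [Cmd.wR])
      (by simp +contextual [Cmd.wNA]) (by simp +contextual [Cmd.wRA]))
  | ite_true _ _ ih =>
    exact ih.of_imp (by simp +contextual [Cmd.wN]) (by simp +contextual [Cmd.wR])
      (by simp +contextual [Cmd.wNA]) (by simp +contextual [Cmd.wRA])
  | ite_false _ _ ih =>
    exact ih.of_imp (by simp +contextual [Cmd.wN]) (by simp +contextual [Cmd.wR])
      (by simp +contextual [Cmd.wNA]) (by simp +contextual [Cmd.wRA])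
  | while_false _ => exact Frame.refl _ _
  | while_true _ _ _ ih1 ih2 =>
    exact (ih1.of_imp (by simp +contextual [Cmd.wN]) (by simp +contextual [Cmd.wR])
      (by simp +contextual [Cmd.wNA]) (by simp +contextual [Cmd.wRA])).trans ih2

/-- `p`, started in `σ`, halts within `p.size * K` steps in a state that satisfies `Q`. -/
def Runs (I : RKCInstance) (p : Cmd) (σ : RAMState) (K : ℕ) (Q : RAMState → Prop) : Prop :=
  ∃ t σ', Exec I p σ t σ' ∧ t ≤ p.size * K ∧ Q σ'

namespace Runs

variable {I : RKCInstance} {p q : Cmd} {b : BExp} {σ : RAMState} {K K' : ℕ}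
  {Q R : RAMState → Prop}

theorem conseq (h : Runs I p σ K R) (hK : K ≤ K')
    (hQ : ∀ σ', Frame p σ σ' → R σ' → Q σ') : Runs I p σ K' Q := by
  obtain ⟨t, σ', he, ht, hR⟩ := h
  exact ⟨t, σ', he, ht.trans (Nat.mul_le_mul_left _ hK), hQ σ' he.frame hR⟩

theorem setN {x : ℕ} {e : NExp} (hK : 1 ≤ K)
    (h : Q { σ with nv := Function.update σ.nv x (e.eval σ) }) : Runs I (.setN x e) σ K Q :=
  ⟨_, _, Exec.setN x e σ, Nat.le_mul_of_pos_right _ hK, h⟩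

theorem setR {x : ℕ} {e : RExp} (hK : 1 ≤ K)
    (h : Q { σ with rv := Function.update σ.rv x (e.eval I σ) }) : Runs I (.setR x e) σ K Q :=
  ⟨_, _, Exec.setR x e σ, Nat.le_mul_of_pos_right _ hK, h⟩

theorem putN {a : ℕ} {i e : NExp} (hK : 1 ≤ K)
    (h : Q { σ with na := update₂ σ.na a (i.eval σ) (e.eval σ) }) : Runs I (.putN a i e) σ K Q :=
  ⟨_, _, Exec.putN a i e σ, Nat.le_mul_of_pos_right _ hK, h⟩

theorem putR {a : ℕ} {i : NExp} {e : RExp} (hK : 1 ≤ K)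
    (h : Q { σ with ra := update₂ σ.ra a (i.eval σ) (e.eval I σ) }) :
    Runs I (.putR a i e) σ K Q :=
  ⟨_, _, Exec.putR a i e σ, Nat.le_mul_of_pos_right _ hK, h⟩

/-- Sizes add, so both halves share the same `K`. Only loops enlarge the factor, which reduces the
time analysis to loop bounds. -/
theorem seq (h : Runs I p σ K fun σ' => Runs I q σ' K Q) : Runs I (.seq p q) σ K Q := by
  obtain ⟨t, σ', he, ht, t', σ'', he', ht', hQ⟩ := h
  exact ⟨_, _, Exec.seq he he', by simp only [Cmd.size, add_mul]; omega, hQ⟩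

theorem ite (hK : 1 ≤ K) (h1 : b.Holds I σ → Runs I p σ K Q)
    (h2 : ¬ b.Holds I σ → Runs I q σ K Q) : Runs I (.ite b p q) σ K Q := by
  have hb : b.cost + 1 ≤ (b.cost + 1) * K := Nat.le_mul_of_pos_right _ hK
  by_cases h : b.Holds I σ
  · obtain ⟨t, σ', he, ht, hQ⟩ := h1 h
    refine ⟨_, _, Exec.ite_true h he, ?_, hQ⟩
    have : (Cmd.ite b p q).size * K = (b.cost + 1) * K + p.size * K + q.size * K := by
      simp only [Cmd.size, add_mul]
    omega
  · obtain ⟨t, σ', he, ht, hQ⟩ := h2 h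
    refine ⟨_, _, Exec.ite_false h he, ?_, hQ⟩
    have : (Cmd.ite b p q).size * K = (b.cost + 1) * K + p.size * K + q.size * K := by
      simp only [Cmd.size, add_mul]
    omega

/-- Induction on the number `m` of rounds still allowed. Termination comes from `step`: a round that
is entered has index below `N`. -/
theorem while_from (N : ℕ) (Inv : ℕ → RAMState → Prop) (hK : 1 ≤ K)
    (step : ∀ i σ', Frame p σ σ' → Inv i σ' → b.Holds I σ' → i < N ∧ Runs I p σ' K (Inv (i + 1)))
    (m i : ℕ) (him : i + m = N) (σ₁ : RAMState) (hF : Frame p σ σ₁) (h : Inv i σ₁) :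
    ∃ t σ', Exec I (.while b p) σ₁ t σ' ∧ t ≤ (b.cost + 1 + p.size) * K * m + (b.cost + 1) ∧
      Frame p σ σ' ∧ ∃ j ≤ N, Inv j σ' ∧ ¬ b.Holds I σ' := by
  induction m generalizing i σ₁ with
  | zero =>
    have hb : ¬ b.Holds I σ₁ := fun hb => by have := (step i σ₁ hF h hb).1; omega
    exact ⟨_, _, Exec.while_false hb, by omega, hF, i, by omega, h, hb⟩
  | succ m ih =>
    by_cases hb : b.Holds I σ₁
    · obtain ⟨-, t, σ₂, he, ht, h2⟩ := step i σ₁ hF h hb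
      obtain ⟨t', σ₃, he', ht', hF', h3⟩ := ih (i + 1) (by omega) σ₂ (hF.trans he.frame) h2
      refine ⟨_, _, Exec.while_true hb he he', ?_, hF', h3⟩
      have hb : b.cost + 1 ≤ (b.cost + 1) * K := Nat.le_mul_of_pos_right _ hK
      have : (b.cost + 1 + p.size) * K * (m + 1)
          = (b.cost + 1 + p.size) * K * m + ((b.cost + 1) * K + p.size * K) := by ring
      omega
    · exact ⟨_, _, Exec.while_false hb, by omega, hF, i, by omega, h, hb⟩

theorem whileLoop (N : ℕ) (Inv : ℕ → RAMState → Prop) (hK : 1 ≤ K) (h0 : Inv 0 σ)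
    (step : ∀ i σ', Frame p σ σ' → Inv i σ' → b.Holds I σ' → i < N ∧ Runs I p σ' K (Inv (i + 1)))
    (hQ : ∀ i σ', Frame p σ σ' → i ≤ N → Inv i σ' → ¬ b.Holds I σ' → Q σ') :
    Runs I (.while b p) σ (K * (N + 1)) Q := by
  obtain ⟨t, σ', he, ht, hF, j, hj, hI, hb⟩ :=
    while_from N Inv hK step N 0 (by omega) σ (Frame.refl _ _) h0
  refine ⟨t, σ', he, ht.trans ?_, hQ j σ' hF hj hI hb⟩
  have : (Cmd.while b p).size * (K * (N + 1))
      = (b.cost + 1 + p.size) * K * N + (b.cost + 1 + p.size) * K := by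
    simp only [Cmd.size]; ring
  have hb : b.cost + 1 ≤ (b.cost + 1) * K := Nat.le_mul_of_pos_right _ hK
  have : (b.cost + 1 + p.size) * K = (b.cost + 1) * K + p.size * K := by ring
  omega

end Runs

/-! ### Derived commands -/

/-- Count register `x` up to the value of register `l`, executing `p` each time. -/
def forUp (x l : ℕ) (p : Cmd) : Cmd :=
  .while (.not (.nle (.var l) (.var x))) (p.seq (.setN x (.add (.var x) (.lit 1))))

/-- Register `99` is reserved for this no-op, hence the side conditions that other registers differ
from it. -/
def skipCmd : Cmd := .setN 99 (.var 99)

def whenCmd (b : BExp) (p : Cmd) : Cmd := .ite b p skipCmd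

namespace Runs

variable {I : RKCInstance} {p : Cmd} {b : BExp} {σ : RAMState} {K : ℕ} {Q : RAMState → Prop}

theorem skip (hK : 1 ≤ K) (h : Q σ) : Runs I skipCmd σ K Q := by
  refine Runs.setN hK ?_
  simpa [NExp.eval] using h

theorem when (hK : 1 ≤ K) (h1 : b.Holds I σ → Runs I p σ K Q) (h2 : ¬ b.Holds I σ → Q σ) :
    Runs I (whenCmd b p) σ K Q :=
  Runs.ite hK h1 fun h => Runs.skip hK (h2 h)

/-- The body has to establish the next invariant with the counter already advanced, so that the
final increment never appears in applications. -/
theorem forUp {x l a N : ℕ} (Inv : ℕ → RAMState → Prop) (hK : 1 ≤ K) (hx : σ.nv x = a)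
    (hl : σ.nv l = N) (ha : a ≤ N) (hpx : p.wN x = false) (hpl : p.wN l = false) (hxl : x ≠ l)
    (h0 : Inv a σ)
    (step : ∀ i σ', a ≤ i → i < N → Frame (forUp x l p) σ σ' → σ'.nv x = i → Inv i σ' →
      Runs I p σ' K fun σ'' => Inv (i + 1) { σ'' with nv := Function.update σ''.nv x (i + 1) }) :
    Runs I (forUp x l p) σ (K * (N + 1)) fun σ' => σ'.nv x = N ∧ Inv N σ' := by
  -- Rounds are numbered from zero, so the counter in round `i` is `i + a`.
  refine Runs.whileLoop (K := K) N
    (fun i σ' => i + a ≤ N ∧ σ'.nv x = i + a ∧ Inv (i + a) σ') hK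
    ⟨by omega, by omega, by simpa using h0⟩ ?_ ?_
  · rintro i σ' hF ⟨h1, h2, h3⟩ hb
    have hlN : σ'.nv l = N := by
      rw [hF.nv l, hl]
      simp only [Cmd.wN, hpl, Bool.false_or, nat_beq_of_ne hxl]
    simp only [BExp.Holds, NExp.eval, h2, hlN, not_le] at hb
    refine ⟨by omega, Runs.seq ?_⟩
    refine (step (i + a) σ' (by omega) hb ⟨hF.nv, hF.rv, hF.na, hF.ra⟩ h2 h3).conseq le_rfl fun σ'' hF' h4 => ?_
    refine Runs.setN hK ?_
    have : σ''.nv x = i + a := by rw [hF'.nv x hpx, h2]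
    refine ⟨by omega, by simp [NExp.eval, this]; omega, ?_⟩
    simp only [NExp.eval, this]
    convert h4 using 1
    omega
  · rintro i σ' hF - ⟨h1, h2, h3⟩ hb
    have hlN : σ'.nv l = N := by
      rw [hF.nv l, hl]
      simp only [Cmd.wN, hpl, Bool.false_or, nat_beq_of_ne hxl]
    simp only [BExp.Holds, NExp.eval, h2, hlN, not_not] at hb
    have : i + a = N := by omega
    rw [this] at h2 h3
    exact ⟨h2, h3⟩

end Runs

/-- `A[i] ← e(i)` for all `i` below the value of register `l`, where `x` holds `i`. -/
def fillN (a x l : ℕ) (e : NExp) : Cmd :=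
  .seq (.setN x (.lit 0)) (forUp x l (.putN a (.var x) e))

def fillR (a x l : ℕ) (e : RExp) : Cmd :=
  .seq (.setN x (.lit 0)) (forUp x l (.putR a (.var x) e))

/-- Search for an index `i` (in register `i`) that satisfies `b` and has the smallest key; `ki` and
`kx` are the keys of the current and the best index. The result `x` is the upper limit if there is
no such index. -/
def argmin (x i l : ℕ) (b : BExp) (ki kx : RExp) : Cmd :=
  .seq (.setN x (.var l)) (.seq (.setN i (.lit 0)) (forUp i l
    (whenCmd (.and b (.not (.and (.not (.nle (.var l) (.var x))) (.rle kx ki))))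
      (.setN x (.var i)))))

theorem Runs.fillN {I : RKCInstance} {σ : RAMState} {a x l N : ℕ} {e : NExp} (g : ℕ → ℕ)
    (hxl : x ≠ l) (hl : σ.nv l = N)
    (he : ∀ i σ', i < N → Frame (fillN a x l e) σ σ' → σ'.nv x = i → σ'.na a i = σ.na a i →
      e.eval σ' = g i) :
    Runs I (fillN a x l e) σ (N + 1) fun σ' =>
      (∀ i < N, σ'.na a i = g i) ∧ ∀ i, N ≤ i → σ'.na a i = σ.na a i := by
  refine Runs.seq (Runs.setN (by omega) ?_)
  set σ₁ : RAMState := { σ with nv := Function.update σ.nv x (NExp.eval σ (.lit 0)) } with hσ₁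
  have hF₁ : Frame (_root_.fillN a x l e) σ σ₁ := by
    refine ⟨fun y hy => ?_, fun _ _ => rfl, fun _ _ => rfl, fun _ _ => rfl⟩
    have : y ≠ x := by rintro rfl; simp [_root_.fillN, Cmd.wN] at hy
    simp [hσ₁, this]
  refine (Runs.forUp (K := 1) (a := 0) (N := N) (fun i σ' =>
      (∀ k < i, σ'.na a k = g k) ∧ ∀ k, i ≤ k → σ'.na a k = σ.na a k) le_rfl
      (by simp [hσ₁, NExp.eval]) (by simp [hσ₁, hl, Ne.symm hxl]) (Nat.zero_le _) rfl rfl hxl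
      ⟨by simp, by simp [hσ₁]⟩ ?_).conseq (by omega) (fun σ' _ h => h.2)
  rintro i σ' - hi hF hx ⟨h1, h2⟩
  refine Runs.putN le_rfl ?_
  have hF' : Frame (_root_.fillN a x l e) σ σ' := hF₁.trans (hF.of_imp
    (by simp +contextual [Cmd.wN, _root_.fillN]) (by simp +contextual [Cmd.wR, _root_.fillN])
    (by simp +contextual [Cmd.wNA, _root_.fillN]) (by simp +contextual [Cmd.wRA, _root_.fillN]))
  have hev := he i σ' hi hF' hx (h2 i le_rfl)
  simp only [update₂_self, hev, NExp.eval, hx]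
  constructor
  · intro k hk
    rcases Nat.lt_succ_iff_lt_or_eq.1 hk with hk | rfl
    · rw [Function.update_of_ne (by omega)]; exact h1 k hk
    · simp
  · intro k hk
    rw [Function.update_of_ne (by omega)]; exact h2 k (by omega)

theorem Runs.fillR {I : RKCInstance} {σ : RAMState} {a x l N : ℕ} {e : RExp} (g : ℕ → ℝ)
    (hxl : x ≠ l) (hl : σ.nv l = N)
    (he : ∀ i σ', i < N → Frame (fillR a x l e) σ σ' → σ'.nv x = i → σ'.ra a i = σ.ra a i →
      e.eval I σ' = g i) :
    Runs I (fillR a x l e) σ (N + 1) fun σ' =>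
      (∀ i < N, σ'.ra a i = g i) ∧ ∀ i, N ≤ i → σ'.ra a i = σ.ra a i := by
  refine Runs.seq (Runs.setN (by omega) ?_)
  set σ₁ : RAMState := { σ with nv := Function.update σ.nv x (NExp.eval σ (.lit 0)) } with hσ₁
  have hF₁ : Frame (_root_.fillR a x l e) σ σ₁ := by
    refine ⟨fun y hy => ?_, fun _ _ => rfl, fun _ _ => rfl, fun _ _ => rfl⟩
    have : y ≠ x := by rintro rfl; simp [_root_.fillR, Cmd.wN] at hy
    simp [hσ₁, this]
  refine (Runs.forUp (K := 1) (a := 0) (N := N) (fun i σ' =>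
      (∀ k < i, σ'.ra a k = g k) ∧ ∀ k, i ≤ k → σ'.ra a k = σ.ra a k) le_rfl
      (by simp [hσ₁, NExp.eval]) (by simp [hσ₁, hl, Ne.symm hxl]) (Nat.zero_le _) rfl rfl hxl
      ⟨by simp, by simp [hσ₁]⟩ ?_).conseq (by omega) (fun σ' _ h => h.2)
  rintro i σ' - hi hF hx ⟨h1, h2⟩
  refine Runs.putR le_rfl ?_
  have hF' : Frame (_root_.fillR a x l e) σ σ' := hF₁.trans (hF.of_imp
    (by simp +contextual [Cmd.wN, _root_.fillR]) (by simp +contextual [Cmd.wR, _root_.fillR])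
    (by simp +contextual [Cmd.wNA, _root_.fillR]) (by simp +contextual [Cmd.wRA, _root_.fillR]))
  have hev := he i σ' hi hF' hx (h2 i le_rfl)
  simp only [update₂_self, hev, NExp.eval, hx]
  constructor
  · intro k hk
    rcases Nat.lt_succ_iff_lt_or_eq.1 hk with hk | rfl
    · rw [Function.update_of_ne (by omega)]; exact h1 k hk
    · simp
  · intro k hk
    rw [Function.update_of_ne (by omega)]; exact h2 k (by omega)

/-- The value `N` in `x` is a sentinel for "nothing found yet", so the key `kx` of the best index is
specified, and used, only while `x` is below `N`. -/
theorem Runs.argmin {I : RKCInstance} {σ : RAMState} {x i l N : ℕ} {b : BExp} {ki kx : RExp}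
    (P : ℕ → Prop) (f : ℕ → ℝ) (hxi : x ≠ i) (hxl : x ≠ l) (hil : i ≠ l) (hx9 : x ≠ 99)
    (hi9 : i ≠ 99) (hl9 : l ≠ 99) (hl : σ.nv l = N)
    (hb : ∀ σ', Frame (argmin x i l b ki kx) σ σ' → σ'.nv i < N →
      (b.Holds I σ' ↔ P (σ'.nv i)))
    (hki : ∀ σ', Frame (argmin x i l b ki kx) σ σ' → σ'.nv i < N → ki.eval I σ' = f (σ'.nv i))
    (hkx : ∀ σ', Frame (argmin x i l b ki kx) σ σ' → σ'.nv x < N → kx.eval I σ' = f (σ'.nv x)) :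
    Runs I (argmin x i l b ki kx) σ (N + 1) fun σ' =>
      (σ'.nv x = N ∧ ∀ k < N, ¬ P k) ∨
      (σ'.nv x < N ∧ P (σ'.nv x) ∧ ∀ k < N, P k → f (σ'.nv x) ≤ f k) := by
  refine Runs.seq (Runs.setN (by omega) (Runs.seq (Runs.setN (by omega) ?_)))
  set σ₁ : RAMState := 
    { σ with nv := Function.update (Function.update σ.nv x (σ.nv l)) i 0 } with hσ₁
  have hF₁ : Frame (_root_.argmin x i l b ki kx) σ σ₁ := by
    refine ⟨fun y hy => ?_, fun _ _ => rfl, fun _ _ => rfl, fun _ _ => rfl⟩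
    have h1 : y ≠ x := by rintro rfl; simp [_root_.argmin, Cmd.wN] at hy
    have h2 : y ≠ i := by rintro rfl; simp [_root_.argmin, Cmd.wN] at hy
    simp [hσ₁, h1, h2]
  have e1 : Nat.beq x i = false := nat_beq_of_ne hxi
  have e2 : Nat.beq x l = false := nat_beq_of_ne hxl
  have e3 : Nat.beq 99 i = false := nat_beq_of_ne hi9.symm
  have e4 : Nat.beq 99 l = false := nat_beq_of_ne hl9.symm
  have hl1 : σ₁.nv l = N := by simp [hσ₁, hl, Ne.symm hxl, Ne.symm hil]
  refine (Runs.forUp (K := 1) (a := 0) (N := N) (fun j σ' =>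
      (σ'.nv x = N ∧ ∀ k < j, ¬ P k) ∨
      (σ'.nv x < N ∧ P (σ'.nv x) ∧ ∀ k < j, P k → f (σ'.nv x) ≤ f k)) le_rfl
      (by simp [hσ₁]) hl1 (Nat.zero_le _)
      (by simp [whenCmd, skipCmd, Cmd.wN, e1, e3]) (by simp [whenCmd, skipCmd, Cmd.wN, e2, e4]) hil
      (Or.inl ⟨by simp [hσ₁, hl, hxi], by simp⟩) ?_).conseq (by omega) (fun σ' _ h => h.2)
  rintro j σ' - hj hF hx hInv
  have hlN : σ'.nv l = N := by
    rw [hF.nv l, hl1]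
    simp [_root_.forUp, whenCmd, skipCmd, Cmd.wN, e2, e4, nat_beq_of_ne hil]
  have hF' : Frame (_root_.argmin x i l b ki kx) σ σ' := hF₁.trans (hF.of_imp
    (by simp +contextual [Cmd.wN, _root_.argmin]) (by simp +contextual [Cmd.wR, _root_.argmin])
    (by simp +contextual [Cmd.wNA, _root_.argmin]) (by simp +contextual [Cmd.wRA, _root_.argmin]))
  have hb' := hb σ' hF' (by omega)
  have hki' := hki σ' hF' (by omega)
  have hkx' := hkx σ' hF'
  rw [hx] at hb' hki'
  refine Runs.when le_rfl (fun hc => Runs.setN le_rfl ?_) (fun hc => ?_)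
  · simp only [BExp.Holds, NExp.eval, hlN, hb', hki'] at hc
    refine Or.inr ?_
    simp only [NExp.eval, hx, Function.update_of_ne hxi, Function.update_self]
    refine ⟨hj, hc.1, fun k hk hPk => ?_⟩
    rcases Nat.lt_succ_iff_lt_or_eq.1 hk with hk | rfl
    · rcases hInv with hInv | ⟨h1, h2, h3⟩
      · exact absurd hPk (hInv.2 k hk)
      · rw [hkx' h1] at hc
        have := hc.2
        push Not at this
        exact (this h1).le.trans (h3 k hk hPk)
    · exact le_rfl
  · simp only [BExp.Holds, NExp.eval, hlN, hb', hki'] at hc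
    simp only [Function.update_of_ne hxi]
    rcases hInv with ⟨h1, h2⟩ | ⟨h1, h2, h3⟩
    · refine Or.inl ⟨h1, fun k hk => ?_⟩
      rcases Nat.lt_succ_iff_lt_or_eq.1 hk with hk | rfl
      · exact h2 k hk
      · intro hP; exact hc ⟨hP, by simp [h1]⟩
    · refine Or.inr ⟨h1, h2, fun k hk hPk => ?_⟩
      rcases Nat.lt_succ_iff_lt_or_eq.1 hk with hk | rfl
      · exact h3 k hk hPk
      · rw [hkx' h1] at hc
        by_contra hlt
        exact hc ⟨hPk, fun h => hlt h.2⟩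

/-! ### Robust knapsack center with multiplicities on index sets -/

open Finset in
/-- The indices that are not within distance `r` of `S`. -/
noncomputable def uncovered (q : ℕ) (δ : ℕ → ℕ → ℝ) (r : ℝ) (S : Finset ℕ) : Finset ℕ :=
  open Classical in (range q).filter fun a => ∀ c ∈ S, r < δ a c

open Finset in
/-- `S` is a solution of radius `r`: it satisfies the knapsack constraint and leaves points of
total multiplicity at most `z` uncovered. -/
structure Feasible (q : ℕ) (δ : ℕ → ℕ → ℝ) (ω : ℕ → ℝ) (μ : ℕ → ℕ) (z : ℕ) (r : ℝ)
    (S : Finset ℕ) : Prop where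
  sub : S ⊆ range q
  weight : ∑ a ∈ S, ω a ≤ 1
  out : ∑ a ∈ uncovered q δ r S, μ a ≤ z

structure IndexMetric (q : ℕ) (δ : ℕ → ℕ → ℝ) : Prop where
  self : ∀ a < q, δ a a = 0
  symm : ∀ a < q, ∀ b < q, δ a b = δ b a
  tri : ∀ a < q, ∀ b < q, ∀ c < q, δ a c ≤ δ a b + δ b c

/-- A greedy clustering with respect to the scores `X`: `ρ u` is the center of the cluster of `u`. -/
structure Clustering (q : ℕ) (δ : ℕ → ℕ → ℝ) (X : ℕ → ℕ) (r : ℝ) (ρ : ℕ → ℕ) : Prop where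
  lt : ∀ u < q, ρ u < q
  idem : ∀ u < q, ρ (ρ u) = ρ u
  near : ∀ u < q, δ (ρ u) u ≤ r + r
  score : ∀ u < q, X (ρ u) ≤ X u
  far : ∀ u < q, ∀ v < q, ρ u ≠ ρ v → r + r < δ (ρ u) (ρ v)

open Finset in
/-- The total multiplicity of the cluster of `v`. -/
def clusterMult (q : ℕ) (μ ρ : ℕ → ℕ) (v : ℕ) : ℕ := ∑ u ∈ range q with ρ u = v, μ u

/-- `B v` is an index of minimum weight in the ball of radius `r` around `v`. -/
structure LightestInBall (q : ℕ) (δ : ℕ → ℕ → ℝ) (ω : ℕ → ℝ) (r : ℝ) (B : ℕ → ℕ) : Prop where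
  lt : ∀ v < q, B v < q
  near : ∀ v < q, δ v (B v) ≤ r
  le : ∀ v < q, ∀ c < q, δ v c ≤ r → ω (B v) ≤ ω c

open Finset in
/-- Clusters `Q` can be served by balls of total weight at most `1` such that the other clusters
have total multiplicity at most `z`. -/
def Selectable (q : ℕ) (A : ℕ → ℕ) (W : ℕ → ℝ) (z : ℕ) (Q : Finset ℕ) : Prop :=
  Q ⊆ range q ∧ ∑ v ∈ range q \ Q, A v ≤ z ∧ ∑ v ∈ Q, W v ≤ 1

section Combinatorics
open Finset

variable {q z : ℕ} {δ : ℕ → ℕ → ℝ} {ω : ℕ → ℝ} {μ X ρ B : ℕ → ℕ} {r : ℝ}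

theorem mem_uncovered {S : Finset ℕ} {a : ℕ} :
    a ∈ uncovered q δ r S ↔ a < q ∧ ∀ c ∈ S, r < δ a c := by
  simp [uncovered]

theorem Clustering.sum_clusterMult (h : Clustering q δ X r ρ) (f : ℕ → ℕ) :
    ∑ v ∈ range q, clusterMult q μ ρ v * f v = ∑ u ∈ range q, μ u * f (ρ u) := by
  rw [← sum_fiberwise_of_maps_to (s := range q) (t := range q) (g := ρ)
    (f := fun u => μ u * f (ρ u))
    (fun u hu => mem_range.2 (h.lt u (mem_range.1 hu)))]
  refine sum_congr rfl fun v _ => ?_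
  rw [clusterMult, sum_mul]
  refine sum_congr rfl fun u hu => ?_
  rw [(mem_filter.1 hu).2]

/-- Every point hands its multiplicity to a center whose score does not exceed its own. -/
theorem Clustering.dominated (h : Clustering q δ X r ρ) :
    ∑ v ∈ range q, clusterMult q μ ρ v * X v ≤ ∑ u ∈ range q, μ u * X u := by
  rw [h.sum_clusterMult X]
  exact sum_le_sum fun u hu => Nat.mul_le_mul_left _ (h.score u (mem_range.1 hu))

theorem clusterMult_eq_zero (h : Clustering q δ X r ρ) {v : ℕ} (hv : ρ v ≠ v) :
    clusterMult q μ ρ v = 0 := by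
  rw [clusterMult, filter_eq_empty_iff.2, sum_empty]
  intro u hu huv
  apply hv
  have := h.idem u (mem_range.1 hu)
  rwa [huv] at this

/-- A solution of radius `r` yields a selection of clusters, or many uncovered centers. -/
theorem Feasible.lt_sum_clusterMult (hm : IndexMetric q δ) (hω : ∀ a < q, 0 ≤ ω a)
    (hB : LightestInBall q δ ω r B) (hc : Clustering q δ X r ρ) {S : Finset ℕ}
    (hS : Feasible q δ ω μ z r S)
    (hno : ¬ ∃ Q, Selectable q (clusterMult q μ ρ) (fun v => ω (B v)) z Q) :
    z < ∑ v ∈ uncovered q δ r S, clusterMult q μ ρ v := by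
  by_contra hle
  push Not at hle
  classical
  apply hno
  -- Select the clusters whose centers are covered by `S`. Indices that are not centers have cluster
  -- multiplicity zero, so only uncovered centers count as left out.
  refine ⟨(range q).filter fun v => ρ v = v ∧ v ∉ uncovered q δ r S, filter_subset _ _, ?_, ?_⟩
  · refine le_trans ?_ hle
    rw [← sum_filter_add_sum_filter_not (s := uncovered q δ r S) (p := fun v => ρ v = v)]
    refine le_trans (le_of_eq ?_) (Nat.le_add_right _ _)
    refine (sum_subset_zero_on_sdiff ?_ ?_ fun _ _ => rfl).symm
    · intro v hv
      rw [mem_filter, mem_uncovered] at hv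
      simp only [mem_sdiff, mem_range, mem_filter, mem_uncovered]
      tauto
    · intro v hv
      apply clusterMult_eq_zero hc
      intro h
      simp only [mem_sdiff, mem_range, mem_filter, not_and, not_not] at hv
      exact hv.2 (hv.1.2 hv.1.1 h) h
  · have key : ∀ v ∈ (range q).filter fun v => ρ v = v ∧ v ∉ uncovered q δ r S,
        ∃ c ∈ S, δ v c ≤ r := by
      intro v hv
      simp only [mem_filter, mem_uncovered, mem_range] at hv
      obtain ⟨h1, h2, h3⟩ := hv
      by_contra hcon
      push Not at hcon
      exact h3 ⟨h1, hcon⟩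
    choose! c hcS hcr using key
    refine le_trans ?_ hS.weight
    -- Charge each selected cluster to a point `c v` of `S` near its center. Centers are more than
    -- `2 r` apart, so no point of `S` is charged twice.
    calc _ ≤ ∑ v ∈ (range q).filter fun v => ρ v = v ∧ v ∉ uncovered q δ r S, ω (c v) := by
          refine sum_le_sum fun v hv => ?_
          exact hB.le v (mem_range.1 (mem_filter.1 hv).1) _ (mem_range.1 (hS.sub (hcS v hv)))
            (hcr v hv)
      _ = ∑ a ∈ ((range q).filter fun v => ρ v = v ∧ v ∉ uncovered q δ r S).image c, ω a := by
          rw [sum_image]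
          intro v hv v' hv' hvv
          by_contra hne
          have hv := mem_coe.1 hv
          have hv' := mem_coe.1 hv'
          have h1 := mem_range.1 (mem_filter.1 hv).1
          have h2 := mem_range.1 (mem_filter.1 hv').1
          have e1 := (mem_filter.1 hv).2.1
          have e2 := (mem_filter.1 hv').2.1
          have hcq := mem_range.1 (hS.sub (hcS v hv))
          have := hc.far v h1 v' h2 (by rw [e1, e2]; exact hne)
          rw [e1, e2] at this
          have h3 := hm.tri v h1 (c v) hcq v' h2
          have h4 := hcr v hv
          have h5 := hcr v' hv'
          have h6 := hm.symm (c v) hcq v' h2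
          rw [← show c v = c v' from hvv] at h5
          linarith
      _ ≤ _ := sum_le_sum_of_subset_of_nonneg
          (image_subset_iff.2 fun v hv => hcS v hv)
          (fun a ha _ => hω a (mem_range.1 (hS.sub ha)))

/-- A point is within `2 r` of its center, which is within `r` of the lightest point chosen for it;
this is the factor 3. Coinciding choices only make the image lighter. -/
theorem Selectable.feasible (hm : IndexMetric q δ) (hω : ∀ a < q, 0 ≤ ω a)
    (hB : LightestInBall q δ ω r B) (hc : Clustering q δ X r ρ) {Q : Finset ℕ}
    (hQ : Selectable q (clusterMult q μ ρ) (fun v => ω (B v)) z Q) :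
    Feasible q δ ω μ z (3 * r) (Q.image B) := by
  have hsub : Q.image B ⊆ range q := image_subset_iff.2 fun v hv =>
    mem_range.2 (hB.lt v (mem_range.1 (hQ.1 hv)))
  refine ⟨hsub, ?_, ?_⟩
  · refine (sum_image_le_of_nonneg ?_).trans hQ.2.2
    exact fun a ha => hω a (mem_range.1 (hsub ha))
  · refine le_trans ?_ hQ.2.1
    calc ∑ a ∈ uncovered q δ (3 * r) (Q.image B), μ a
        ≤ ∑ a ∈ (range q).filter (fun u => ρ u ∈ range q \ Q), μ a := by
          refine sum_le_sum_of_subset fun u hu => ?_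
          rw [mem_uncovered] at hu
          rw [mem_filter, mem_sdiff, mem_range, mem_range]
          refine ⟨hu.1, hc.lt u hu.1, fun hmem => ?_⟩
          have h1 := hu.2 _ (mem_image_of_mem B hmem)
          have hl := hc.lt u hu.1
          have h2 := hm.tri u hu.1 (ρ u) hl (B (ρ u)) (hB.lt _ hl)
          have h3 := hm.symm u hu.1 (ρ u) hl
          have h4 := hc.near u hu.1
          have h5 := hB.near (ρ u) hl
          linarith
      _ = ∑ v ∈ range q \ Q, clusterMult q μ ρ v := by
          rw [← sum_fiberwise_of_maps_to (g := ρ) (t := range q \ Q)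
            (fun u hu => (mem_filter.1 hu).2)]
          refine sum_congr rfl fun v hv => ?_
          rw [clusterMult]
          congr 1
          ext u
          simp only [mem_filter]
          constructor
          · rintro ⟨⟨h1, -⟩, h2⟩; exact ⟨h1, h2⟩
          · rintro ⟨h1, rfl⟩; exact ⟨⟨h1, hv⟩, rfl⟩

/-! ### The perceptron argument. -/

/-- The bound on the squared length of the steps of the perceptron. -/
def stepBound (q z : ℕ) : ℕ := q * (q * (z + 1)) ^ 2

/-- The squared distance of `X` to a multiple of the indicator of the points uncovered by `S`. -/
noncomputable def potential (q z : ℕ) (δ : ℕ → ℕ → ℝ) (r : ℝ) (S : Finset ℕ) (X : ℕ → ℕ) : ℤ :=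
  ∑ a ∈ range q, ((X a : ℤ) - stepBound q z * (if a ∈ uncovered q δ r S then 1 else 0)) ^ 2

theorem clusterMult_le (hμ : ∀ a < q, μ a ≤ z + 1) (v : ℕ) :
    clusterMult q μ ρ v ≤ q * (z + 1) := by
  calc clusterMult q μ ρ v ≤ ∑ u ∈ range q, μ u := sum_le_sum_of_subset (filter_subset _ _)
    _ ≤ ∑ u ∈ range q, (z + 1) := sum_le_sum fun u hu => hμ u (mem_range.1 hu)
    _ = _ := by simp

/-- Let `A` be the cluster multiplicities, `x` the indicator of the points uncovered by `S` and `L =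
stepBound q z`. The step `A - μ` has inner product at most `0` with the scores and at least `1` with
`x`, the latter because `A` gives `x` at least `z + 1` and `μ` at most `z`. Hence the cross terms of
the squared distance to `L x` contribute at most `-2 L`, against a squared step length of at most
`L`. -/
theorem potential_step (hμ : ∀ a < q, μ a ≤ z + 1) (hm : IndexMetric q δ)
    (hω : ∀ a < q, 0 ≤ ω a)
    (hB : LightestInBall q δ ω r B) (hc : Clustering q δ X r ρ) {S : Finset ℕ}
    (hS : Feasible q δ ω μ z r S)
    (hno : ¬ ∃ Q, Selectable q (clusterMult q μ ρ) (fun v => ω (B v)) z Q) {X' : ℕ → ℕ}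
    (hX' : ∀ a < q, X' a = X a + clusterMult q μ ρ a - μ a) :
    potential q z δ r S X' + stepBound q z ≤ potential q z δ r S X := by
  set L : ℤ := (stepBound q z : ℤ) with hL
  set x : ℕ → ℤ := fun a => if a ∈ uncovered q δ r S then 1 else 0 with hx
  set A : ℕ → ℤ := fun a => (clusterMult q μ ρ a : ℤ) with hA
  have hL0 : 0 ≤ L := by positivity
  -- Truncating a negative score to zero only brings it closer to the nonnegative coordinate of `L
  -- x`.
  have h1 : potential q z δ r S X' ≤
      ∑ a ∈ range q, ((X a : ℤ) - L * x a + (A a - μ a)) ^ 2 := by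
    refine sum_le_sum fun a ha => ?_
    have hxa : 0 ≤ L * x a := mul_nonneg hL0 (by simp only [hx]; split_ifs <;> norm_num)
    change ((X' a : ℤ) - L * x a) ^ 2 ≤ _
    rw [hX' a (mem_range.1 ha)]
    rcases le_total (μ a) (X a + clusterMult q μ ρ a) with h | h
    · apply le_of_eq
      push_cast [Nat.cast_sub h]
      simp only [hA]; ring
    · rw [Nat.sub_eq_zero_of_le h]
      have : (X a : ℤ) + A a ≤ μ a := by simp only [hA]; exact_mod_cast h
      have e : (X a : ℤ) - L * x a + (A a - μ a) = (X a + A a - μ a) - L * x a := by ring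
      rw [e]
      push_cast
      nlinarith
  have h2 : ∑ a ∈ range q, ((X a : ℤ) - L * x a + (A a - μ a)) ^ 2
      = potential q z δ r S X + 2 * (∑ a ∈ range q, A a * X a - ∑ a ∈ range q, (μ a : ℤ) * X a)
        - 2 * L * (∑ a ∈ range q, A a * x a - ∑ a ∈ range q, (μ a : ℤ) * x a)
        + ∑ a ∈ range q, (A a - μ a) ^ 2 := by
    rw [potential, ← sum_sub_distrib, ← sum_sub_distrib, mul_sum, mul_sum, ← sum_add_distrib,
      ← sum_sub_distrib, ← sum_add_distrib]
    refine sum_congr rfl fun a _ => ?_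
    change _ = ((X a : ℤ) - L * x a) ^ 2 + _ - _ + _
    ring
  have h3 : ∑ a ∈ range q, A a * X a ≤ ∑ a ∈ range q, (μ a : ℤ) * X a := by
    have := hc.dominated (μ := μ)
    simp only [hA]
    exact_mod_cast this
  have hsum : ∀ f : ℕ → ℤ, ∑ a ∈ range q, f a * x a = ∑ a ∈ uncovered q δ r S, f a := by
    intro f
    simp only [hx, mul_ite, mul_one, mul_zero]
    rw [← sum_filter]
    congr 1
    ext a
    simp only [mem_filter, mem_range, and_iff_right_iff_imp]
    exact fun h => (mem_uncovered.1 h).1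
  have h4 : (z : ℤ) + 1 ≤ ∑ a ∈ range q, A a * x a := by
    rw [hsum]
    have := hS.lt_sum_clusterMult hm hω hB hc hno
    simp only [hA]
    exact_mod_cast this
  have h5 : ∑ a ∈ range q, (μ a : ℤ) * x a ≤ z := by
    rw [hsum]
    exact_mod_cast hS.out
  have h6 : ∑ a ∈ range q, (A a - μ a) ^ 2 ≤ L := by
    calc ∑ a ∈ range q, (A a - μ a) ^ 2 ≤ ∑ a ∈ range q, ((q * (z + 1) : ℕ) : ℤ) ^ 2 := by
          refine sum_le_sum fun a ha => ?_
          have ha' := mem_range.1 ha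
          have e1 : A a ≤ ((q * (z + 1) : ℕ) : ℤ) := by
            simp only [hA]; exact_mod_cast clusterMult_le hμ a
          have e2 : (μ a : ℤ) ≤ ((q * (z + 1) : ℕ) : ℤ) := by
            exact_mod_cast (hμ a ha').trans (Nat.le_mul_of_pos_left _ (by omega))
          have e3 : 0 ≤ A a := by simp only [hA]; positivity
          have e4 : (0 : ℤ) ≤ μ a := by positivity
          exact sq_le_sq' (by linarith) (by linarith)
      _ = L := by simp [hL, stepBound]
  nlinarith

theorem potential_zero (S : Finset ℕ) (hX : ∀ a < q, X a = 0) :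
    potential q z δ r S X ≤ (stepBound q z : ℤ) * (stepBound q z * q : ℕ) := by
  have : ∀ a ∈ range q,
      ((X a : ℤ) - stepBound q z * (if a ∈ uncovered q δ r S then 1 else 0)) ^ 2
        ≤ (stepBound q z : ℤ) ^ 2 := by
    intro a ha
    rw [hX a (mem_range.1 ha)]
    split_ifs
    · simp
    · simp
  refine (sum_le_sum this).trans (le_of_eq ?_)
  simp; ring

theorem potential_nonneg (S : Finset ℕ) : 0 ≤ potential q z δ r S X :=
  sum_nonneg fun _ _ => sq_nonneg _

/-! ### The knapsack table -/

open Classical in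
/-- Minimum weight of a selection from the first `v` clusters that leaves clusters of total
multiplicity at most `j`. -/
noncomputable def knapTable (A : ℕ → ℕ) (W : ℕ → ℝ) : ℕ → ℕ → ℝ
  | 0, _ => 0
  | v + 1, j =>
    if A v ≤ j ∧ knapTable A W v (j - A v) ≤ knapTable A W v j + W v
    then knapTable A W v (j - A v) else knapTable A W v j + W v

/-- A selection `Q` follows one of the branches that the recurrence compares. Only this lower bound
is needed here; that the table value is attained is shown by backtracking in `extractCmd_spec`. -/
theorem knapTable_le (A : ℕ → ℕ) (W : ℕ → ℝ) (k j : ℕ) (Q : Finset ℕ)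
    (h : ∑ v ∈ range k \ Q, A v ≤ j) : knapTable A W k j ≤ ∑ v ∈ range k ∩ Q, W v := by
  induction k generalizing j with
  | zero => simp [knapTable]
  | succ k ih =>
    by_cases hk : k ∈ Q
    · have e1 : range (k + 1) \ Q = range k \ Q := by
        rw [range_add_one, insert_sdiff_of_mem _ hk]
      have e2 : range (k + 1) ∩ Q = insert k (range k ∩ Q) := by
        rw [range_add_one, insert_inter_of_mem hk]
      rw [e1] at h
      rw [e2, sum_insert (by simp)]
      have := ih j h
      rw [knapTable]
      split_ifs with hc
      · linarith [hc.2]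
      · linarith
    · have e1 : range (k + 1) \ Q = insert k (range k \ Q) := by
        rw [range_add_one, insert_sdiff_of_notMem _ hk]
      have e2 : range (k + 1) ∩ Q = range k ∩ Q := by
        rw [range_add_one, insert_inter_of_notMem hk]
      rw [e1, sum_insert (by simp)] at h
      have := ih (j - A k) (by omega)
      rw [e2, knapTable]
      split_ifs with hc
      · exact this
      · have h1 : A k ≤ j := by omega
        have : ¬ knapTable A W k (j - A k) ≤ knapTable A W k j + W k := fun h => hc ⟨h1, h⟩
        linarith

theorem Selectable.knapTable_le {A : ℕ → ℕ} {W : ℕ → ℝ} {Q : Finset ℕ}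
    (h : Selectable q A W z Q) : knapTable A W q z ≤ 1 := by
  have := _root_.knapTable_le A W q z Q h.2.1
  rw [inter_eq_right.2 h.1] at this
  exact this.trans h.2.2

end Combinatorics

/-! ### Real-valued descriptions of the costs -/

theorem exists_eq_iInf_of_prop {ι : Type*} [Finite ι] (p : ι → Prop) (f : ι → ℝ≥0∞)
    (h : ∃ i, p i) : ∃ i, p i ∧ f i = ⨅ (i) (_ : p i), f i := by
  have : Nonempty {i // p i} := let ⟨i, hi⟩ := h; ⟨⟨i, hi⟩⟩
  obtain ⟨⟨i, hi⟩, h⟩ := exists_eq_ciInf_of_finite (f := fun i : {i // p i} => f i)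
  exact ⟨i, hi, by rw [h, iInf_subtype]⟩

/-- An infimum over finitely many candidates is attained, and without candidates it is `⊤`; the
latter is excluded by `hv`. This turns all costs into existence statements about real distances. -/
theorem iInf_prop_le_iff {ι : Type*} [Finite ι] (p : ι → Prop) (f : ι → ℝ≥0∞) {v : ℝ≥0∞}
    (hv : v < ⊤) : (⨅ (i) (_ : p i), f i) ≤ v ↔ ∃ i, p i ∧ f i ≤ v := by
  constructor
  · intro h
    by_cases hp : ∃ i, p i
    · obtain ⟨i, hi, h'⟩ := exists_eq_iInf_of_prop p f hp
      exact ⟨i, hi, h' ▸ h⟩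
    · push Not at hp
      have : (⨅ (i) (_ : p i), f i) = ⊤ := by simp [hp]
      rw [this] at h
      exact absurd (hv.trans_le h) (lt_irrefl _)
  · rintro ⟨i, hi, h⟩
    exact (iInf₂_le i hi).trans h

namespace RKCInstance

variable {I : RKCInstance}

theorem d_nonneg (i j : Fin I.n) : 0 ≤ I.d i j := by
  have h := I.d_triangle i j i
  rw [I.d_self, I.d_symm j i] at h
  linarith

theorem n_pos (I : RKCInstance) : 0 < I.n := (Nat.zero_le _).trans_lt I.z_lt

theorem distTo_le_iff {i : Fin I.n} {S : Finset (Fin I.n)} {R : ℝ} (hR : 0 ≤ R) :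
    I.distTo i S ≤ ENNReal.ofReal R ↔ ∃ c ∈ S, I.d i c ≤ R := by
  rw [distTo, Finset.inf_le_iff ENNReal.ofReal_lt_top]
  simp only [ENNReal.ofReal_le_ofReal_iff hR]

theorem cost_le_iff {S : Finset (Fin I.n)} {R : ℝ} (hR : 0 ≤ R) :
    I.cost S ≤ ENNReal.ofReal R ↔
      ∃ X : Finset (Fin I.n), I.n ≤ X.card + I.z ∧ ∀ i ∈ X, ∃ c ∈ S, I.d i c ≤ R := by
  rw [cost, iInf_prop_le_iff _ _ ENNReal.ofReal_lt_top]
  simp only [Finset.sup_le_iff, distTo_le_iff hR]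

theorem costMult_le_iff {T S : Finset (Fin I.n)} {m : Fin I.n → ℕ} {R : ℝ} (hR : 0 ≤ R) :
    I.costMult T m S ≤ ENNReal.ofReal R ↔
      ∃ X : Finset (Fin I.n), (X ⊆ T ∧ ∑ i ∈ T, m i ≤ ∑ i ∈ X, m i + I.z) ∧
        ∀ i ∈ X, ∃ c ∈ S, I.d i c ≤ R := by
  rw [costMult, iInf_prop_le_iff _ _ ENNReal.ofReal_lt_top]
  simp only [Finset.sup_le_iff, distTo_le_iff hR]

theorem opt_le_iff {R : ℝ} : I.opt ≤ ENNReal.ofReal R ↔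
    ∃ S, I.Fits S ∧ I.cost S ≤ ENNReal.ofReal R :=
  iInf_prop_le_iff _ _ ENNReal.ofReal_lt_top

theorem optMult_le_iff {T : Finset (Fin I.n)} {m : Fin I.n → ℕ} {R : ℝ} :
    I.optMult T m ≤ ENNReal.ofReal R ↔
      ∃ S, (S ⊆ T ∧ I.Fits S) ∧ I.costMult T m S ≤ ENNReal.ofReal R :=
  iInf_prop_le_iff _ _ ENNReal.ofReal_lt_top

theorem radius_le_iff {Γ : Finset (Fin I.n)} {R : ℝ} (hR : 0 ≤ R) :
    I.radius Γ ≤ ENNReal.ofReal R ↔ ∀ j, ∃ c ∈ Γ, I.d j c ≤ R := by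
  simp only [radius, Finset.sup_le_iff, distTo_le_iff hR, Finset.mem_univ, true_imp_iff]

theorem centerOpt_le_iff {τ : ℕ} {R : ℝ} : I.centerOpt τ ≤ ENNReal.ofReal R ↔
    ∃ Γ : Finset (Fin I.n), Γ.card = min τ I.n ∧ I.radius Γ ≤ ENNReal.ofReal R :=
  iInf_prop_le_iff _ _ ENNReal.ofReal_lt_top

theorem exists_bound (I : RKCInstance) : ∃ R : ℝ, 0 ≤ R ∧ ∀ i j, I.d i j ≤ R := by
  refine ⟨∑ i, ∑ j, I.d i j, Finset.sum_nonneg fun i _ => Finset.sum_nonneg fun j _ =>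
    d_nonneg i j, fun i j => ?_⟩
  calc I.d i j ≤ ∑ j, I.d i j :=
        Finset.single_le_sum (f := fun j => I.d i j) (fun j _ => d_nonneg i j) (Finset.mem_univ j)
    _ ≤ _ := Finset.single_le_sum (f := fun i => ∑ j, I.d i j)
        (fun i _ => Finset.sum_nonneg fun j _ => d_nonneg i j) (Finset.mem_univ i)

theorem fits_singleton (i : Fin I.n) : I.Fits {i} := by simp [Fits, I.w_le_one i]

theorem opt_lt_top (I : RKCInstance) : I.opt < ⊤ := by
  obtain ⟨R, hR, h⟩ := I.exists_bound
  refine lt_of_le_of_lt (opt_le_iff.2 ⟨{⟨0, I.n_pos⟩}, fits_singleton _, (cost_le_iff hR).2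
    ⟨Finset.univ, by simp, fun i _ => ⟨_, Finset.mem_singleton_self _, h _ _⟩⟩⟩)
    (ENNReal.ofReal_lt_top (r := R))

theorem ofReal_opt (I : RKCInstance) : ENNReal.ofReal I.opt.toReal = I.opt :=
  ENNReal.ofReal_toReal I.opt_lt_top.ne

theorem exists_opt (I : RKCInstance) : ∃ S, I.Fits S ∧ I.cost S = I.opt := by
  have h : ∃ S, I.Fits S := ⟨{⟨0, I.n_pos⟩}, fits_singleton _⟩
  exact exists_eq_iInf_of_prop _ _ h

theorem exists_opt_card (I : RKCInstance) :
    ∃ S, I.Fits S ∧ I.cost S = I.opt ∧ S.card = I.minOptCard := by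
  obtain ⟨S, h1, h2⟩ := I.exists_opt
  exact Nat.sInf_mem (s := {k | ∃ S : Finset (Fin I.n), I.Fits S ∧ I.cost S = I.opt ∧ S.card = k})
    ⟨S.card, S, h1, h2, rfl⟩

theorem exists_opt_cover (I : RKCInstance) : ∃ S X : Finset (Fin I.n), I.Fits S ∧
    S.card = I.minOptCard ∧ I.n ≤ X.card + I.z ∧ ∀ i ∈ X, ∃ c ∈ S, I.d i c ≤ I.opt.toReal := by
  obtain ⟨S, h1, h2, h3⟩ := I.exists_opt_card
  obtain ⟨X, hX, h⟩ := (cost_le_iff ENNReal.toReal_nonneg).1 (h2.trans I.ofReal_opt.symm).le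
  exact ⟨S, X, h1, h3, hX, h⟩

theorem minOptCard_pos (I : RKCInstance) : 0 < I.minOptCard := by
  obtain ⟨S, X, -, h1, h2, h3⟩ := I.exists_opt_cover
  rw [← h1, Finset.card_pos]
  have : 0 < X.card := by have := I.z_lt; omega
  obtain ⟨i, hi⟩ := Finset.card_pos.1 this
  obtain ⟨c, hc, -⟩ := h3 i hi
  exact ⟨c, hc⟩

/-! ### Analysis of the coreset -/

/-- The relation between the results of CoresetComputeAndTest and the optimum. -/
theorem IsCoresetTest.bounds {α β : ℝ} (hα : 0 ≤ α) {τ : ℕ} {S : Finset (Fin I.n)} {r₁ r₂ : ℝ}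
    (h : I.IsCoresetTest α β τ S r₁ r₂) :
    0 ≤ r₁ ∧ 0 ≤ r₂ ∧ I.Fits S ∧ I.cost S ≤ ENNReal.ofReal (r₂ + 2 * r₁) ∧
      r₂ ≤ α * (I.opt.toReal + 4 * r₁) ∧
      ENNReal.ofReal r₁ ≤ ENNReal.ofReal β * I.centerOpt τ ∧ (I.n ≤ τ → r₁ = 0) := by
  classical
  obtain ⟨Γ, cl, rep, T, m, hΓ, hβ, hcl, hrep, hT, hm, ⟨hST, hfit, happ⟩, hr1, hr2⟩ := h
  have hr1' : 0 ≤ r₁ := hr1 ▸ ENNReal.toReal_nonneg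
  have hr2' : 0 ≤ r₂ := hr2 ▸ ENNReal.toReal_nonneg
  have hrad : I.radius Γ = ENNReal.ofReal r₁ := by
    obtain ⟨R, hR, hb⟩ := I.exists_bound
    rw [hr1, ENNReal.ofReal_toReal]
    refine (lt_of_le_of_lt ((radius_le_iff hR).2 fun j => ⟨cl j, (hcl j).1, hb _ _⟩)
      ENNReal.ofReal_lt_top).ne
  have hcld : ∀ j, I.d j (cl j) ≤ r₁ := by
    intro j
    obtain ⟨c, hc, hjc⟩ := (radius_le_iff hr1').1 hrad.le j
    exact ((hcl j).2 c hc).trans hjc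
  -- Both points lie within `r₁` of the common center `cl j`.
  have hreprep : ∀ j, I.d j (rep (cl j)) ≤ 2 * r₁ := by
    intro j
    have h1 := hcld j
    have h2 := hcld (rep (cl j))
    rw [(hrep _ (hcl j).1).1] at h2
    have h3 := I.d_triangle j (cl j) (rep (cl j))
    rw [I.d_symm (cl j) (rep (cl j))] at h3
    linarith
  have hmT : ∀ j, rep (cl j) ∈ T := fun j => hT ▸ Finset.mem_image_of_mem rep (hcl j).1
  have hsum : ∀ Y ⊆ T, ∑ i ∈ Y, m i = (Finset.univ.filter fun j => rep (cl j) ∈ Y).card := by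
    intro Y _
    rw [Finset.card_eq_sum_card_fiberwise (f := fun j => rep (cl j)) (t := Y)
      (fun j hj => by simpa using hj)]
    refine Finset.sum_congr rfl fun i hi => ?_
    rw [hm i, Finset.filter_filter]
    congr 1
    ext j
    simp only [Finset.mem_filter, Finset.mem_univ, true_and]
    constructor
    · rintro rfl; exact ⟨hi, rfl⟩
    · exact fun h => h.2
  have hsumT : ∑ i ∈ T, m i = I.n := by
    rw [hsum T le_rfl, Finset.filter_true_of_mem fun j _ => hmT j]; simp
  -- the optimum of the coreset
  have hopt : I.optMult T m ≤ ENNReal.ofReal (I.opt.toReal + 4 * r₁) := by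
    obtain ⟨S', X, hfit', -, hX, hcov⟩ := I.exists_opt_cover
    have hnn : 0 ≤ I.opt.toReal := ENNReal.toReal_nonneg
    -- Move an optimal solution and its served points to their representatives. Representatives are
    -- lightest in their clusters, so the knapsack constraint survives; both endpoints move by at
    -- most `2 r₁`.
    refine optMult_le_iff.2 ⟨S'.image fun c => rep (cl c), ⟨?_, ?_⟩, ?_⟩
    · exact Finset.image_subset_iff.2 fun c _ => hmT c
    · refine le_trans (Finset.sum_image_le_of_nonneg (fun a _ => I.w_nonneg _)) ?_
      exact (Finset.sum_le_sum fun c _ => (hrep _ (hcl c).1).2 c rfl).trans hfit'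
    · refine (costMult_le_iff (by positivity)).2 ⟨X.image fun j => rep (cl j), ⟨?_, ?_⟩, ?_⟩
      · exact Finset.image_subset_iff.2 fun c _ => hmT c
      · rw [hsumT, hsum _ (Finset.image_subset_iff.2 fun c _ => hmT c)]
        refine hX.trans (Nat.add_le_add_right (Finset.card_le_card fun j hj => ?_) _)
        simp only [Finset.mem_filter, Finset.mem_univ, true_and]
        exact Finset.mem_image_of_mem _ hj
      · intro i hi
        obtain ⟨j, hj, rfl⟩ := Finset.mem_image.1 hi
        obtain ⟨c, hc, hjc⟩ := hcov j hj
        refine ⟨_, Finset.mem_image_of_mem _ hc, ?_⟩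
        have h1 := I.d_triangle (rep (cl j)) j (rep (cl c))
        have h2 := I.d_triangle j c (rep (cl c))
        have h3 := hreprep j
        have h4 := hreprep c
        rw [I.d_symm] at h3
        linarith
  have hcostS : I.costMult T m S ≤ ENNReal.ofReal (α * (I.opt.toReal + 4 * r₁)) := by
    rw [ENNReal.ofReal_mul hα]
    exact happ.trans (mul_le_mul_right hopt _)
  have hnn : 0 ≤ α * (I.opt.toReal + 4 * r₁) := by
    have : 0 ≤ I.opt.toReal := ENNReal.toReal_nonneg
    positivity
  have hr2c : ENNReal.ofReal r₂ = I.costMult T m S := by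
    rw [hr2, ENNReal.ofReal_toReal (hcostS.trans_lt ENNReal.ofReal_lt_top).ne]
  refine ⟨hr1', hr2', hfit, ?_, ?_, hrad ▸ hβ, ?_⟩
  · obtain ⟨X, ⟨hXT, hX⟩, hcov⟩ := (costMult_le_iff hr2').1 hr2c.ge
    -- All points represented in `X` are served; their number is the total multiplicity of `X`.
    refine (cost_le_iff (by positivity)).2 ⟨Finset.univ.filter fun j => rep (cl j) ∈ X, ?_, ?_⟩
    · rw [← hsum X hXT]; exact hsumT.symm.le.trans hX
    · intro j hj
      obtain ⟨c, hc, h⟩ := hcov _ (Finset.mem_filter.1 hj).2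
      refine ⟨c, hc, ?_⟩
      have := I.d_triangle j (rep (cl j)) c
      have := hreprep j
      linarith
  · rw [← hr2c] at hcostS
    exact (ENNReal.ofReal_le_ofReal_iff hnn).1 hcostS
  · intro hn
    rw [min_eq_right hn] at hΓ
    have hu : Γ = Finset.univ := Finset.eq_univ_of_card _ (by simpa using hΓ)
    have : I.radius Γ ≤ ENNReal.ofReal 0 :=
      (radius_le_iff le_rfl).2 fun j => ⟨j, by simp [hu], (I.d_self j).le⟩
    rw [hr1]
    simp only [ENNReal.ofReal_zero, nonpos_iff_eq_zero] at this
    simp [this]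

/-- A run that passes the stopping test returns a good solution. -/
theorem IsCoresetTest.isApprox {β ε : ℝ} (hε : 0 ≤ ε) {τ : ℕ} {S : Finset (Fin I.n)} {r₁ r₂ : ℝ}
    (h : I.IsCoresetTest 3 β τ S r₁ r₂) (ht : 42 * r₁ ≤ ε * (r₂ - 12 * r₁)) :
    I.IsApprox (3 + ε) S := by
  obtain ⟨h1, h2, h3, h4, h5, -⟩ := h.bounds (by norm_num)
  refine ⟨h3, h4.trans ?_⟩
  rw [← I.ofReal_opt, ← ENNReal.ofReal_mul (by positivity)]
  apply ENNReal.ofReal_le_ofReal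
  -- By `h5`, `r₂ - 12 r₁ ≤ 3 opt`, so the test gives `14 r₁ ≤ ε opt`, while the cost is at most `r₂
  -- + 2 r₁ ≤ 3 opt + 14 r₁`.
  have : ε * (r₂ - 12 * r₁) ≤ ε * (3 * I.opt.toReal) :=
    mul_le_mul_of_nonneg_left (by linarith) hε
  linarith

theorem IsCoresetTest.stops_of_card_le {β ε : ℝ} (hε : 0 ≤ ε) {τ : ℕ} {S : Finset (Fin I.n)}
    {r₁ r₂ : ℝ} (hτ : I.n ≤ τ) (h : I.IsCoresetTest 3 β τ S r₁ r₂) :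
    42 * r₁ ≤ ε * (r₂ - 12 * r₁) := by
  obtain ⟨h1, h2, -, -, -, -, h3⟩ := h.bounds (by norm_num)
  rw [h3 hτ]
  simpa using mul_nonneg hε h2

/-- Since `r₁ ≤ 2 opt / 2 ^ j`, the constant `112 = 2 * 56` yields `56 r₁ ≤ ε opt ≤ ε (r₂ + 2 r₁)`.
This implies the test because `42 + 12 ε ≤ 56 - 2 ε` for `ε ≤ 1`. -/
theorem IsCoresetTest.stops_of_centerOpt_le {ε : ℝ} (hε : 0 < ε) (hε1 : ε < 1) {τ j : ℕ}
    {S : Finset (Fin I.n)} {r₁ r₂ : ℝ} (h : I.IsCoresetTest 3 2 τ S r₁ r₂)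
    (hj : 112 ≤ ε * 2 ^ j) (hc : I.centerOpt τ ≤ ENNReal.ofReal (I.opt.toReal / 2 ^ j)) :
    42 * r₁ ≤ ε * (r₂ - 12 * r₁) := by
  obtain ⟨h1, h2, h3, h4, -, h5, -⟩ := h.bounds (by norm_num)
  have hnn : 0 ≤ I.opt.toReal := ENNReal.toReal_nonneg
  have h6 : I.opt.toReal ≤ r₂ + 2 * r₁ := by
    rw [← ENNReal.ofReal_le_ofReal_iff (by positivity), I.ofReal_opt]
    exact opt_le_iff.2 ⟨S, h3, h4⟩
  have h7 : r₁ ≤ 2 * (I.opt.toReal / 2 ^ j) := by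
    rw [← ENNReal.ofReal_le_ofReal_iff (by positivity), ENNReal.ofReal_mul (by norm_num)]
    exact h5.trans (mul_le_mul_right hc _)
  have h8 : 112 * (I.opt.toReal / 2 ^ j) ≤ ε * I.opt.toReal := by
    calc 112 * (I.opt.toReal / 2 ^ j) ≤ (ε * 2 ^ j) * (I.opt.toReal / 2 ^ j) :=
          mul_le_mul_of_nonneg_right hj (by positivity)
      _ = ε * I.opt.toReal := by field_simp
  nlinarith [mul_le_mul_of_nonneg_left h6 hε.le, mul_nonneg (sub_nonneg.2 hε1.le) h1]

/-! ### Doubling dimension -/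

/-- Every ball is covered by at most `M` balls of half the radius. -/
def Doubling (I : RKCInstance) (M : ℕ) : Prop :=
  ∀ (i : Fin I.n) (r : ℝ), ∃ B : Finset (Fin I.n), B.card ≤ M ∧
    ∀ j, I.d i j ≤ r → ∃ b ∈ B, I.d b j ≤ r / 2

/-- The dimension is an infimum, which a priori need not be attained. For a fixed ball there are
only finitely many candidate covers, so one of them recurs along exponents whose upper bounds tend
to `D`, and its cardinality is at most the limit `2 ^ D`. -/
theorem doubling_of_doublingDim_le {D : ℝ} (h : I.doublingDim ≤ D) :
    I.Doubling ⌊(2 : ℝ) ^ D⌋₊ := by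
  have key : ∀ n : ℕ, ∃ D' < D + 1 / (n + 1 : ℝ), ∀ (i : Fin I.n) (r : ℝ),
      ∃ B : Finset (Fin I.n), (B.card : ℝ) ≤ (2 : ℝ) ^ D' ∧
        ∀ j, I.d i j ≤ r → ∃ b ∈ B, I.d b j ≤ r / 2 := by
    intro n
    have hne : {D : ℝ | ∀ (i : Fin I.n) (r : ℝ), ∃ B : Finset (Fin I.n),
        (B.card : ℝ) ≤ (2 : ℝ) ^ D ∧ ∀ j, I.d i j ≤ r → ∃ b ∈ B, I.d b j ≤ r / 2}.Nonempty := by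
      refine ⟨I.n, fun i r => ⟨Finset.univ.filter fun j => I.d i j ≤ r, ?_, fun j hj => ?_⟩⟩
      · refine le_trans (Nat.cast_le.2 (Finset.card_le_univ _)) ?_
        simp only [Fintype.card_fin, Real.rpow_natCast]
        exact_mod_cast Nat.lt_two_pow_self.le
      · refine ⟨j, by simpa using hj, ?_⟩
        rw [I.d_self]
        have := d_nonneg i j
        linarith
    have hlt : I.doublingDim < D + 1 / (n + 1 : ℝ) := by
      have : (0 : ℝ) < 1 / (n + 1 : ℝ) := by positivity
      linarith
    obtain ⟨D', hD', hlt'⟩ := exists_lt_of_csInf_lt hne hlt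
    exact ⟨D', hlt', hD'⟩
  choose D' hD' hB using key
  intro i r
  choose B hBc hBj using fun n => hB n i r
  -- a set that occurs infinitely often
  obtain ⟨B₀, hB₀⟩ := Finite.exists_infinite_fiber B
  obtain ⟨n₀, hn₀⟩ := (Set.infinite_coe_iff.1 hB₀).nonempty
  refine ⟨B₀, Nat.le_floor ?_, fun j hj => ?_⟩
  · have hle : ∀ N : ℕ, (B₀.card : ℝ) ≤ (2 : ℝ) ^ (D + 1 / (N + 1 : ℝ)) := by
      intro N
      obtain ⟨n, hn, hNn⟩ := (Set.infinite_coe_iff.1 hB₀).exists_gt N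
      have := hBc n
      rw [show B n = B₀ from hn] at this
      refine this.trans (Real.rpow_le_rpow_of_exponent_le (by norm_num) ((hD' n).le.trans ?_))
      have : (1 : ℝ) / (n + 1) ≤ 1 / (N + 1) :=
        one_div_le_one_div_of_le (by positivity) (by exact_mod_cast Nat.succ_le_succ hNn.le)
      linarith
    have hlim : Filter.Tendsto (fun N : ℕ => (2 : ℝ) ^ (D + 1 / (N + 1 : ℝ))) Filter.atTop
        (nhds ((2 : ℝ) ^ (D + 0))) := by
      exact ((Real.continuous_const_rpow (by norm_num)).tendsto _).comp
        (tendsto_const_nhds.add tendsto_one_div_add_atTop_nhds_zero_nat)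
    rw [add_zero] at hlim
    exact ge_of_tendsto' hlim hle
  · have := hBj n₀ j hj
    rwa [show B n₀ = B₀ from hn₀] at this

theorem Doubling.iterate {M : ℕ} (h : I.Doubling M) (e : ℕ) (i : Fin I.n) (r : ℝ) :
    ∃ B : Finset (Fin I.n), B.card ≤ M ^ e ∧
      ∀ j, I.d i j ≤ r → ∃ b ∈ B, I.d b j ≤ r / 2 ^ e := by
  classical
  induction e with
  | zero => exact ⟨{i}, by simp, fun j hj => ⟨i, by simp, by simpa using hj⟩⟩
  | succ e ih =>
    obtain ⟨B, hB, hcov⟩ := ih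
    choose C hC hC' using fun b => h b (r / 2 ^ e)
    refine ⟨B.biUnion C, ?_, fun j hj => ?_⟩
    · refine Finset.card_biUnion_le.trans ((Finset.sum_le_sum fun b _ => hC b).trans ?_)
      rw [Finset.sum_const, smul_eq_mul, pow_succ]
      exact Nat.mul_le_mul_right _ hB
    · obtain ⟨b, hb, hbj⟩ := hcov j hj
      obtain ⟨c, hc, hcj⟩ := hC' b j hbj
      refine ⟨c, Finset.mem_biUnion.2 ⟨b, hb, hc⟩, hcj.trans (le_of_eq ?_)⟩
      rw [pow_succ, div_div]

theorem Doubling.pos {M : ℕ} (h : I.Doubling M) : 0 < M := by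
  obtain ⟨B, hB, hcov⟩ := h ⟨0, I.n_pos⟩ 0
  obtain ⟨b, hb, -⟩ := hcov ⟨0, I.n_pos⟩ (I.d_self _).le
  exact (Finset.card_pos.2 ⟨b, hb⟩).trans_le hB

/-- Few centers suffice to cover everything at a small scale. -/
theorem Doubling.centerOpt_le {M : ℕ} (h : I.Doubling M) (e : ℕ) {τ : ℕ}
    (hτ : (I.minOptCard + I.z) * M ^ e ≤ τ) :
    I.centerOpt τ ≤ ENNReal.ofReal (I.opt.toReal / 2 ^ e) := by
  classical
  obtain ⟨S, X, -, hS, hX, hcov⟩ := I.exists_opt_cover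
  choose B hB hBcov using fun c => h.iterate e c I.opt.toReal
  have hnn : 0 ≤ I.opt.toReal := ENNReal.toReal_nonneg
  -- Centers covering the optimal balls at the small scale, together with all outliers.
  have hcard : (S.biUnion B ∪ Xᶜ).card ≤ min τ I.n := by
    refine le_min ((Finset.card_union_le _ _).trans (le_trans ?_ hτ)) (by
      simpa using Finset.card_le_univ (S.biUnion B ∪ Xᶜ))
    rw [add_mul]
    refine Nat.add_le_add ?_ ?_
    · refine Finset.card_biUnion_le.trans ((Finset.sum_le_sum fun b _ => hB b).trans ?_)
      rw [Finset.sum_const, smul_eq_mul, hS]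
    · rw [Finset.card_compl, Fintype.card_fin]
      have : I.z ≤ I.z * M ^ e := Nat.le_mul_of_pos_right _ (pow_pos h.pos e)
      omega
  -- `centerOpt` requires exactly `min τ n` centers; additional ones do no harm.
  obtain ⟨Γ, hsub, hΓ⟩ := Finset.exists_superset_card_eq hcard (by simp)
  refine centerOpt_le_iff.2 ⟨Γ, hΓ, (radius_le_iff (by positivity)).2 fun j => ?_⟩
  by_cases hj : j ∈ X
  · obtain ⟨c, hc, hjc⟩ := hcov j hj
    obtain ⟨b, hb, hbj⟩ := hBcov c j (by rw [I.d_symm]; exact hjc)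
    refine ⟨b, hsub (Finset.mem_union_left _ (Finset.mem_biUnion.2 ⟨c, hc, hb⟩)), ?_⟩
    rw [I.d_symm]; exact hbj
  · exact ⟨j, hsub (Finset.mem_union_right _ (by simpa using hj)), by
      rw [I.d_self]; positivity⟩

end RKCInstance

/-! ### The doubling loop -/

theorem sol_doubleTau (I : RKCInstance) (σ : RAMState) (f : ℕ → ℕ) :
    RAMState.sol I { σ with nv := f } = σ.sol I := rfl

theorem stopTest_holds_iff {I : RKCInstance} {σ : RAMState} :
    (stopTest 3).Holds I σ ↔ 42 * σ.rv 1 ≤ σ.rv 0 * (σ.rv 2 - 12 * σ.rv 1) := by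
  simp only [stopTest, BExp.Holds, RExp.eval, NExp.eval]
  norm_num

section MainLoop

variable {I : RKCInstance} {β ε : ℝ} {body : Cmd} {Θ b : ℕ} {free : Prop}

/-- The proposition `free` switches the time bound off, so that one induction serves both halting
and running time. The fuel `m` drops by one per round although `τ` doubles: a number of rounds
linear in `Θ` is good enough. When the test is evaluated, register `2` already holds the doubled
value. The body is repeated only for `τ < Θ`, hence never run beyond `2 Θ`. -/
theorem while_stopTest (hε : 0 < ε)
    (himp : ∀ τ σ, 1 ≤ τ → τ ≤ 2 * Θ → σ.nv 0 = I.n → σ.nv 1 = I.z → σ.nv 2 = τ →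
      ∃ t σ', Exec I body σ t σ' ∧ (free ∨ t ≤ b) ∧
        σ'.nv 0 = I.n ∧ σ'.nv 1 = I.z ∧ σ'.nv 2 = τ ∧ σ'.rv 0 = σ.rv 0 ∧
        I.IsCoresetTest 3 β τ (σ'.sol I) (σ'.rv 1) (σ'.rv 2))
    (hhalt : ∀ τ S r₁ r₂, Θ ≤ τ → I.IsCoresetTest 3 β τ S r₁ r₂ →
      42 * r₁ ≤ ε * (r₂ - 12 * r₁)) (m : ℕ) :
    ∀ τ σ, 1 ≤ τ → Θ ≤ τ + m → σ.nv 0 = I.n → σ.nv 1 = I.z → σ.nv 2 = τ + τ → σ.rv 0 = ε →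
      I.IsCoresetTest 3 β τ (σ.sol I) (σ.rv 1) (σ.rv 2) →
      ∃ t σ', Exec I (.while (.not (stopTest 3)) (.seq body doubleTau)) σ t σ' ∧
        I.IsApprox (3 + ε) (σ'.sol I) ∧ (free ∨ t ≤ m * (b + 19) + 15) := by
  induction m with
  | zero =>
    intro τ σ h1 hΘ h2 h3 h4 h5 hc
    have hs := hhalt τ _ _ _ (by omega) hc
    refine ⟨_, σ, Exec.while_false ?_, hc.isApprox hε.le hs, Or.inr (by rw [zero_mul]; decide)⟩
    simp only [BExp.Holds, stopTest_holds_iff, h5, not_not]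
    exact hs
  | succ m ih =>
    intro τ σ h1 hΘ h2 h3 h4 h5 hc
    by_cases hs : (stopTest 3).Holds I σ
    · refine ⟨_, σ, Exec.while_false (by simpa [BExp.Holds] using hs), hc.isApprox hε.le ?_,
        Or.inr (le_trans (by decide : _ ≤ 15) (Nat.le_add_left _ _))⟩
      rw [stopTest_holds_iff, h5] at hs
      exact hs
    · have hτ : τ < Θ := by
        by_contra hlt
        apply hs
        rw [stopTest_holds_iff, h5]
        exact hhalt τ _ _ _ (by omega) hc
      obtain ⟨t, σ', he, ht, g0, g1, g2, g3, g4⟩ :=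
        himp (τ + τ) σ (by omega) (by omega) h2 h3 h4
      obtain ⟨t', σ'', he', happ, ht'⟩ := ih (τ + τ)
        { σ' with nv := Function.update σ'.nv 2 ((NExp.add (.var 2) (.var 2)).eval σ') }
        (by omega) (by omega) (by simpa using g0) (by simpa using g1)
        (by simp [NExp.eval, g2]) (g3.trans h5) (by rw [sol_doubleTau]; exact g4)
      refine ⟨_, σ'', Exec.while_true (by simpa [BExp.Holds] using hs)
        (Exec.seq he (Exec.setN 2 _ σ')) he', happ, ?_⟩
      rcases ht with ht | ht
      · exact Or.inl ht
      rcases ht' with ht' | ht'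
      · exact Or.inl ht'
      refine Or.inr ?_
      have e1 : (BExp.not (stopTest 3)).cost + 1 = 15 := by decide
      have e2 : (NExp.add (.var 2) (.var 2)).cost + 1 = 4 := by decide
      rw [e1, e2, add_mul]
      omega

theorem rknapCenter_run (hε : 0 < ε) (hΘ : 1 ≤ Θ)
    (himp : ∀ τ σ, 1 ≤ τ → τ ≤ 2 * Θ → σ.nv 0 = I.n → σ.nv 1 = I.z → σ.nv 2 = τ →
      ∃ t σ', Exec I body σ t σ' ∧ (free ∨ t ≤ b) ∧
        σ'.nv 0 = I.n ∧ σ'.nv 1 = I.z ∧ σ'.nv 2 = τ ∧ σ'.rv 0 = σ.rv 0 ∧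
        I.IsCoresetTest 3 β τ (σ'.sol I) (σ'.rv 1) (σ'.rv 2))
    (hhalt : ∀ τ S r₁ r₂, Θ ≤ τ → I.IsCoresetTest 3 β τ S r₁ r₂ →
      42 * r₁ ≤ ε * (r₂ - 12 * r₁)) :
    ∃ t σ, Exec I (rknapCenter 3 body) (initState I ε) t σ ∧ I.IsApprox (3 + ε) (σ.sol I) ∧
      (free ∨ t ≤ (Θ + 1) * (b + 21)) := by
  obtain ⟨t, σ', he, ht, g0, g1, g2, g3, g4⟩ := himp 1
    { initState I ε with
      nv := Function.update (initState I ε).nv 2 ((NExp.lit 1).eval (initState I ε)) }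
    le_rfl (by omega) (by simp [initState]) (by simp [initState]) (by simp [NExp.eval])
  obtain ⟨t', σ'', he', happ, ht'⟩ := while_stopTest hε himp hhalt Θ 1
    { σ' with nv := Function.update σ'.nv 2 ((NExp.add (.var 2) (.var 2)).eval σ') }
    le_rfl (by omega) (by simpa using g0) (by simpa using g1)
    (by simp [NExp.eval, g2]) (g3.trans (by simp [initState])) (by rw [sol_doubleTau]; exact g4)
  refine ⟨_, σ'', Exec.seq (Exec.setN 2 _ _) (Exec.seq (Exec.seq he (Exec.setN 2 _ σ')) he'),
    happ, ?_⟩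
  rcases ht with ht | ht
  · exact Or.inl ht
  rcases ht' with ht' | ht'
  · exact Or.inl ht'
  refine Or.inr ?_
  have e1 : (NExp.lit 1).cost + 1 = 2 := by decide
  have e2 : (NExp.add (.var 2) (.var 2)).cost + 1 = 4 := by decide
  rw [e1, e2]
  nlinarith

end MainLoop

theorem rknapCenter_isApprox {β : ℝ} {body : Cmd} (h : ImplementsCoresetTest 3 β body) {ε : ℝ}
    (hε : 0 < ε) (I : RKCInstance) :
    ∃ (t : ℕ) (σ : RAMState), Exec I (rknapCenter 3 body) (initState I ε) t σ ∧
      I.IsApprox (3 + ε) (σ.sol I) := by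
  obtain ⟨t, σ, he, happ, -⟩ := rknapCenter_run (I := I) (β := β) (ε := ε) (body := body)
    (Θ := I.n) (b := 0) (free := True) hε I.n_pos
    (fun τ σ h1 _ h2 h3 h4 => by
      obtain ⟨t, σ', g⟩ := h I τ σ h1 h2 h3 h4
      exact ⟨t, σ', g.1, Or.inl trivial, g.2⟩)
    (fun τ S r₁ r₂ hτ hc => hc.stops_of_card_le hε.le hτ)
  exact ⟨t, σ, he, happ⟩

/-- A polynomial bound on the running time of the body yields one for RKnapCenter. -/
theorem rknapCenter_time {body : Cmd} {B e : ℕ} (himp : ∀ (I : RKCInstance) (τ : ℕ) σ, 1 ≤ τ →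
      σ.nv 0 = I.n → σ.nv 1 = I.z → σ.nv 2 = τ →
      ∃ t σ', Exec I body σ t σ' ∧ t ≤ B * (I.n * (τ + I.z + 1) ^ e) ∧
        σ'.nv 0 = I.n ∧ σ'.nv 1 = I.z ∧ σ'.nv 2 = τ ∧ σ'.rv 0 = σ.rv 0 ∧
        I.IsCoresetTest 3 2 τ (σ'.sol I) (σ'.rv 1) (σ'.rv 2)) {ε : ℝ} (hε : 0 < ε) (hε1 : ε < 1) :
    ∃ C : ℝ → ℝ, ∀ I : RKCInstance,
      ∃ (t : ℕ) (σ : RAMState), Exec I (rknapCenter 3 body) (initState I ε) t σ ∧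
        I.IsApprox (3 + ε) (σ.sol I) ∧
        ∀ D : ℝ, I.doublingDim ≤ D →
          (t : ℝ) ≤ C D * (I.n : ℝ) * ((I.minOptCard + I.z : ℕ) : ℝ) ^ (e + 1) := by
  -- The scale at which the optimal balls are covered depends on `ε` only.
  obtain ⟨j, hj⟩ : ∃ j : ℕ, 112 ≤ ε * 2 ^ j := by
    obtain ⟨j, hj⟩ := pow_unbounded_of_one_lt (112 / ε) (one_lt_two (α := ℝ))
    exact ⟨j, by rw [div_lt_iff₀ hε] at hj; linarith⟩
  refine ⟨fun D => (((B + 21) * (⌊(2 : ℝ) ^ D⌋₊ ^ j + 1) * (2 * ⌊(2 : ℝ) ^ D⌋₊ ^ j + 2) ^ e : ℕ) : ℝ),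
    fun I => ?_⟩
  have hdoub := RKCInstance.doubling_of_doublingDim_le (I := I) le_rfl
  set M := ⌊(2 : ℝ) ^ I.doublingDim⌋₊ with hM
  set s := I.minOptCard + I.z with hs
  have hs1 : 1 ≤ s := by have := I.minOptCard_pos; omega
  have hA : 1 ≤ M ^ j := Nat.one_le_pow _ _ hdoub.pos
  -- The threshold is `Θ = (k + z) M ^ j`; for `τ ≤ 2 Θ` the base `τ + z + 1` is at most `(2 M ^ j +
  -- 2) (k + z)`.
  obtain ⟨t, σ, he, happ, ht⟩ := rknapCenter_run (I := I) (β := 2) (ε := ε) (body := body)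
    (Θ := s * M ^ j) (b := B * (I.n * ((2 * M ^ j + 2) * s) ^ e)) (free := False) hε
    (Nat.mul_pos hs1 hA)
    (fun τ σ h1 h2 h3 h4 h5 => by
      obtain ⟨t, σ', g1, g2, g3⟩ := himp I τ σ h1 h3 h4 h5
      refine ⟨t, σ', g1, Or.inr (g2.trans ?_), g3⟩
      gcongr
      have : I.z ≤ s := by omega
      nlinarith)
    (fun τ S r₁ r₂ hτ hc => hc.stops_of_centerOpt_le hε hε1 hj (hdoub.centerOpt_le j hτ))
  refine ⟨t, σ, he, happ, fun D hD => ?_⟩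
  have ht := ht.resolve_left id
  -- The run is analyzed with the true dimension of the instance; the bound for any larger `D`
  -- follows by monotonicity.
  have hmono : M ≤ ⌊(2 : ℝ) ^ D⌋₊ :=
    Nat.floor_le_floor (Real.rpow_le_rpow_of_exponent_le (by norm_num) hD)
  have h1 : t ≤ (B + 21) * (M ^ j + 1) * (2 * M ^ j + 2) ^ e * I.n * s ^ (e + 1) := by
    refine ht.trans ?_
    have hn := I.n_pos
    have hX : 1 ≤ I.n * ((2 * M ^ j + 2) * s) ^ e :=
      Nat.mul_pos hn (pow_pos (Nat.mul_pos (by omega) hs1) _)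
    calc (s * M ^ j + 1) * (B * (I.n * ((2 * M ^ j + 2) * s) ^ e) + 21)
        ≤ (s * (M ^ j + 1)) * ((B + 21) * (I.n * ((2 * M ^ j + 2) * s) ^ e)) := by
          apply Nat.mul_le_mul
          · nlinarith
          · nlinarith
      _ = _ := by rw [mul_pow, pow_succ]; ring
  have h2 : t ≤ (B + 21) * (⌊(2 : ℝ) ^ D⌋₊ ^ j + 1) * (2 * ⌊(2 : ℝ) ^ D⌋₊ ^ j + 2) ^ e
      * I.n * s ^ (e + 1) := by
    refine h1.trans ?_
    gcongr
  calc (t : ℝ) ≤ (((B + 21) * (⌊(2 : ℝ) ^ D⌋₊ ^ j + 1) * (2 * ⌊(2 : ℝ) ^ D⌋₊ ^ j + 2) ^ e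
      * I.n * s ^ (e + 1) : ℕ) : ℝ) := by exact_mod_cast h2
    _ = _ := by push_cast; ring

/-! ### More derived commands -/

/-- `x ← 0; while x < l do { p; x ← x + 1 }`. -/
def forAll (x l : ℕ) (p : Cmd) : Cmd := .seq (.setN x (.lit 0)) (forUp x l p)

def fillWhenN (a x l : ℕ) (b : BExp) (e : NExp) : Cmd :=
  forAll x l (whenCmd b (.putN a (.var x) e))

def fillWhenR (a x l : ℕ) (b : BExp) (e : RExp) : Cmd :=
  forAll x l (whenCmd b (.putR a (.var x) e))

namespace Runs

variable {I : RKCInstance} {p : Cmd} {σ : RAMState}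

theorem forAll {x l N K : ℕ} (Inv : ℕ → RAMState → Prop) (hK : 1 ≤ K)
    (hl : σ.nv l = N) (hpx : p.wN x = false) (hpl : p.wN l = false) (hxl : x ≠ l)
    (h0 : Inv 0 { σ with nv := Function.update σ.nv x 0 })
    (step : ∀ i σ', i < N → Frame (forAll x l p) σ σ' → σ'.nv x = i → Inv i σ' →
      Runs I p σ' K fun σ'' => Inv (i + 1) { σ'' with nv := Function.update σ''.nv x (i + 1) }) :
    Runs I (forAll x l p) σ (K * (N + 1)) (Inv N) := by
  have hK' : 1 ≤ K * (N + 1) := Nat.mul_pos hK (by omega)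
  refine Runs.seq (Runs.setN hK' ?_)
  have hF₁ : Frame (_root_.forAll x l p) σ
      { σ with nv := Function.update σ.nv x (NExp.eval σ (.lit 0)) } := by
    refine ⟨fun y hy => ?_, fun _ _ => rfl, fun _ _ => rfl, fun _ _ => rfl⟩
    have : y ≠ x := by rintro rfl; simp [_root_.forAll, Cmd.wN] at hy
    simp [this]
  refine (Runs.forUp (K := K) (a := 0) (N := N) Inv hK (by simp)
    (by simp [hl, Ne.symm hxl]) (Nat.zero_le _) hpx hpl hxl h0
    fun i σ' _ hi hF hx h => ?_).conseq le_rfl (fun σ' _ h => h.2)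
  exact step i σ' hi (hF₁.trans (hF.of_imp
    (by simp +contextual [Cmd.wN, _root_.forAll]) (by simp +contextual [Cmd.wR, _root_.forAll])
    (by simp +contextual [Cmd.wNA, _root_.forAll])
    (by simp +contextual [Cmd.wRA, _root_.forAll]))) hx h

theorem fillWhenN {a x l N : ℕ} {b : BExp} {e : NExp} (g : ℕ → ℕ)
    (hxl : x ≠ l) (hx9 : x ≠ 99) (hl9 : l ≠ 99) (hl : σ.nv l = N)
    (he : ∀ i σ', i < N → Frame (fillWhenN a x l b e) σ σ' → σ'.nv x = i →
      σ'.na a i = σ.na a i →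
      (b.Holds I σ' → e.eval σ' = g i) ∧ (¬ b.Holds I σ' → σ.na a i = g i)) :
    Runs I (fillWhenN a x l b e) σ (N + 1) fun σ' =>
      (∀ i < N, σ'.na a i = g i) ∧ ∀ i, N ≤ i → σ'.na a i = σ.na a i := by
  refine (Runs.forAll (K := 1) (N := N) (fun i σ' =>
      (∀ k < i, σ'.na a k = g k) ∧ ∀ k, i ≤ k → σ'.na a k = σ.na a k) le_rfl hl
      (by simp [whenCmd, skipCmd, Cmd.wN, nat_beq_of_ne hx9.symm])
      (by simp [whenCmd, skipCmd, Cmd.wN, nat_beq_of_ne hl9.symm]) hxl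
      ⟨by simp, by simp⟩ ?_).conseq (by omega) (fun σ' _ h => h)
  rintro i σ' hi hF hx ⟨h1, h2⟩
  obtain ⟨hev1, hev2⟩ := he i σ' hi hF hx (h2 i le_rfl)
  refine Runs.when le_rfl (fun hb => Runs.putN le_rfl ?_) (fun hb => ?_)
  · simp only [update₂_self, hev1 hb, NExp.eval, hx]
    constructor
    · intro k hk
      rcases Nat.lt_succ_iff_lt_or_eq.1 hk with hk | rfl
      · rw [Function.update_of_ne (by omega)]; exact h1 k hk
      · simp
    · intro k hk
      rw [Function.update_of_ne (by omega)]; exact h2 k (by omega)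
  · refine ⟨fun k hk => ?_, fun k hk => h2 k (by omega)⟩
    rcases Nat.lt_succ_iff_lt_or_eq.1 hk with hk | rfl
    · exact h1 k hk
    · exact (h2 k le_rfl).trans (hev2 hb)

theorem fillWhenR {a x l N : ℕ} {b : BExp} {e : RExp} (g : ℕ → ℝ)
    (hxl : x ≠ l) (hx9 : x ≠ 99) (hl9 : l ≠ 99) (hl : σ.nv l = N)
    (he : ∀ i σ', i < N → Frame (fillWhenR a x l b e) σ σ' → σ'.nv x = i →
      σ'.ra a i = σ.ra a i →
      (b.Holds I σ' → e.eval I σ' = g i) ∧ (¬ b.Holds I σ' → σ.ra a i = g i)) :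
    Runs I (fillWhenR a x l b e) σ (N + 1) fun σ' =>
      (∀ i < N, σ'.ra a i = g i) ∧ ∀ i, N ≤ i → σ'.ra a i = σ.ra a i := by
  refine (Runs.forAll (K := 1) (N := N) (fun i σ' =>
      (∀ k < i, σ'.ra a k = g k) ∧ ∀ k, i ≤ k → σ'.ra a k = σ.ra a k) le_rfl hl
      (by simp [whenCmd, skipCmd, Cmd.wN, nat_beq_of_ne hx9.symm])
      (by simp [whenCmd, skipCmd, Cmd.wN, nat_beq_of_ne hl9.symm]) hxl
      ⟨by simp, by simp⟩ ?_).conseq (by omega) (fun σ' _ h => h)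
  rintro i σ' hi hF hx ⟨h1, h2⟩
  obtain ⟨hev1, hev2⟩ := he i σ' hi hF hx (h2 i le_rfl)
  refine Runs.when le_rfl (fun hb => Runs.putR le_rfl ?_) (fun hb => ?_)
  · simp only [update₂_self, hev1 hb, NExp.eval, hx]
    constructor
    · intro k hk
      rcases Nat.lt_succ_iff_lt_or_eq.1 hk with hk | rfl
      · rw [Function.update_of_ne (by omega)]; exact h1 k hk
      · simp
    · intro k hk
      rw [Function.update_of_ne (by omega)]; exact h2 k (by omega)
  · refine ⟨fun k hk => ?_, fun k hk => h2 k (by omega)⟩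
    rcases Nat.lt_succ_iff_lt_or_eq.1 hk with hk | rfl
    · exact h1 k hk
    · exact (h2 k le_rfl).trans (hev2 hb)

end Runs

/-! ### Distances and weights by numbers -/

namespace RKCInstance

variable (I : RKCInstance)

/-- The default value is that of `RExp.eval`, so that `RExp.eval_dist` holds by definition. -/
noncomputable def natDist (i j : ℕ) : ℝ :=
  if h : i < I.n ∧ j < I.n then I.d ⟨i, h.1⟩ ⟨j, h.2⟩ else 0

noncomputable def natWeight (i : ℕ) : ℝ := if h : i < I.n then I.w ⟨i, h⟩ else 0

/-- Distances between the points with indices in an array. -/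
noncomputable def idxDist (P : ℕ → ℕ) (a b : ℕ) : ℝ := I.natDist (P a) (P b)

noncomputable def idxWeight (P : ℕ → ℕ) (a : ℕ) : ℝ := I.natWeight (P a)

theorem natDist_fin (i j : Fin I.n) : I.natDist i j = I.d i j := by simp [natDist]

theorem natWeight_fin (i : Fin I.n) : I.natWeight i = I.w i := by simp [natWeight]

theorem natDist_nonneg (i j : ℕ) : 0 ≤ I.natDist i j := by
  unfold natDist; split_ifs
  · exact d_nonneg _ _
  · exact le_rfl

theorem natWeight_nonneg (i : ℕ) : 0 ≤ I.natWeight i := by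
  unfold natWeight; split_ifs
  · exact I.w_nonneg _
  · exact le_rfl

theorem indexMetric {P : ℕ → ℕ} {q : ℕ} (hP : ∀ a < q, P a < I.n) :
    IndexMetric q (I.idxDist P) := by
  refine ⟨fun a ha => ?_, fun a ha b hb => ?_, fun a ha b hb c hc => ?_⟩
  · simp [idxDist, natDist, I.d_self]
  · simp only [idxDist, natDist, hP a ha, hP b hb, and_self, dite_true]
    exact I.d_symm _ _
  · simp only [idxDist, natDist, hP a ha, hP b hb, hP c hc, and_self, dite_true]
    exact I.d_triangle _ _ _

end RKCInstance

theorem RExp.eval_dist {I : RKCInstance} {σ : RAMState} {i j : NExp} :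
    (RExp.dist i j).eval I σ = I.natDist (i.eval σ) (j.eval σ) := rfl

theorem RExp.eval_weight {I : RKCInstance} {σ : RAMState} {i : NExp} :
    (RExp.weight i).eval I σ = I.natWeight (i.eval σ) := rfl

/-! ### The subroutine for the problem with multiplicities

The natural registers `1`, `3`, `4` hold `z`, the number `q` of points and `z + 1`; the natural
arrays `3` and `4` hold the points and their truncated multiplicities. -/

/-- Array `6`: lightest point in the ball whose radius is in real register `4`. -/
def lightestCmd : Cmd :=
  forAll 10 3 (.seq
    (argmin 11 12 3 (.rle (.dist (.get 3 (.var 10)) (.get 3 (.var 12))) (.var 4))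
      (.weight (.get 3 (.var 12))) (.weight (.get 3 (.var 11))))
    (.putN 6 (.var 10) (.var 11)))

/-- Array `8`: the greedy clusters for the scores in array `7`, as center plus one. -/
def clusterCmd : Cmd :=
  .seq (fillN 8 10 3 (.lit 0))
    (forAll 10 3 (.seq
      (argmin 11 12 3 (.nle (.get 8 (.var 12)) (.lit 0))
        (.ofNat (.get 7 (.var 12))) (.ofNat (.get 7 (.var 11))))
      (fillWhenN 8 13 3 (.and (.nle (.get 8 (.var 13)) (.lit 0))
        (.rle (.dist (.get 3 (.var 11)) (.get 3 (.var 13))) (.add (.var 4) (.var 4))))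
        (.add (.var 11) (.lit 1)))))

/-- Array `9`: the multiplicities of the clusters. -/
def clusterMultCmd : Cmd :=
  .seq (fillN 9 10 3 (.lit 0))
    (forAll 10 3 (.putN 9 (.sub (.get 8 (.var 10)) (.lit 1))
      (.add (.get 9 (.sub (.get 8 (.var 10)) (.lit 1))) (.get 4 (.var 10)))))

section Subroutine

variable {I : RKCInstance} {σ : RAMState} {q z : ℕ} {r : ℝ}

theorem lightestCmd_spec (hq : σ.nv 3 = q) (hr : 0 ≤ σ.rv 4) (hP : ∀ a < q, σ.na 3 a < I.n) :
    Runs I lightestCmd σ ((q + 1) * (q + 1)) fun σ' =>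
      LightestInBall q (I.idxDist (σ.na 3)) (I.idxWeight (σ.na 3)) (σ.rv 4) (σ'.na 6) := by
  have hm := I.indexMetric hP
  refine (Runs.forAll (K := q + 1) (N := q) (fun i σ' => ∀ v < i, σ'.na 6 v < q ∧
    I.idxDist (σ.na 3) v (σ'.na 6 v) ≤ σ.rv 4 ∧ ∀ c < q, I.idxDist (σ.na 3) v c ≤ σ.rv 4 →
      I.idxWeight (σ.na 3) (σ'.na 6 v) ≤ I.idxWeight (σ.na 3) c) (by omega) hq rfl rfl (by decide)
    (by simp) ?_).conseq le_rfl
    fun σ' _ h => ⟨fun v hv => (h v hv).1, fun v hv => (h v hv).2.1, fun v hv => (h v hv).2.2⟩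
  intro i σ₁ hi hF hx hInv
  have h3 : σ₁.na 3 = σ.na 3 := hF.na 3 rfl
  have hr4 : σ₁.rv 4 = σ.rv 4 := hF.rv 4 rfl
  refine Runs.seq ((Runs.argmin (N := q) (fun c => I.idxDist (σ.na 3) i c ≤ σ.rv 4)
    (I.idxWeight (σ.na 3)) (by decide) (by decide) (by decide) (by decide) (by decide) (by decide)
    ((hF.nv 3 rfl).trans hq) ?_ ?_ ?_).conseq le_rfl fun σ₂ hF₂ h => ?_)
  · intro σ' hF' _
    simp only [BExp.Holds, RExp.eval, NExp.eval, hF'.na 3 rfl, hF'.rv 4 rfl,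
      hF'.nv 10 rfl, h3, hr4, hx]
    rfl
  · intro σ' hF' _
    simp only [RExp.eval_weight, NExp.eval, hF'.na 3 rfl, h3]
    rfl
  · intro σ' hF' _
    simp only [RExp.eval_weight, NExp.eval, hF'.na 3 rfl, h3]
    rfl
  · refine Runs.putN (by omega) ?_
    have h6 : σ₂.na 6 = σ₁.na 6 := hF₂.na 6 rfl
    have h10 : σ₂.nv 10 = i := (hF₂.nv 10 rfl).trans hx
    simp only [update₂_self, NExp.eval, h10, h6]
    intro v hv
    rcases Nat.lt_succ_iff_lt_or_eq.1 hv with hv | rfl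
    · rw [Function.update_of_ne (by omega)]; exact hInv v hv
    · rw [Function.update_self]
      -- The search cannot fail: `v` lies in its own ball, as the radius is nonnegative.
      rcases h with ⟨-, h⟩ | h
      · exact absurd (by rw [hm.self v hi]; exact hr) (h v hi)
      · exact h

/-- A center has the least score among the unassigned points at the moment it is opened, in
particular among the points it absorbs. Later centers were not absorbed, hence are far from it. -/
theorem clusterCmd_spec (hq : σ.nv 3 = q) (hr : 0 ≤ σ.rv 4) (hP : ∀ a < q, σ.na 3 a < I.n) :
    Runs I clusterCmd σ ((q + 1) * (q + 1)) fun σ' =>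
      Clustering q (I.idxDist (σ.na 3)) (σ.na 7) (σ.rv 4) (fun u => σ'.na 8 u - 1) := by
  classical
  have hm := I.indexMetric hP
  set δ := I.idxDist (σ.na 3) with hδ
  have hK : q + 1 ≤ (q + 1) * (q + 1) := Nat.le_mul_of_pos_right _ (by omega)
  refine Runs.seq ((Runs.fillN (N := q) (fun _ => 0) (by decide) hq
    (fun _ _ _ _ _ _ => rfl)).conseq hK fun σ₀ hF₀ h0 => ?_)
  have hq₀ : σ₀.nv 3 = q := (hF₀.nv 3 rfl).trans hq
  -- The entry `0` means unassigned and `v + 1` at position `v` marks a center. The four clauses: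
  -- assigned points are well assigned; unassigned points are far from all centers; centers are far
  -- apart; and every round makes progress unless all points are assigned, so `q` rounds suffice.
  refine (Runs.forAll (K := q + 1) (N := q) (fun i σ' =>
    (∀ u < q, σ'.na 8 u ≠ 0 → σ'.na 8 u - 1 < q ∧ σ'.na 8 (σ'.na 8 u - 1) = σ'.na 8 u ∧
      δ (σ'.na 8 u - 1) u ≤ σ.rv 4 + σ.rv 4 ∧ σ.na 7 (σ'.na 8 u - 1) ≤ σ.na 7 u) ∧
    (∀ v < q, σ'.na 8 v = v + 1 → ∀ u < q, σ'.na 8 u = 0 → σ.rv 4 + σ.rv 4 < δ v u) ∧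
    (∀ v < q, σ'.na 8 v = v + 1 → ∀ u < q, σ'.na 8 u = u + 1 → v ≠ u →
      σ.rv 4 + σ.rv 4 < δ v u) ∧
    ((∀ u < q, σ'.na 8 u ≠ 0) ∨ i ≤ ((Finset.range q).filter fun u => σ'.na 8 u ≠ 0).card))
    (by omega) hq₀ rfl rfl (by decide) ?_ ?_).conseq le_rfl ?_
  · refine ⟨fun u hu h => absurd (h0.1 u hu) h, fun v hv h => ?_, fun v hv h => ?_, Or.inr (by simp)⟩
    · have := h0.1 v hv
      simp only at h; omega
    · have := h0.1 v hv
      simp only at h; omega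
  · rintro i σ₁ hi hF hx ⟨g1, g2, g3, g4⟩
    have h3 : σ₁.na 3 = σ.na 3 := (hF.na 3 rfl).trans (hF₀.na 3 rfl)
    have h7 : σ₁.na 7 = σ.na 7 := (hF.na 7 rfl).trans (hF₀.na 7 rfl)
    have hr4 : σ₁.rv 4 = σ.rv 4 := (hF.rv 4 rfl).trans (hF₀.rv 4 rfl)
    refine Runs.seq ((Runs.argmin (N := q) (fun c => σ₁.na 8 c = 0)
      (fun c => (σ.na 7 c : ℝ)) (by decide) (by decide) (by decide) (by decide) (by decide)
      (by decide) ((hF.nv 3 rfl).trans hq₀) ?_ ?_ ?_).conseq le_rfl fun σ₂ hF₂ h => ?_)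
    · intro σ' hF' _
      simp only [BExp.Holds, NExp.eval, hF'.na 8 rfl, nonpos_iff_eq_zero]
    · intro σ' hF' _
      simp only [RExp.eval, NExp.eval, hF'.na 7 rfl, h7]
    · intro σ' hF' _
      simp only [RExp.eval, NExp.eval, hF'.na 7 rfl, h7]
    · set v := σ₂.nv 11 with hv
      have h8 : σ₂.na 8 = σ₁.na 8 := hF₂.na 8 rfl
      refine (Runs.fillWhenN (N := q)
        (fun u => if σ₁.na 8 u = 0 ∧ δ v u ≤ σ.rv 4 + σ.rv 4 then v + 1 else σ₁.na 8 u)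
        (by decide) (by decide) (by decide)
        ((hF₂.nv 3 rfl).trans ((hF.nv 3 rfl).trans hq₀)) ?_).conseq le_rfl fun σ₃ hF₃ h' => ?_
      · intro u σ' hu hF' hxu hau
        have e1 : σ'.na 3 = σ.na 3 := (hF'.na 3 rfl).trans ((hF₂.na 3 rfl).trans h3)
        have e2 : σ'.rv 4 = σ.rv 4 := (hF'.rv 4 rfl).trans ((hF₂.rv 4 rfl).trans hr4)
        have e3 : σ'.nv 11 = v := hF'.nv 11 rfl
        have e4 : σ'.na 8 u = σ₁.na 8 u := by rw [hau, h8]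
        simp only [BExp.Holds, RExp.eval, NExp.eval, e1, e2, e3, hxu, e4,
          nonpos_iff_eq_zero, h8]
        exact ⟨fun hb => (if_pos hb).symm, fun hb => (if_neg hb).symm⟩
      · have key := h'.1
        simp only
        rcases h with ⟨hvq, hall⟩ | ⟨hvq, hv0, hmin⟩
        -- Everything is assigned already, so the round changes nothing.
        · have heq : ∀ u < q, σ₃.na 8 u = σ₁.na 8 u := fun u hu => by
            rw [key u hu, if_neg (fun h => hall u hu h.1)]
          refine ⟨fun u hu => ?_, fun a ha => ?_, fun a ha => ?_, Or.inl fun u hu => ?_⟩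
          · rw [heq u hu]
            intro hne
            have := g1 u hu hne
            rw [heq _ this.1]; exact this
          · intro _ u hu h0
            rw [heq u hu] at h0
            exact absurd h0 (hall u hu)
          · rw [heq a ha]
            intro h1 u hu
            rw [heq u hu]
            exact g3 a ha h1 u hu
          · rw [heq u hu]; exact hall u hu
        · have hself : σ₃.na 8 v = v + 1 := by
            rw [key v hvq, if_pos ⟨hv0, by rw [hm.self v hvq]; linarith⟩]
          have hkeep : ∀ u < q, σ₁.na 8 u ≠ 0 → σ₃.na 8 u = σ₁.na 8 u := fun u hu hne => by
            rw [key u hu, if_neg (fun h => hne h.1)]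
          have hold : ∀ u < q, σ₃.na 8 u = u + 1 → u ≠ v → σ₁.na 8 u = u + 1 := by
            intro u hu h1 hne
            rw [key u hu] at h1
            split_ifs at h1 with hc
            · omega
            · exact h1
          refine ⟨fun u hu hne => ?_, fun a ha h1 u hu h0 => ?_, fun a ha h1 u hu h2 hne => ?_, ?_⟩
          · by_cases hu0 : σ₁.na 8 u = 0
            · have hc : σ₁.na 8 u = 0 ∧ δ v u ≤ σ.rv 4 + σ.rv 4 := by
                by_contra hc
                rw [key u hu, if_neg hc] at hne
                exact hne hu0
              have e : σ₃.na 8 u = v + 1 := by rw [key u hu, if_pos hc]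
              rw [e, Nat.add_sub_cancel]
              exact ⟨hvq, hself, hc.2, by exact_mod_cast hmin u hu hu0⟩
            · have := g1 u hu hu0
              rw [hkeep u hu hu0]
              refine ⟨this.1, ?_, this.2.2⟩
              rw [hkeep _ this.1 (by rw [this.2.1]; exact hu0)]
              exact this.2.1
          · have hu0 : σ₁.na 8 u = 0 := by
              by_contra hu0
              rw [hkeep u hu hu0] at h0
              exact hu0 h0
            by_cases hav : a = v
            · subst hav
              by_contra hle
              rw [key u hu, if_pos ⟨hu0, not_lt.1 hle⟩] at h0
              omega
            · exact g2 a ha (hold a ha h1 hav) u hu hu0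
          · by_cases hav : a = v
            · have huv : u ≠ v := fun h => hne (hav.trans h.symm)
              have := g2 u hu (hold u hu h2 huv) v hvq hv0
              rw [hav, hm.symm v hvq u hu]; exact this
            · have ha' := hold a ha h1 hav
              by_cases huv : u = v
              · rw [huv]; exact g2 a ha ha' v hvq hv0
              · exact g3 a ha ha' u hu (hold u hu h2 huv) hne
          · refine Or.inr ?_
            rcases g4 with g4 | g4
            · exact absurd hv0 (g4 v hvq)
            · refine Nat.succ_le_of_lt (g4.trans_lt (Finset.card_lt_card ?_))
              refine ⟨fun u hu => ?_, fun hsub => ?_⟩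
              · rw [Finset.mem_filter, Finset.mem_range] at hu ⊢
                exact ⟨hu.1, by rw [hkeep u hu.1 hu.2]; exact hu.2⟩
              · have := hsub (Finset.mem_filter.2 ⟨Finset.mem_range.2 hvq, by rw [hself]; omega⟩)
                exact (Finset.mem_filter.1 this).2 hv0
  · rintro σ' - ⟨g1, g2, g3, g4⟩
    have hall : ∀ u < q, σ'.na 8 u ≠ 0 := by
      rcases g4 with g4 | g4
      · exact g4
      · intro u hu
        have : (Finset.range q).filter (fun u => σ'.na 8 u ≠ 0) = Finset.range q :=
          Finset.eq_of_subset_of_card_le (Finset.filter_subset _ _) (by simpa using g4)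
        have hu' := Finset.mem_range.2 hu
        rw [← this] at hu'
        exact (Finset.mem_filter.1 hu').2
    refine ⟨fun u hu => (g1 u hu (hall u hu)).1, fun u hu => ?_,
      fun u hu => (g1 u hu (hall u hu)).2.2.1, fun u hu => (g1 u hu (hall u hu)).2.2.2,
      fun u hu v hv hne => ?_⟩
    · have := (g1 u hu (hall u hu)).2.1
      simp only [this]
    · have hu' := g1 u hu (hall u hu)
      have hv' := g1 v hv (hall v hv)
      have := hall u hu
      have := hall v hv
      exact g3 _ hu'.1 (by rw [hu'.2.1]; omega) _ hv'.1 (by rw [hv'.2.1]; omega) hne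

theorem clusterMultCmd_spec (hq : σ.nv 3 = q) :
    Runs I clusterMultCmd σ (q + 1) fun σ' =>
      ∀ v < q, σ'.na 9 v = clusterMult q (σ.na 4) (fun u => σ.na 8 u - 1) v := by
  refine Runs.seq ((Runs.fillN (N := q) (fun _ => 0) (by decide) hq
    (fun _ _ _ _ _ _ => rfl)).conseq le_rfl fun σ₀ hF₀ h0 => ?_)
  have hq₀ : σ₀.nv 3 = q := (hF₀.nv 3 rfl).trans hq
  refine (Runs.forAll (K := 1) (N := q) (fun i σ' =>
    ∀ v < q, σ'.na 9 v = clusterMult i (σ.na 4) (fun u => σ.na 8 u - 1) v)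
    (by omega) hq₀ rfl rfl (by decide) ?_ ?_).conseq (by omega) fun _ _ h => h
  · intro v hv
    simpa [clusterMult] using h0.1 v hv
  · intro i σ₁ hi hF hx hInv
    refine Runs.putN le_rfl ?_
    have h8 : σ₁.na 8 = σ.na 8 := (hF.na 8 rfl).trans (hF₀.na 8 rfl)
    have h4 : σ₁.na 4 = σ.na 4 := (hF.na 4 rfl).trans (hF₀.na 4 rfl)
    simp only [update₂_self, NExp.eval, h8, hx, h4]
    intro v hv
    have hsum : clusterMult (i + 1) (σ.na 4) (fun u => σ.na 8 u - 1) v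
        = clusterMult i (σ.na 4) (fun u => σ.na 8 u - 1) v
          + if σ.na 8 i - 1 = v then σ.na 4 i else 0 := by
      simp only [clusterMult, Finset.range_add_one, Finset.filter_insert]
      split_ifs
      · rw [Finset.sum_insert (by simp), add_comm]
      · rfl
    rw [hsum]
    by_cases hc : σ.na 8 i - 1 = v
    · rw [hc, Function.update_self, if_pos rfl, hInv v hv]
    · rw [Function.update_of_ne (Ne.symm hc), if_neg hc, hInv v hv, add_zero]

end Subroutine

/-! ### Computing and backtracking the knapsack table. -/

/-- Condition for leaving out the cluster `v` when the multiplicity `j` may still be left out; the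
row of the knapsack table starts at the value of register `15`. -/
def leaveOut (v j : ℕ) : BExp :=
  .and (.nle (.get 9 (.var v)) (.var j))
    (.rle (.get 1 (.add (.var 15) (.sub (.var j) (.get 9 (.var v)))))
      (.add (.get 1 (.add (.var 15) (.var j))) (.weight (.get 3 (.get 6 (.var v))))))

/-- Real array `1`: the rows of the knapsack table one after another. -/
def knapsackCmd : Cmd :=
  .seq (fillR 1 10 4 (.ofNat (.lit 0)))
    (.seq (.setN 15 (.lit 0)) (.seq (.setN 16 (.var 4))
      (forAll 10 3 (.seq
        (forAll 13 4 (.ite (leaveOut 10 13)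
          (.putR 1 (.add (.var 16) (.var 13))
            (.get 1 (.add (.var 15) (.sub (.var 13) (.get 9 (.var 10))))))
          (.putR 1 (.add (.var 16) (.var 13))
            (.add (.get 1 (.add (.var 15) (.var 13))) (.weight (.get 3 (.get 6 (.var 10))))))))
        (.seq (.setN 15 (.var 16)) (.setN 16 (.add (.var 16) (.var 4))))))))

/-- Array `5`: the indicator of the solution that the knapsack table describes. -/
def extractCmd : Cmd :=
  .seq (fillN 5 10 3 (.lit 0))
    (.seq (.setN 14 (.var 1))
      (forAll 10 3 (.seq (.setN 12 (.sub (.sub (.var 3) (.var 10)) (.lit 1)))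
        (.seq (.setN 15 (.sub (.var 15) (.var 4)))
          (.ite (leaveOut 12 14) (.setN 14 (.sub (.var 14) (.get 9 (.var 12))))
            (.putN 5 (.get 6 (.var 12)) (.lit 1)))))))

section Knapsack

variable {I : RKCInstance} {σ : RAMState} {q z : ℕ} {r : ℝ}

/-- The real array `1` holds the first rows of the knapsack table. -/
def HoldsTable (σ : RAMState) (z k : ℕ) (A : ℕ → ℕ) (W : ℕ → ℝ) : Prop :=
  ∀ v ≤ k, ∀ j ≤ z, σ.ra 1 (v * (z + 1) + j) = knapTable A W v j

theorem leaveOut_iff {A : ℕ → ℕ} {W : ℕ → ℝ} {x y v j k : ℕ} (hx : σ.nv x = v) (hy : σ.nv y = j)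
    (h15 : σ.nv 15 = v * (z + 1)) (hA : σ.na 9 v = A v)
    (hW : I.natWeight (σ.na 3 (σ.na 6 v)) = W v) (ht : HoldsTable σ z k A W) (hv : v ≤ k)
    (hj : j ≤ z) :
    (leaveOut x y).Holds I σ ↔ A v ≤ j ∧ knapTable A W v (j - A v) ≤ knapTable A W v j + W v := by
  -- Only the equations of `RExp.eval` for `get` and `add` are unfolded, to keep weights in the form
  -- `natWeight`.
  simp only [leaveOut, BExp.Holds, RExp.eval_weight, RExp.eval.eq_2, RExp.eval.eq_6, NExp.eval, hx,
    hy, h15, hA, hW]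
  rw [ht v hv j hj, ht v hv (j - A v) (by omega)]

theorem knapsackCmd_spec (hq : σ.nv 3 = q) (hz : σ.nv 4 = z + 1) :
    Runs I knapsackCmd σ ((z + 2) * (q + 1)) fun σ' =>
      HoldsTable σ' z q (σ.na 9) (fun v => I.idxWeight (σ.na 3) (σ.na 6 v)) ∧
      σ'.nv 15 = q * (z + 1) := by
  set W : ℕ → ℝ := fun v => I.idxWeight (σ.na 3) (σ.na 6 v) with hW
  set A := σ.na 9 with hA
  have hK : z + 2 ≤ (z + 2) * (q + 1) := Nat.le_mul_of_pos_right _ (by omega)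
  refine Runs.seq ((Runs.fillR (N := z + 1) (fun _ => 0) (by decide) hz
    (fun _ _ _ _ _ _ => by simp [RExp.eval, NExp.eval])).conseq hK fun σ₀ hF₀ h0 => ?_)
  refine Runs.seq (Runs.setN (by omega) (Runs.seq (Runs.setN (by omega) ?_)))
  refine (Runs.forAll (K := z + 2) (N := q) (fun i σ' => σ'.nv 15 = i * (z + 1) ∧
    σ'.nv 16 = (i + 1) * (z + 1) ∧ HoldsTable σ' z i A W) (by omega)
    (by simpa using (hF₀.nv 3 rfl).trans hq) rfl rfl (by decide) ?_ ?_).conseq le_rfl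
    fun _ _ h => ⟨h.2.2, h.1⟩
  · refine ⟨by simp [NExp.eval], by simp [NExp.eval, (hF₀.nv 4 rfl).trans hz], ?_⟩
    intro v hv j hj
    obtain rfl : v = 0 := by omega
    simpa [knapTable] using h0.1 j (by omega)
  · rintro i σ₁ hi hF hx ⟨h15, h16, hT⟩
    have e3 : σ₁.na 3 = σ.na 3 := (hF.na 3 rfl).trans (hF₀.na 3 rfl)
    have e6 : σ₁.na 6 = σ.na 6 := (hF.na 6 rfl).trans (hF₀.na 6 rfl)
    have e9 : σ₁.na 9 = A := (hF.na 9 rfl).trans (hF₀.na 9 rfl)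
    have e4 : σ₁.nv 4 = z + 1 := by
      rw [hF.nv 4 rfl]; simpa using (hF₀.nv 4 rfl).trans hz
    refine Runs.seq ((Runs.forAll (K := 1) (N := z + 1) (fun k σ' => HoldsTable σ' z i A W ∧
      ∀ j < k, σ'.ra 1 ((i + 1) * (z + 1) + j) = knapTable A W (i + 1) j) le_rfl e4 rfl rfl
      (by decide) ⟨hT, by simp⟩ ?_).conseq (by omega) fun σ₂ hF₂ h => ?_)
    · rintro k σ₂ hk hF₂ hxk ⟨hT₂, hrow⟩
      have d3 : σ₂.na 3 = σ.na 3 := (hF₂.na 3 rfl).trans e3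
      have d6 : σ₂.na 6 = σ.na 6 := (hF₂.na 6 rfl).trans e6
      have d9 : σ₂.na 9 = A := (hF₂.na 9 rfl).trans e9
      have d15 : σ₂.nv 15 = i * (z + 1) := (hF₂.nv 15 rfl).trans h15
      have d16 : σ₂.nv 16 = (i + 1) * (z + 1) := (hF₂.nv 16 rfl).trans h16
      have d10 : σ₂.nv 10 = i := (hF₂.nv 10 rfl).trans hx
      have hWi : I.natWeight (σ₂.na 3 (σ₂.na 6 i)) = W i := by rw [d3, d6]; rfl
      have hiff := leaveOut_iff (I := I) d10 hxk d15 (by rw [d9]) hWi hT₂ le_rfl (by omega)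
      -- Shared by both branches: a write to entry `k` of row `i + 1` lies beyond all finished rows.
      have fin : ∀ x : ℝ, x = knapTable A W (i + 1) k → ∀ f : ℕ → ℕ,
          HoldsTable { σ₂ with
              nv := f
              ra := update₂ σ₂.ra 1 ((NExp.add (.var 16) (.var 13)).eval σ₂) x } z i A W ∧
          ∀ j < k + 1, update₂ σ₂.ra 1 ((NExp.add (.var 16) (.var 13)).eval σ₂) x 1
            ((i + 1) * (z + 1) + j) = knapTable A W (i + 1) j := by
        intro x hx f
        have e : (NExp.add (.var 16) (.var 13)).eval σ₂ = (i + 1) * (z + 1) + k := by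
          simp only [NExp.eval, d16, hxk]
        rw [e]
        constructor
        · intro v hv j hj
          change update₂ σ₂.ra 1 _ x 1 _ = _
          rw [update₂_self, Function.update_of_ne]
          · exact hT₂ v hv j hj
          · have : (v + 1) * (z + 1) ≤ (i + 1) * (z + 1) := Nat.mul_le_mul_right _ (by omega)
            have e2 : (v + 1) * (z + 1) = v * (z + 1) + (z + 1) := by ring
            omega
        · intro j hj
          rw [update₂_self]
          rcases Nat.lt_succ_iff_lt_or_eq.1 hj with hj | rfl
          · rw [Function.update_of_ne (by omega)]; exact hrow j hj
          · rw [Function.update_self]; exact hx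
      refine Runs.ite le_rfl (fun hb => Runs.putR le_rfl ?_) (fun hb => Runs.putR le_rfl ?_)
      · refine fin _ ?_ _
        rw [hiff] at hb
        rw [knapTable, if_pos hb]
        simp only [RExp.eval, NExp.eval, d15, hxk, d10, d9]
        exact hT₂ i le_rfl _ (by omega)
      · refine fin _ ?_ _
        rw [hiff] at hb
        rw [knapTable, if_neg hb]
        simp only [RExp.eval_weight, RExp.eval.eq_2, RExp.eval.eq_6, NExp.eval, d15, hxk, d10, hWi]
        rw [hT₂ i le_rfl _ (by omega)]
    · have g16 : σ₂.nv 16 = (i + 1) * (z + 1) := (hF₂.nv 16 rfl).trans h16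
      have g4 : σ₂.nv 4 = z + 1 := (hF₂.nv 4 rfl).trans e4
      refine Runs.seq (Runs.setN (by omega) (Runs.setN (by omega) ?_))
      refine ⟨by simp [NExp.eval, g16], by simp [NExp.eval, g16, g4]; ring, ?_⟩
      intro v hv j hj
      rcases Nat.lt_succ_iff_lt_or_eq.1 (Nat.lt_succ_of_le hv) with hv | rfl
      · exact h.1 v (by omega) j hj
      · exact h.2 j (by omega)

/-- Repeating the comparisons of the recurrence from the last row down recovers a selection whose
weight is exactly the table value. -/
theorem extractCmd_spec (hq : σ.nv 3 = q) (hz : σ.nv 4 = z + 1) (hz1 : σ.nv 1 = z)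
    {A : ℕ → ℕ} (hA : ∀ v < q, σ.na 9 v = A v)
    (hT : HoldsTable σ z q A (fun v => I.idxWeight (σ.na 3) (σ.na 6 v)))
    (h15 : σ.nv 15 = q * (z + 1))
    (hle : knapTable A (fun v => I.idxWeight (σ.na 3) (σ.na 6 v)) q z ≤ 1) :
    Runs I extractCmd σ (q + 1) fun σ' => ∃ Q,
      Selectable q A (fun v => I.idxWeight (σ.na 3) (σ.na 6 v)) z Q ∧
      ∀ a < q, σ'.na 5 a ≠ 0 ↔ a ∈ Q.image (σ.na 6) := by
  set W : ℕ → ℝ := fun v => I.idxWeight (σ.na 3) (σ.na 6 v) with hW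
  refine Runs.seq ((Runs.fillN (N := q) (fun _ => 0) (by decide) hq
    (fun _ _ _ _ _ _ => rfl)).conseq le_rfl fun σ₀ hF₀ h0 => ?_)
  refine Runs.seq (Runs.setN (by omega) ?_)
  -- Two conserved quantities: multiplicity left out so far plus the remaining allowance is `z`, and
  -- weight selected so far plus the current table entry is the final table value.
  refine (Runs.forAll (K := 1) (N := q) (fun i σ' => i ≤ q ∧ σ'.nv 15 = (q - i) * (z + 1) ∧
    σ'.nv 14 ≤ z ∧ ∃ Q ⊆ Finset.Ico (q - i) q,
      ∑ v ∈ Finset.Ico (q - i) q \ Q, A v + σ'.nv 14 = z ∧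
      ∑ v ∈ Q, W v + knapTable A W (q - i) (σ'.nv 14) = knapTable A W q z ∧
      ∀ a < q, σ'.na 5 a ≠ 0 ↔ a ∈ Q.image (σ.na 6)) le_rfl
    (by simpa using (hF₀.nv 3 rfl).trans hq) rfl rfl (by decide) ?_ ?_).conseq (by omega) ?_
  · have e1 : σ₀.nv 1 = z := (hF₀.nv 1 rfl).trans hz1
    refine ⟨by omega, by simp [(hF₀.nv 15 rfl).trans h15], by simp [NExp.eval, e1], ∅, by simp,
      by simp [NExp.eval, e1], by simp [NExp.eval, e1], fun a ha => ?_⟩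
    simpa using h0.1 a ha
  · rintro i σ₁ hi hF hx ⟨-, g15, g14, Q, hQ, hQA, hQW, hS⟩
    obtain ⟨v, hv⟩ : ∃ v, q - i = v + 1 := ⟨q - i - 1, by omega⟩
    have hv' : q - (i + 1) = v := by omega
    have hvq : v < q := by omega
    rw [hv] at g15 hQ hQA hQW
    have e3 : σ₁.na 3 = σ.na 3 := (hF.na 3 rfl).trans (hF₀.na 3 rfl)
    have e6 : σ₁.na 6 = σ.na 6 := (hF.na 6 rfl).trans (hF₀.na 6 rfl)
    have e9 : σ₁.na 9 = σ.na 9 := (hF.na 9 rfl).trans (hF₀.na 9 rfl)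
    have er : σ₁.ra 1 = σ.ra 1 := (hF.ra 1 rfl).trans (hF₀.ra 1 rfl)
    have e4 : σ₁.nv 4 = z + 1 := by
      rw [hF.nv 4 rfl]; simpa using (hF₀.nv 4 rfl).trans hz
    have eq3 : σ₁.nv 3 = q := by
      rw [hF.nv 3 rfl]; simpa using (hF₀.nv 3 rfl).trans hq
    refine Runs.seq (Runs.setN le_rfl (Runs.seq (Runs.setN le_rfl ?_)))
    have ev : (NExp.sub (.sub (.var 3) (.var 10)) (.lit 1)).eval σ₁ = v := by
      simp only [NExp.eval, eq3, hx]; omega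
    rw [ev]
    have eb : (NExp.sub (.var 15) (.var 4)).eval
        { σ₁ with nv := Function.update σ₁.nv 12 v } = v * (z + 1) := by
      have : (v + 1) * (z + 1) - (z + 1) = v * (z + 1) := by rw [add_mul, one_mul]; simp
      simpa [NExp.eval, g15, e4] using this
    rw [eb]
    set σ₂ : RAMState :=
      { σ₁ with nv := Function.update (Function.update σ₁.nv 12 v) 15 (v * (z + 1)) } with hσ₂
    have d14 : σ₂.nv 14 = σ₁.nv 14 := by simp [hσ₂]
    have d12 : σ₂.nv 12 = v := by simp [hσ₂]
    have d15 : σ₂.nv 15 = v * (z + 1) := by simp [hσ₂]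
    have hT₂ : HoldsTable σ₂ z q A W := by
      intro a ha j hj
      have : σ₂.ra 1 = σ.ra 1 := er
      rw [this]; exact hT a ha j hj
    have hA₂ : σ₂.na 9 v = A v := by
      have : σ₂.na 9 = σ.na 9 := e9
      rw [this]; exact hA v hvq
    have hiff := leaveOut_iff (I := I) (W := W) (A := A) d12 d14 d15 hA₂
      (show I.natWeight (σ₁.na 3 (σ₁.na 6 v)) = W v by rw [e3, e6]; rfl) hT₂ hvq.le g14
    have hico : Finset.Ico v q = insert v (Finset.Ico (v + 1) q) :=
      (Finset.insert_Ico_add_one_left_eq_Ico hvq).symm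
    have hvQ : v ∉ Q := fun h => by have := Finset.mem_Ico.1 (hQ h); omega
    refine Runs.ite le_rfl (fun hb => Runs.setN le_rfl ?_) (fun hb => Runs.putN le_rfl ?_)
    · rw [hiff] at hb
      have ej : (NExp.sub (.var 14) (.get 9 (.var 12))).eval σ₂ = σ₁.nv 14 - A v := by
        simp only [NExp.eval, d14, d12, hA₂]
      rw [ej]
      simp only [hv']
      refine ⟨by omega, by simp [d15], by simp; omega, Q,
        hQ.trans (Finset.Ico_subset_Ico_left (by omega)), ?_, ?_, hS⟩
      · rw [hico, Finset.insert_sdiff_of_notMem _ hvQ, Finset.sum_insert (by simp)]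
        simp
        omega
      · rw [knapTable, if_pos hb] at hQW
        simpa using hQW
    · rw [hiff] at hb
      simp only [hv']
      refine ⟨by omega, by simp [d15], by simpa [d14] using g14, insert v Q, ?_, ?_, ?_, ?_⟩
      · rw [hico]; exact Finset.insert_subset_insert _ hQ
      · rw [hico, Finset.insert_sdiff_insert, Finset.sdiff_insert_of_notMem (by simp)]
        simpa [d14] using hQA
      · rw [knapTable, if_neg hb] at hQW
        rw [Finset.sum_insert hvQ]
        simp [d14]
        linarith
      · intro a ha
        have ei : (NExp.get 6 (.var 12)).eval σ₂ = σ.na 6 v := by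
          simp only [NExp.eval, d12]
          exact congrFun e6 v
        rw [ei, update₂_self, Finset.image_insert, Finset.mem_insert]
        by_cases hc : a = σ.na 6 v
        · simp [hc, NExp.eval]
        · rw [Function.update_of_ne hc]
          simp only [hc, false_or]
          exact hS a ha
  · rintro σ' - ⟨-, -, g14, Q, hQ, hQA, hQW, hS⟩
    simp only [Nat.sub_self, Nat.Ico_zero_eq_range] at hQ hQA hQW
    refine ⟨Q, ⟨hQ, by omega, ?_⟩, hS⟩
    rw [knapTable, add_zero] at hQW
    linarith

end Knapsack

/-! ### Testing one radius and searching over all radii. -/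

/-- One step of the perceptron: cluster, and then either extract a solution (and set register `20`)
or change the scores. -/
def perceptronStep : Cmd :=
  .seq clusterCmd (.seq clusterMultCmd (.seq knapsackCmd (.seq
    (.ite (.rle (.get 1 (.add (.var 15) (.var 1))) (.ofNat (.lit 1)))
      (.seq extractCmd (.setN 20 (.lit 1)))
      (fillN 7 10 3 (.sub (.add (.get 7 (.var 10)) (.get 9 (.var 10))) (.get 4 (.var 10)))))
    (.setN 21 (.add (.var 21) (.lit 1))))))

/-- The number of steps after which the perceptron has refuted the radius. -/
def stepLimit : RExp :=
  .add (.mul (.mul (.ofNat (.var 3)) (.mul (.mul (.ofNat (.var 3)) (.ofNat (.var 4)))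
    (.mul (.ofNat (.var 3)) (.ofNat (.var 4))))) (.ofNat (.var 3))) (.ofNat (.lit 1))

/-- Find a solution of three times the radius in real register `4`, or refute this radius. -/
def testRadius : Cmd :=
  .seq lightestCmd (.seq (fillN 7 10 3 (.lit 0)) (.seq (.setN 20 (.lit 0)) (.seq (.setN 21 (.lit 0))
    (.while (.and (.nle (.var 20) (.lit 0)) (.not (.rle stepLimit (.ofNat (.var 21)))))
      perceptronStep))))

/-- Try all distances; real register `3` and array `2` hold the best radius and its solution. -/
def searchRadius : Cmd :=
  .seq (.setN 24 (.lit 0)) (forAll 22 3 (forAll 23 3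
    (.seq (.setR 4 (.dist (.get 3 (.var 22)) (.get 3 (.var 23))))
      (.seq testRadius
        (whenCmd (.and (.not (.nle (.var 20) (.lit 0)))
            (.not (.and (.not (.nle (.var 24) (.lit 0))) (.rle (.var 3) (.var 4)))))
          (.seq (.setN 24 (.lit 1)) (.seq (.setR 3 (.var 4))
            (fillN 2 10 3 (.get 5 (.var 10))))))))))

section Search

variable {I : RKCInstance} {σ : RAMState} {q z : ℕ}

/-- Bound on the time of one step of the perceptron. -/
def stepTime (q z : ℕ) : ℕ := (q + z + 3) * (q + 1)

/-- The input of the subroutine is in place. -/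
structure HoldsInput (I : RKCInstance) (σ : RAMState) (q z : ℕ) : Prop where
  z_eq : σ.nv 1 = z
  q_eq : σ.nv 3 = q
  z_succ : σ.nv 4 = z + 1
  lt : ∀ a < q, σ.na 3 a < I.n
  mult_le : ∀ a < q, σ.na 4 a ≤ z + 1

/-- The feasible solutions for the input in the state. -/
def FeasibleAt (I : RKCInstance) (σ : RAMState) (q z : ℕ) (r : ℝ) (S : Finset ℕ) : Prop :=
  Feasible q (I.idxDist (σ.na 3)) (I.idxWeight (σ.na 3)) (σ.na 4) z r S

/-- A table value of at most one is backtracked to a selection, hence to a solution of radius `3 r`.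
Otherwise `Selectable.knapTable_le` excludes every selection, and `potential_step` applies to all
solutions of radius `r` at once. -/
theorem perceptronStep_spec (h : HoldsInput I σ q z) (hr : 0 ≤ σ.rv 4)
    (hB : LightestInBall q (I.idxDist (σ.na 3)) (I.idxWeight (σ.na 3)) (σ.rv 4) (σ.na 6))
    (h20 : σ.nv 20 = 0) :
    Runs I perceptronStep σ (stepTime q z) fun σ' => σ'.nv 21 = σ.nv 21 + 1 ∧
      ((σ'.nv 20 = 1 ∧ ∃ S, FeasibleAt I σ q z (3 * σ.rv 4) S ∧ ∀ a < q, σ'.na 5 a ≠ 0 ↔ a ∈ S) ∨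
       (σ'.nv 20 = 0 ∧ ∀ S, FeasibleAt I σ q z (σ.rv 4) S →
          potential q z (I.idxDist (σ.na 3)) (σ.rv 4) S (σ'.na 7) + stepBound q z
            ≤ potential q z (I.idxDist (σ.na 3)) (σ.rv 4) S (σ.na 7))) := by
  obtain ⟨hz, hq, hz1, hP, hμ⟩ := h
  have hm := I.indexMetric hP
  have hω : ∀ a < q, 0 ≤ I.idxWeight (σ.na 3) a := fun a _ => I.natWeight_nonneg _
  have hT : 1 ≤ stepTime q z := Nat.mul_pos (by omega) (by omega)
  have hT0 : (q + 1) ≤ stepTime q z := Nat.le_mul_of_pos_left _ (by omega)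
  have hT1 : (q + 1) * (q + 1) ≤ stepTime q z := Nat.mul_le_mul_right _ (by omega)
  have hT2 : (z + 2) * (q + 1) ≤ stepTime q z := Nat.mul_le_mul_right _ (by omega)
  refine Runs.seq ((clusterCmd_spec hq hr hP).conseq hT1 fun σ₁ hF₁ hc => ?_)
  refine Runs.seq ((clusterMultCmd_spec (q := q) ((hF₁.nv 3 rfl).trans hq)).conseq hT0
    fun σ₂ hF₂ hA => ?_)
  rw [hF₁.na 4 rfl] at hA
  set ρ : ℕ → ℕ := fun u => σ₁.na 8 u - 1 with hρ
  have q2 : σ₂.nv 3 = q := (hF₂.nv 3 rfl).trans ((hF₁.nv 3 rfl).trans hq)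
  have z2 : σ₂.nv 4 = z + 1 := (hF₂.nv 4 rfl).trans ((hF₁.nv 4 rfl).trans hz1)
  refine Runs.seq ((knapsackCmd_spec q2 z2).conseq hT2 fun σ₃ hF₃ hK => ?_)
  have q3 : σ₃.nv 3 = q := (hF₃.nv 3 rfl).trans q2
  have z3 : σ₃.nv 4 = z + 1 := (hF₃.nv 4 rfl).trans z2
  have y3 : σ₃.nv 1 = z := by rw [hF₃.nv 1 rfl, hF₂.nv 1 rfl, hF₁.nv 1 rfl, hz]
  have e3 : σ₃.na 3 = σ.na 3 := by rw [hF₃.na 3 rfl, hF₂.na 3 rfl, hF₁.na 3 rfl]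
  have e6 : σ₃.na 6 = σ.na 6 := by rw [hF₃.na 6 rfl, hF₂.na 6 rfl, hF₁.na 6 rfl]
  have e4 : σ₃.na 4 = σ.na 4 := by rw [hF₃.na 4 rfl, hF₂.na 4 rfl, hF₁.na 4 rfl]
  have e7 : σ₃.na 7 = σ.na 7 := by rw [hF₃.na 7 rfl, hF₂.na 7 rfl, hF₁.na 7 rfl]
  have e9 : σ₃.na 9 = σ₂.na 9 := hF₃.na 9 rfl
  have e21 : σ₃.nv 21 = σ.nv 21 := by rw [hF₃.nv 21 rfl, hF₂.nv 21 rfl, hF₁.nv 21 rfl]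
  have e20 : σ₃.nv 20 = 0 := by rw [hF₃.nv 20 rfl, hF₂.nv 20 rfl, hF₁.nv 20 rfl, h20]
  rw [show σ₂.na 3 = σ₃.na 3 from (hF₃.na 3 rfl).symm,
    show σ₂.na 6 = σ₃.na 6 from (hF₃.na 6 rfl).symm, ← e9] at hK
  have hval : RExp.eval I σ₃ (.get 1 (.add (.var 15) (.var 1)))
      = knapTable (σ₃.na 9) (fun v => I.idxWeight (σ₃.na 3) (σ₃.na 6 v)) q z := by
    simp only [RExp.eval, NExp.eval, hK.2, y3]
    exact hK.1 q le_rfl z le_rfl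
  have hAcongr : ∀ Q, Selectable q (σ₃.na 9) (fun v => I.idxWeight (σ.na 3) (σ.na 6 v)) z Q ↔
      Selectable q (clusterMult q (σ.na 4) ρ) (fun v => I.idxWeight (σ.na 3) (σ.na 6 v)) z Q := by
    intro Q
    have : ∑ v ∈ Finset.range q \ Q, σ₃.na 9 v
        = ∑ v ∈ Finset.range q \ Q, clusterMult q (σ.na 4) ρ v :=
      Finset.sum_congr rfl fun v hv => by
        rw [e9]; exact hA v (Finset.mem_range.1 (Finset.mem_sdiff.1 hv).1)
    rw [Selectable, Selectable, this]
  refine Runs.seq (Runs.ite hT (fun hb => ?_) (fun hb => ?_))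
  · simp only [BExp.Holds] at hb
    rw [hval] at hb
    simp only [RExp.eval, NExp.eval, Nat.cast_one] at hb
    refine Runs.seq ((extractCmd_spec (A := σ₃.na 9) q3 z3 y3 (fun _ _ => rfl) hK.1 hK.2
      hb).conseq hT0 fun σ₄ hF₄ h => ?_)
    obtain ⟨Q, hQ, hS⟩ := h
    rw [e3, e6, hAcongr] at hQ
    rw [e6] at hS
    refine Runs.setN hT (Runs.setN hT ?_)
    refine ⟨by simp [NExp.eval, hF₄.nv 21 rfl, e21], Or.inl ⟨by simp [NExp.eval], Q.image (σ.na 6),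
      hQ.feasible hm hω hB hc, hS⟩⟩
  · simp only [BExp.Holds] at hb
    rw [hval] at hb
    simp only [RExp.eval, NExp.eval, Nat.cast_one] at hb
    refine (Runs.fillN (N := q) (fun a => σ.na 7 a + clusterMult q (σ.na 4) ρ a - σ.na 4 a)
      (by decide) q3 ?_).conseq hT0 fun σ₄ hF₄ h => ?_
    · intro a σ' ha hF' hx h7
      simp only [NExp.eval, hx, h7, hF'.na 9 rfl, hF'.na 4 rfl, e7, e9, e4, hA a ha]
    · refine Runs.setN hT ?_
      refine ⟨by simp [NExp.eval, hF₄.nv 21 rfl, e21], Or.inr ⟨by simp [hF₄.nv 20 rfl, e20], ?_⟩⟩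
      intro S hS
      refine potential_step hμ hm hω hB hc hS ?_ h.1
      rintro ⟨Q, hQ⟩
      rw [← hAcongr, ← e3, ← e6] at hQ
      exact hb hQ.knapTable_le

/-- With `L = stepBound q z`, the potential of a solution of radius `r` starts at no more than `L *
(L * q)`, loses at least `L` per failed step and is never negative. So `L * q + 1` failures refute
the radius. -/
theorem testRadius_spec (h : HoldsInput I σ q z) (hr : 0 ≤ σ.rv 4) (hq1 : 1 ≤ q) :
    Runs I testRadius σ (stepTime q z * (stepBound q z * q + 2)) fun σ' =>
      (σ'.nv 20 = 1 ∧ ∃ S, FeasibleAt I σ q z (3 * σ.rv 4) S ∧ ∀ a < q, σ'.na 5 a ≠ 0 ↔ a ∈ S) ∨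
      (σ'.nv 20 = 0 ∧ ∀ S, ¬ FeasibleAt I σ q z (σ.rv 4) S) := by
  have hT : 1 ≤ stepTime q z := Nat.mul_pos (by omega) (by omega)
  have hT0 : (q + 1) ≤ stepTime q z := Nat.le_mul_of_pos_left _ (by omega)
  have hT1 : (q + 1) * (q + 1) ≤ stepTime q z := Nat.mul_le_mul_right _ (by omega)
  have hT2 : stepTime q z ≤ stepTime q z * (stepBound q z * q + 2) :=
    Nat.le_mul_of_pos_right _ (by omega)
  refine Runs.seq ((lightestCmd_spec h.q_eq hr h.lt).conseq (hT1.trans hT2) fun σ₁ hF₁ hB => ?_)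
  refine Runs.seq ((Runs.fillN (N := q) (fun _ => 0) (by decide) ((hF₁.nv 3 rfl).trans h.q_eq)
    (fun _ _ _ _ _ _ => rfl)).conseq (hT0.trans hT2) fun σ₂ hF₂ h0 => ?_)
  refine Runs.seq (Runs.setN (hT.trans hT2) (Runs.seq (Runs.setN (hT.trans hT2) ?_)))
  set σ₃ : RAMState := { σ₂ with nv := Function.update (Function.update σ₂.nv 20 0) 21 0 } with hσ₃
  have f1 : σ₃.nv 1 = σ.nv 1 := by simp [hσ₃, hF₂.nv 1 rfl, hF₁.nv 1 rfl]
  have f3 : σ₃.nv 3 = σ.nv 3 := by simp [hσ₃, hF₂.nv 3 rfl, hF₁.nv 3 rfl]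
  have f4 : σ₃.nv 4 = σ.nv 4 := by simp [hσ₃, hF₂.nv 4 rfl, hF₁.nv 4 rfl]
  have g3 : σ₃.na 3 = σ.na 3 := (hF₂.na 3 rfl).trans (hF₁.na 3 rfl)
  have g4 : σ₃.na 4 = σ.na 4 := (hF₂.na 4 rfl).trans (hF₁.na 4 rfl)
  have g6 : σ₃.na 6 = σ₁.na 6 := hF₂.na 6 rfl
  have r4 : σ₃.rv 4 = σ.rv 4 := (hF₂.rv 4 rfl).trans (hF₁.rv 4 rfl)
  have hlim : ∀ σ', Frame perceptronStep σ₃ σ' → (RExp.eval I σ' stepLimit ≤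
      RExp.eval I σ' (.ofNat (.var 21)) ↔ stepBound q z * q + 1 ≤ σ'.nv 21) := by
    intro σ' hF
    have e : RExp.eval I σ' stepLimit = ((stepBound q z * q + 1 : ℕ) : ℝ) := by
      simp only [stepLimit, RExp.eval, NExp.eval, hF.nv 3 rfl, hF.nv 4 rfl, f3, f4, h.q_eq,
        h.z_succ, stepBound]
      push_cast; ring
    rw [e]
    simp only [RExp.eval, NExp.eval]
    exact Nat.cast_le
  refine (Runs.whileLoop (K := stepTime q z) (stepBound q z * q + 1) (fun i σ' => σ'.nv 21 = i ∧
      ((σ'.nv 20 = 1 ∧ ∃ S, FeasibleAt I σ q z (3 * σ.rv 4) S ∧ ∀ a < q, σ'.na 5 a ≠ 0 ↔ a ∈ S) ∨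
       (σ'.nv 20 = 0 ∧ ∀ S, FeasibleAt I σ q z (σ.rv 4) S →
          potential q z (I.idxDist (σ.na 3)) (σ.rv 4) S (σ'.na 7) + stepBound q z * i
            ≤ (stepBound q z : ℤ) * (stepBound q z * q : ℕ)))) hT ?_ ?_ ?_)
  · refine ⟨by simp [NExp.eval], Or.inr ⟨by simp [NExp.eval], fun S _ => ?_⟩⟩
    have := potential_zero (q := q) (z := z) (δ := I.idxDist (σ.na 3)) (r := σ.rv 4) S
      (X := σ₃.na 7) h0.1
    simpa using this
  · rintro i σ' hF ⟨h21, hI⟩ hb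
    simp only [BExp.Holds, hlim σ' hF, NExp.eval, h21, not_le, nonpos_iff_eq_zero] at hb
    refine ⟨hb.2, ?_⟩
    rcases hI with ⟨h1, -⟩ | ⟨h1, hI⟩
    · omega
    have k3 : σ'.na 3 = σ.na 3 := (hF.na 3 rfl).trans g3
    have k4 : σ'.na 4 = σ.na 4 := (hF.na 4 rfl).trans g4
    have k6 : σ'.na 6 = σ₁.na 6 := (hF.na 6 rfl).trans g6
    have kr : σ'.rv 4 = σ.rv 4 := (hF.rv 4 rfl).trans r4
    have hin : HoldsInput I σ' q z :=
      ⟨(hF.nv 1 rfl).trans (f1.trans h.z_eq), (hF.nv 3 rfl).trans (f3.trans h.q_eq),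
        (hF.nv 4 rfl).trans (f4.trans h.z_succ), by rw [k3]; exact h.lt,
        by rw [k4]; exact h.mult_le⟩
    refine (perceptronStep_spec hin (by rw [kr]; exact hr) (by rw [k3, k6, kr]; exact hB)
      h1).conseq le_rfl fun σ'' _ hpost => ?_
    simp only [FeasibleAt, k3, k4, kr] at hpost ⊢
    refine ⟨by rw [hpost.1, h21], ?_⟩
    rcases hpost.2 with hpost | ⟨h1', hpost⟩
    · exact Or.inl hpost
    · refine Or.inr ⟨h1', fun S hS => ?_⟩
      have a1 := hpost S hS
      have a2 := hI S hS
      push_cast at a1 a2 ⊢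
      linarith
  · rintro i σ' hF hi ⟨h21, hI⟩ hb
    simp only [BExp.Holds, hlim σ' hF, NExp.eval, h21, not_le, nonpos_iff_eq_zero] at hb
    rcases hI with hI | ⟨h1, hI⟩
    · exact Or.inl hI
    · refine Or.inr ⟨h1, fun S hS => ?_⟩
      have hi' : i = stepBound q z * q + 1 := by
        by_contra hne
        exact hb ⟨h1, by omega⟩
      have a1 := hI S hS
      have a2 := potential_nonneg (q := q) (z := z) (δ := I.idxDist (σ.na 3)) (r := σ.rv 4)
        (X := σ'.na 7) S
      have a3 : 1 ≤ stepBound q z :=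
        Nat.mul_pos hq1 (pow_pos (Nat.mul_pos hq1 (Nat.succ_pos z)) 2)
      rw [hi'] at a1
      push_cast at a1
      have a4 : (1 : ℤ) ≤ stepBound q z := by exact_mod_cast a3
      nlinarith

/-- The state of the search after the radii in `tried` have been tested. -/
def BestSoFar (I : RKCInstance) (σ : RAMState) (q z : ℕ) (tried : ℕ → ℕ → Prop) (σ' : RAMState) :
    Prop :=
  (σ'.nv 24 = 0 ∧ ∀ a b, tried a b → ∀ S, ¬ FeasibleAt I σ q z (I.idxDist (σ.na 3) a b) S) ∨
  (σ'.nv 24 = 1 ∧ 0 ≤ σ'.rv 3 ∧ (∃ S, FeasibleAt I σ q z (3 * σ'.rv 3) S ∧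
      ∀ a < q, σ'.na 2 a ≠ 0 ↔ a ∈ S) ∧
    ∀ a b, tried a b → ∀ S, FeasibleAt I σ q z (I.idxDist (σ.na 3) a b) S →
      σ'.rv 3 ≤ I.idxDist (σ.na 3) a b)

theorem BestSoFar.congr {tried tried' : ℕ → ℕ → Prop} {σ' : RAMState}
    (h : BestSoFar I σ q z tried σ') (h' : ∀ a b, tried' a b → tried a b) :
    BestSoFar I σ q z tried' σ' := by
  rcases h with ⟨h1, h2⟩ | ⟨h1, h2, h3, h4⟩
  · exact Or.inl ⟨h1, fun a b hab => h2 a b (h' a b hab)⟩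
  · exact Or.inr ⟨h1, h2, h3, fun a b hab => h4 a b (h' a b hab)⟩

theorem searchRadius_spec (h : HoldsInput I σ q z) (hq1 : 1 ≤ q) :
    Runs I searchRadius σ (stepTime q z * (stepBound q z * q + 2) * (q + 1) * (q + 1))
      (BestSoFar I σ q z fun a b => a < q ∧ b < q) := by
  set T := stepTime q z * (stepBound q z * q + 2) with hTdef
  have hT0 : (q + 1) ≤ stepTime q z := Nat.le_mul_of_pos_left _ (by omega)
  have hTq : q + 1 ≤ T := hT0.trans (Nat.le_mul_of_pos_right _ (by omega))
  have hT : 1 ≤ T := by omega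
  have hT1 : 1 ≤ T * (q + 1) := Nat.mul_pos hT (by omega)
  refine Runs.seq (Runs.setN (Nat.mul_pos hT1 (by omega)) ?_)
  refine (Runs.forAll (K := T * (q + 1)) (N := q)
    (fun i => BestSoFar I σ q z fun a b => a < i ∧ b < q) hT1 (by simpa using h.q_eq)
    rfl rfl (by decide) ?_ ?_)
  · exact Or.inl ⟨by simp [NExp.eval], by simp⟩
  intro i σ₁ hi hF₁ hx₁ hI₁
  refine (Runs.forAll (K := T) (N := q)
    (fun k => BestSoFar I σ q z fun a b => (a < i ∧ b < q) ∨ (a = i ∧ b < k)) hT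
    (by rw [hF₁.nv 3 rfl]; simpa using h.q_eq)
    rfl rfl (by decide) ?_ ?_).conseq le_rfl fun σ' _ h' => ?_
  · refine BestSoFar.congr (tried := fun a b => a < i ∧ b < q) ?_ (by simp)
    simpa [BestSoFar] using hI₁
  · intro k σ₂ hk hF₂ hx₂ hI₂
    have m1 : σ₂.nv 1 = z := by rw [hF₂.nv 1 rfl, hF₁.nv 1 rfl]; simpa using h.z_eq
    have m3 : σ₂.nv 3 = q := by rw [hF₂.nv 3 rfl, hF₁.nv 3 rfl]; simpa using h.q_eq
    have m4 : σ₂.nv 4 = z + 1 := by rw [hF₂.nv 4 rfl, hF₁.nv 4 rfl]; simpa using h.z_succ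
    have n3 : σ₂.na 3 = σ.na 3 := (hF₂.na 3 rfl).trans (hF₁.na 3 rfl)
    have n4 : σ₂.na 4 = σ.na 4 := (hF₂.na 4 rfl).trans (hF₁.na 4 rfl)
    have m22 : σ₂.nv 22 = i := (hF₂.nv 22 rfl).trans hx₁
    refine Runs.seq (Runs.setR hT ?_)
    have er : RExp.eval I σ₂ (.dist (.get 3 (.var 22)) (.get 3 (.var 23)))
        = I.idxDist (σ.na 3) i k := by
      simp only [RExp.eval_dist, NExp.eval, m22, hx₂, n3]; rfl
    rw [er]
    set σ₃ : RAMState :=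
      { σ₂ with rv := Function.update σ₂.rv 4 (I.idxDist (σ.na 3) i k) } with hσ₃
    have r3 : σ₃.rv 4 = I.idxDist (σ.na 3) i k := by simp [hσ₃]
    have hin : HoldsInput I σ₃ q z := ⟨m1, m3, m4, by rw [show σ₃.na 3 = σ.na 3 from n3]; exact h.lt,
      by rw [show σ₃.na 4 = σ.na 4 from n4]; exact h.mult_le⟩
    refine Runs.seq ((testRadius_spec hin (by rw [r3]; exact I.natDist_nonneg _ _) hq1).conseq
      le_rfl fun σ₄ hF₄ h₄ => ?_)
    simp only [FeasibleAt, r3, show σ₃.na 3 = σ.na 3 from n3, show σ₃.na 4 = σ.na 4 from n4] at h₄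
    have s4 : σ₄.rv 4 = I.idxDist (σ.na 3) i k := (hF₄.rv 4 rfl).trans r3
    have s3 : σ₄.rv 3 = σ₂.rv 3 := (hF₄.rv 3 rfl).trans (by simp [hσ₃])
    have s24 : σ₄.nv 24 = σ₂.nv 24 := hF₄.nv 24 rfl
    have sna : σ₄.na 2 = σ₂.na 2 := hF₄.na 2 rfl
    have hcase : ∀ a b, ((a < i ∧ b < q) ∨ (a = i ∧ b < k + 1)) →
        ((a < i ∧ b < q) ∨ (a = i ∧ b < k)) ∨ (a = i ∧ b = k) := by omega
    refine Runs.when hT (fun hb => ?_) (fun hb => ?_)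
    · simp only [BExp.Holds, RExp.eval, NExp.eval, s4, s3, s24, nonpos_iff_eq_zero] at hb
      obtain ⟨hb1, hb2⟩ := hb
      rcases h₄ with ⟨-, S, hS, hind⟩ | ⟨h20, -⟩
      swap
      · exact absurd h20 hb1
      refine Runs.seq (Runs.setN hT (Runs.seq (Runs.setR hT ?_)))
      refine (Runs.fillN (a := 2) (x := 10) (l := 3) (N := q) (σ₄.na 5) (by decide)
        (by simpa using (hF₄.nv 3 rfl).trans m3)
        ?_).conseq hTq fun σ₅ hF₅ h₅ => ?_
      · intro a σ' _ hF' hx' _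
        simp only [NExp.eval, hx', hF'.na 5 rfl]
      · have t3 : σ₅.rv 3 = I.idxDist (σ.na 3) i k := by
          rw [hF₅.rv 3 rfl]; simpa [RExp.eval] using s4
        have t24 : σ₅.nv 24 = 1 := by rw [hF₅.nv 24 rfl]; simp [NExp.eval]
        refine Or.inr ⟨by simpa using t24, ?_, ⟨S, ?_, fun a ha => ?_⟩, fun a b hab S' hS' => ?_⟩
        · simp only [t3]; exact I.natDist_nonneg _ _
        · simp only [t3]; exact hS
        · simp only [h₅.1 a ha]; exact hind a ha
        · simp only [t3]
          rcases hcase a b hab with hab | ⟨rfl, rfl⟩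
          · rcases hI₂ with ⟨-, h2⟩ | ⟨h1, -, -, h3⟩
            · exact absurd hS' (h2 a b hab S')
            · have h3' := h3 a b hab S' hS'
              have : ¬ σ₂.rv 3 ≤ I.idxDist (σ.na 3) i k := fun hle => hb2 ⟨by omega, hle⟩
              linarith
          · exact le_rfl
    · simp only [BExp.Holds, RExp.eval, NExp.eval, s4, s3, s24, nonpos_iff_eq_zero] at hb
      rcases hI₂ with ⟨h1, h2⟩ | ⟨h1, h2, h3, h3'⟩
      · refine Or.inl ⟨by simpa [s24] using h1, fun a b hab S' hS' => ?_⟩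
        rcases hcase a b hab with hab | ⟨rfl, rfl⟩
        · exact h2 a b hab S' hS'
        · rcases h₄ with ⟨h20, -⟩ | ⟨-, hno⟩
          · exact hb ⟨by omega, fun h => h.1 h1⟩
          · exact hno S' hS'
      · refine Or.inr ⟨by simpa [s24] using h1, ?_, ?_, fun a b hab S' hS' => ?_⟩
        · simpa [s3] using h2
        · simpa [s3, sna] using h3
        · simp only [s3]
          rcases hcase a b hab with hab | ⟨rfl, rfl⟩
          · exact h3' a b hab S' hS'
          · rcases h₄ with ⟨h20, -⟩ | ⟨-, hno⟩
            · by_contra hle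
              exact hb ⟨by omega, fun h => hle h.2⟩
            · exact absurd hS' (hno S')
  · refine BestSoFar.congr (tried := fun a b => (a < i ∧ b < q) ∨ (a = i ∧ b < q)) ?_
      (by intro a b hab; omega)
    simpa [BestSoFar] using h'

end Search

/-! ### The coreset -/

/-- The state of the farthest-first traversal after `c` centers: `P` lists the centers, `L j` is the
index of the center that is closest to `j`, and `E j` is its distance. -/
structure FarthestFirst (I : RKCInstance) (c : ℕ) (P L : ℕ → ℕ) (E : ℕ → ℝ) : Prop where
  lt : ∀ a < c, P a < I.n
  label_lt : ∀ j < I.n, L j < c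
  dist_eq : ∀ j < I.n, E j = I.natDist (P (L j)) j
  dist_le : ∀ a < c, ∀ j < I.n, E j ≤ I.natDist (P a) j
  label_center : ∀ a < c, L (P a) = a
  spread : ∀ b < c, ∀ a < b, ∀ j < I.n, E j ≤ I.natDist (P a) (P b)

theorem RKCInstance.natDist_self (I : RKCInstance) (i : ℕ) : I.natDist i i = 0 := by
  simp [RKCInstance.natDist, I.d_self]

theorem RKCInstance.eq_of_natDist_eq_zero {I : RKCInstance} {i j : ℕ} (hi : i < I.n) (hj : j < I.n)
    (h : I.natDist i j = 0) : i = j := by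
  simp only [RKCInstance.natDist, hi, hj, and_self, dite_true] at h
  simpa using I.eq_of_d_eq_zero _ _ h

/-- With fewer labels than points two points share a label; if all distances to the centers
vanished, both would equal the center with that label. -/
theorem FarthestFirst.pos_of_lt {I : RKCInstance} {c : ℕ} {P L : ℕ → ℕ} {E : ℕ → ℝ}
    (h : FarthestFirst I c P L E) (hc : c < I.n) {f : ℕ} (hmax : ∀ j < I.n, E j ≤ E f) :
    0 < E f := by
  by_contra hle
  obtain ⟨x, hx, y, hy, hne, hxy⟩ := Finset.exists_ne_map_eq_of_card_lt_of_maps_to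
    (s := Finset.range I.n) (t := Finset.range c) (by simpa using hc) (f := L)
    (fun j hj => by simpa using h.label_lt j (by simpa using hj))
  rw [Finset.mem_range] at hx hy
  have key : ∀ j < I.n, P (L j) = j := fun j hj => by
    refine RKCInstance.eq_of_natDist_eq_zero (h.lt _ (h.label_lt j hj)) hj (le_antisymm ?_ ?_)
    · rw [← h.dist_eq j hj]; linarith [hmax j hj]
    · exact I.natDist_nonneg _ _
  apply hne
  rw [← key x hx, ← key y hy, hxy]

/-- The clause `spread` survives because `E f` bounds all of `E` and is at most the distance of `f`
to each earlier center. Ties keep the old label, so old centers keep theirs; positivity of `E f`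
gives the new center its own. -/
theorem FarthestFirst.step {I : RKCInstance} {c : ℕ} {P L : ℕ → ℕ} {E : ℕ → ℝ}
    (h : FarthestFirst I c P L E) (hc : c < I.n) {f : ℕ} (hf : f < I.n)
    (hmax : ∀ j < I.n, E j ≤ E f) {P' L' : ℕ → ℕ} {E' : ℕ → ℝ}
    (hP : P' = Function.update P c f)
    (hL : ∀ j < I.n, L' j = if E j ≤ I.natDist f j then L j else c)
    (hE : ∀ j < I.n, E' j = if E j ≤ I.natDist f j then E j else I.natDist f j) :
    FarthestFirst I (c + 1) P' L' E' := by
  have hpos := h.pos_of_lt hc hmax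
  have hPc : P' c = f := by simp [hP]
  have hPa : ∀ a < c, P' a = P a := fun a ha => by
    rw [hP, Function.update_of_ne (by omega)]
  have hEE : ∀ j < I.n, E' j ≤ E j := fun j hj => by
    rw [hE j hj]; split_ifs with hle
    · exact le_rfl
    · exact (not_le.1 hle).le
  refine ⟨fun a ha => ?_, fun j hj => ?_, fun j hj => ?_, fun a ha j hj => ?_, fun a ha => ?_,
    fun b hb a hab j hj => ?_⟩
  · rcases Nat.lt_succ_iff_lt_or_eq.1 ha with ha | rfl
    · rw [hPa a ha]; exact h.lt a ha
    · rw [hPc]; exact hf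
  · rw [hL j hj]; split_ifs
    · exact (h.label_lt j hj).trans (Nat.lt_succ_self c)
    · exact Nat.lt_succ_self c
  · rw [hE j hj, hL j hj]
    split_ifs
    · rw [hPa _ (h.label_lt j hj)]; exact h.dist_eq j hj
    · rw [hPc]
  · rcases Nat.lt_succ_iff_lt_or_eq.1 ha with ha | rfl
    · rw [hPa a ha]; exact (hEE j hj).trans (h.dist_le a ha j hj)
    · rw [hPc, hE j hj]; split_ifs with hle
      · exact hle
      · exact le_rfl
  · rcases Nat.lt_succ_iff_lt_or_eq.1 ha with ha | rfl
    · rw [hPa a ha, hL _ (h.lt a ha), if_pos, h.label_center a ha]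
      have := h.dist_le a ha (P a) (h.lt a ha)
      rw [I.natDist_self] at this
      exact this.trans (I.natDist_nonneg _ _)
    · rw [hPc, hL f hf, if_neg]
      rw [I.natDist_self]; linarith
  · rcases Nat.lt_succ_iff_lt_or_eq.1 hb with hb | rfl
    · rw [hPa b hb, hPa a (by omega)]
      exact (hEE j hj).trans (h.spread b hb a hab j hj)
    · rw [hPc, hPa a hab]
      exact (hEE j hj).trans ((hmax j hj).trans (h.dist_le a hab f hf))

/-- Register `11`: a point of maximum distance to the centers. -/
def farthestCmd : Cmd :=
  argmin 11 12 0 (.nle (.lit 0) (.lit 0)) (.sub (.ofNat (.lit 0)) (.get 0 (.var 12)))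
    (.sub (.ofNat (.lit 0)) (.get 0 (.var 11)))

/-- The current point is closer to the new center than to the previous ones. -/
def closerTest : BExp := .not (.rle (.get 0 (.var 10)) (.dist (.var 11) (.var 10)))

/-- Farthest-first traversal with `min τ n` centers; real register `1` holds the radius. -/
def centersCmd : Cmd :=
  .seq (.setN 5 (.sub (.var 2) (.sub (.var 2) (.var 0))))
    (.seq (fillR 0 10 0 (.dist (.lit 0) (.var 10)))
      (.seq (fillN 1 10 0 (.lit 0))
        (.seq (.putN 3 (.lit 0) (.lit 0))
          (.seq (.setN 3 (.lit 1))
            (.seq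
              (forUp 3 5 (.seq farthestCmd (.seq (.putN 3 (.var 3) (.var 11))
                (.seq (fillWhenN 1 10 0 closerTest (.var 3))
                  (fillWhenR 0 10 0 closerTest (.dist (.var 11) (.var 10)))))))
              (.seq farthestCmd (.setR 1 (.get 0 (.var 11)))))))))

/-- Arrays `3` and `4`: the lightest points and the truncated sizes of the clusters. -/
def repsCmd : Cmd :=
  .seq (fillN 4 10 3 (.lit 0))
    (.seq (forAll 10 0 (.seq
        (.putN 4 (.get 1 (.var 10)) (.add (.get 4 (.get 1 (.var 10))) (.lit 1)))
        (whenCmd (.not (.rle (.weight (.get 3 (.get 1 (.var 10)))) (.weight (.var 10))))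
          (.putN 3 (.get 1 (.var 10)) (.var 10)))))
      (fillN 4 10 3 (.sub (.get 4 (.var 10)) (.sub (.get 4 (.var 10)) (.var 4)))))

section Coreset

variable {I : RKCInstance} {σ : RAMState} {q τ : ℕ}

theorem farthestCmd_spec (hn : σ.nv 0 = I.n) :
    Runs I farthestCmd σ (I.n + 1) fun σ' =>
      σ'.nv 11 < I.n ∧ ∀ j < I.n, σ.ra 0 j ≤ σ.ra 0 (σ'.nv 11) := by
  refine (Runs.argmin (N := I.n) (fun _ => True) (fun j => -σ.ra 0 j) (by decide) (by decide)
    (by decide) (by decide) (by decide) (by decide) hn ?_ ?_ ?_).conseq le_rfl fun σ' _ h => ?_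
  · intro σ' _ _; simp [BExp.Holds]
  · intro σ' hF _; simp [RExp.eval, NExp.eval, hF.ra 0 rfl]
  · intro σ' hF _; simp [RExp.eval, NExp.eval, hF.ra 0 rfl]
  · rcases h with ⟨-, h⟩ | ⟨h1, -, h2⟩
    · exact absurd trivial (h 0 I.n_pos)
    · exact ⟨h1, fun j hj => by have := h2 j hj trivial; linarith⟩

theorem centersCmd_spec (hn : σ.nv 0 = I.n) (hτ : σ.nv 2 = τ) (hτ1 : 1 ≤ τ) :
    Runs I centersCmd σ ((I.n + 1) * (min τ I.n + 1)) fun σ' =>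
      σ'.nv 3 = min τ I.n ∧ FarthestFirst I (min τ I.n) (σ'.na 3) (σ'.na 1) (σ'.ra 0) ∧
      ∃ f < I.n, σ'.rv 1 = σ'.ra 0 f ∧ ∀ j < I.n, σ'.ra 0 j ≤ σ'.ra 0 f := by
  have hnpos := I.n_pos
  have hmin : 1 ≤ min τ I.n := le_min hτ1 hnpos
  have hK : I.n + 1 ≤ (I.n + 1) * (min τ I.n + 1) := Nat.le_mul_of_pos_right _ (by omega)
  have hK1 : 1 ≤ (I.n + 1) * (min τ I.n + 1) := by omega
  refine Runs.seq (Runs.setN hK1 ?_)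
  -- Truncated subtraction computes a minimum: `a - (a - b) = min a b`.
  have h5 : (NExp.sub (.var 2) (.sub (.var 2) (.var 0))).eval σ = min τ I.n := by
    simp only [NExp.eval, hτ, hn]; omega
  rw [h5]
  refine Runs.seq ((Runs.fillR (N := I.n) (I.natDist 0) (by decide) (by simpa using hn)
    ?_).conseq hK fun σ₁ hF₁ h₁ => ?_)
  · intro j σ' _ _ hx _
    simp only [RExp.eval_dist, NExp.eval, hx]
  refine Runs.seq ((Runs.fillN (N := I.n) (fun _ => 0) (by decide)
    (by rw [hF₁.nv 0 rfl]; simpa using hn) (fun _ _ _ _ _ _ => rfl)).conseq hK fun σ₂ hF₂ h₂ => ?_)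
  refine Runs.seq (Runs.putN hK1 (Runs.seq (Runs.setN hK1 ?_)))
  have n2 : σ₂.nv 0 = I.n := by rw [hF₂.nv 0 rfl, hF₁.nv 0 rfl]; simpa using hn
  have l2 : σ₂.nv 5 = min τ I.n := by rw [hF₂.nv 5 rfl, hF₁.nv 5 rfl]; simp
  refine Runs.seq ((Runs.forUp (K := I.n + 1) (a := 1) (N := min τ I.n)
    (fun i σ' => FarthestFirst I i (σ'.na 3) (σ'.na 1) (σ'.ra 0)) (by omega)
    (by simp [NExp.eval]) (by simpa using l2) hmin rfl rfl (by decide) ?_ ?_).conseq le_rfl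
    fun σ₃ hF₃ h₃ => ?_)
  · have e3 : ∀ f : ℕ → ℕ → ℕ, update₂ f 3 ((NExp.lit 0).eval σ₂) ((NExp.lit 0).eval σ₂) 3 0
        = 0 := by intro f; simp [update₂_self, NExp.eval]
    have er : σ₂.ra 0 = σ₁.ra 0 := hF₂.ra 0 rfl
    refine ⟨fun a ha => ?_, fun j hj => ?_, fun j hj => ?_, fun a ha j hj => ?_, fun a ha => ?_,
      fun b hb a hab => by omega⟩
    · obtain rfl : a = 0 := by omega
      simp only [e3]; exact hnpos
    · simp only [update₂_of_ne _ _ _ (show 1 ≠ 3 by decide), h₂.1 j hj]; omega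
    · simp only [update₂_of_ne _ _ _ (show 1 ≠ 3 by decide), h₂.1 j hj, e3, er, h₁.1 j hj]
    · obtain rfl : a = 0 := by omega
      simp only [e3, er, h₁.1 j hj, le_refl]
    · obtain rfl : a = 0 := by omega
      simp only [e3, update₂_of_ne _ _ _ (show 1 ≠ 3 by decide), h₂.1 0 hnpos]
  · intro i σ₃ h1i hi hF₃ hx hI
    have n3 : σ₃.nv 0 = I.n := by rw [hF₃.nv 0 rfl]; simpa using n2
    have hin : i < I.n := hi.trans_le (min_le_right _ _)
    refine Runs.seq ((farthestCmd_spec n3).conseq le_rfl fun σ₄ hF₄ h₄ => ?_)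
    set f := σ₄.nv 11 with hf
    have x4 : σ₄.nv 3 = i := (hF₄.nv 3 rfl).trans hx
    refine Runs.seq (Runs.putN (by omega) ?_)
    have en : (NExp.var 11).eval σ₄ = f := rfl
    have ei : (NExp.var 3).eval σ₄ = i := x4
    rw [en, ei]
    set σ₅ : RAMState := { σ₄ with na := update₂ σ₄.na 3 i f } with hσ₅
    have p5 : σ₅.na 3 = Function.update (σ₃.na 3) i f := by
      rw [hσ₅]; simp only [update₂_self, hF₄.na 3 rfl]
    have c5 : σ₅.na 1 = σ₃.na 1 := by
      rw [hσ₅]; simp only [update₂_of_ne _ _ _ (show 1 ≠ 3 by decide), hF₄.na 1 rfl]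
    have r5 : σ₅.ra 0 = σ₃.ra 0 := hF₄.ra 0 rfl
    have n5 : σ₅.nv 0 = I.n := (hF₄.nv 0 rfl).trans n3
    -- Labels are updated before distances, and each distance is tested before it is overwritten, so
    -- both loops see the old values.
    have hcond : ∀ j σ', σ'.ra 0 j = σ₃.ra 0 j → σ'.nv 11 = f → σ'.nv 10 = j →
        (closerTest.Holds I σ' ↔ ¬ σ₃.ra 0 j ≤ I.natDist f j) := by
      intro j σ' g1 g2 g3
      simp only [closerTest, BExp.Holds, RExp.eval_dist, RExp.eval.eq_2, NExp.eval, g1, g2, g3]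
    refine Runs.seq ((Runs.fillWhenN (N := I.n)
      (fun j => if σ₃.ra 0 j ≤ I.natDist f j then σ₃.na 1 j else i) (by decide) (by decide)
      (by decide) n5 ?_).conseq le_rfl fun σ₆ hF₆ h₆ => ?_)
    · intro j σ' hj hF' hxj hoj
      rw [hcond j σ' (by rw [hF'.ra 0 rfl, r5]) (hF'.nv 11 rfl) hxj]
      refine ⟨fun hb => ?_, fun hb => ?_⟩
      · rw [if_neg hb]
        exact (hF'.nv 3 rfl).trans x4
      · rw [if_pos (not_not.1 hb), c5]
    have r6 : σ₆.ra 0 = σ₃.ra 0 := (hF₆.ra 0 rfl).trans r5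
    have f6 : σ₆.nv 11 = f := hF₆.nv 11 rfl
    refine (Runs.fillWhenR (N := I.n)
      (fun j => if σ₃.ra 0 j ≤ I.natDist f j then σ₃.ra 0 j else I.natDist f j) (by decide)
      (by decide) (by decide) ((hF₆.nv 0 rfl).trans n5) ?_).conseq le_rfl fun σ₇ hF₇ h₇ => ?_
    · intro j σ' hj hF' hxj hoj
      rw [hcond j σ' (by rw [hoj, r6]) ((hF'.nv 11 rfl).trans f6) hxj]
      refine ⟨fun hb => ?_, fun hb => ?_⟩
      · rw [if_neg hb]
        simp only [RExp.eval_dist, NExp.eval, (hF'.nv 11 rfl).trans f6, hxj]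
      · rw [if_pos (not_not.1 hb), r6]
    · refine hI.step hin h₄.1 h₄.2 ?_ ?_ h₇.1
      · simp only [hF₇.na 3 rfl, hF₆.na 3 rfl, p5]
      · intro j hj
        simp only [hF₇.na 1 rfl, h₆.1 j hj]
  · have n3 : σ₃.nv 0 = I.n := by rw [hF₃.nv 0 rfl]; simpa using n2
    refine Runs.seq ((farthestCmd_spec n3).conseq hK fun σ₄ hF₄ h₄ => ?_)
    refine Runs.setR hK1 ?_
    simp only [hF₄.nv 3 rfl, hF₄.na 3 rfl, hF₄.na 1 rfl, hF₄.ra 0 rfl]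
    exact ⟨h₃.1, h₃.2, σ₄.nv 11, h₄.1, by simp [RExp.eval, NExp.eval, hF₄.ra 0 rfl], h₄.2⟩

/-- Array `3` starts with the centers, which belong to their own clusters by `hLP`, and an entry is
replaced only by a lighter point of the same cluster. -/
theorem repsCmd_spec {z : ℕ} (hn : σ.nv 0 = I.n) (hq : σ.nv 3 = q) (hz : σ.nv 4 = z + 1)
    (hqn : q ≤ I.n)
    (hP : ∀ a < q, σ.na 3 a < I.n) (hL : ∀ j < I.n, σ.na 1 j < q)
    (hLP : ∀ a < q, σ.na 1 (σ.na 3 a) = a) :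
    Runs I repsCmd σ (I.n + 1) fun σ' => ∀ a < q, σ'.na 3 a < I.n ∧ σ.na 1 (σ'.na 3 a) = a ∧
      (∀ j < I.n, σ.na 1 j = a → I.natWeight (σ'.na 3 a) ≤ I.natWeight j) ∧
      σ'.na 4 a = min ((Finset.range I.n).filter fun j => σ.na 1 j = a).card (z + 1) := by
  refine Runs.seq ((Runs.fillN (N := q) (fun _ => 0) (by decide) hq
    (fun _ _ _ _ _ _ => rfl)).conseq (by omega) fun σ₁ hF₁ h₁ => ?_)
  have e3 : σ₁.na 3 = σ.na 3 := hF₁.na 3 rfl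
  have e1 : σ₁.na 1 = σ.na 1 := hF₁.na 1 rfl
  refine Runs.seq ((Runs.forAll (K := 1) (N := I.n) (fun i σ' => ∀ a < q, σ'.na 3 a < I.n ∧
      σ.na 1 (σ'.na 3 a) = a ∧
      (∀ j < i, σ.na 1 j = a → I.natWeight (σ'.na 3 a) ≤ I.natWeight j) ∧
      σ'.na 4 a = ((Finset.range i).filter fun j => σ.na 1 j = a).card) le_rfl
    ((hF₁.nv 0 rfl).trans hn) rfl rfl (by decide) ?_ ?_).conseq (by omega) fun σ₂ hF₂ h₂ => ?_)
  · intro a ha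
    refine ⟨?_, ?_, by simp, ?_⟩
    · simp only [e3]; exact hP a ha
    · simp only [e3]; exact hLP a ha
    · simpa using h₁.1 a ha
  · intro i σ₂ hi hF₂ hx hI
    have d1 : σ₂.na 1 = σ.na 1 := (hF₂.na 1 rfl).trans e1
    set c := σ.na 1 i with hc
    have hcq : c < q := hL i hi
    refine Runs.seq (Runs.putN le_rfl ?_)
    have ec : (NExp.get 1 (.var 10)).eval σ₂ = c := by simp only [NExp.eval, d1, hx, hc]
    have ev : (NExp.add (.get 4 (.get 1 (.var 10))) (.lit 1)).eval σ₂ = σ₂.na 4 c + 1 := by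
      simp only [NExp.eval, d1, hx, hc]
    rw [ec, ev]
    have hcard : ∀ a, ((Finset.range (i + 1)).filter fun j => σ.na 1 j = a).card
        = ((Finset.range i).filter fun j => σ.na 1 j = a).card + if c = a then 1 else 0 := by
      intro a
      rw [Finset.range_add_one, Finset.filter_insert]
      split_ifs
      · rw [Finset.card_insert_of_notMem (by simp)]
      · rfl
    have hM : ∀ a < q, update₂ σ₂.na 4 c (σ₂.na 4 c + 1) 4 a
        = ((Finset.range (i + 1)).filter fun j => σ.na 1 j = a).card := by
      intro a ha
      rw [hcard, update₂_self, ← (hI a ha).2.2.2]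
      by_cases hca : c = a
      · rw [hca, if_pos rfl, Function.update_self]
      · rw [if_neg hca, Function.update_of_ne (Ne.symm hca), add_zero]
    set σ₃ : RAMState := { σ₂ with na := update₂ σ₂.na 4 c (σ₂.na 4 c + 1) } with hσ₃
    have f1 : σ₃.na 1 = σ.na 1 := by
      rw [hσ₃]; simp only [update₂_of_ne _ _ _ (show 1 ≠ 4 by decide), d1]
    have f3 : σ₃.na 3 = σ₂.na 3 := by
      rw [hσ₃]; simp only [update₂_of_ne _ _ _ (show 3 ≠ 4 by decide)]
    have f10 : σ₃.nv 10 = i := hx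
    refine Runs.when le_rfl (fun hb => Runs.putN le_rfl ?_) (fun hb => ?_)
    · simp only [BExp.Holds, RExp.eval_weight, NExp.eval, f1, f3, f10, not_le] at hb
      intro a ha
      have ea : (NExp.get 1 (.var 10)).eval σ₃ = c := by simp only [NExp.eval, f1, f10, hc]
      have eb : (NExp.var 10).eval σ₃ = i := f10
      simp only [ea, eb, update₂_self, update₂_of_ne _ _ _ (show 4 ≠ 3 by decide), f3]
      by_cases hca : a = c
      · subst hca
        rw [Function.update_self]
        refine ⟨hi, rfl, fun j hj hja => ?_, hM _ ha⟩
        rcases Nat.lt_succ_iff_lt_or_eq.1 hj with hj | rfl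
        · exact hb.le.trans ((hI _ ha).2.2.1 j hj hja)
        · exact le_rfl
      · rw [Function.update_of_ne hca]
        obtain ⟨g1, g2, g3, -⟩ := hI a ha
        refine ⟨g1, g2, fun j hj hja => ?_, hM a ha⟩
        rcases Nat.lt_succ_iff_lt_or_eq.1 hj with hj | rfl
        · exact g3 j hj hja
        · exact absurd hja.symm hca
    · simp only [BExp.Holds, RExp.eval_weight, NExp.eval, f1, f3, f10, not_not] at hb
      intro a ha
      simp only [f3]
      obtain ⟨g1, g2, g3, -⟩ := hI a ha
      refine ⟨g1, g2, fun j hj hja => ?_, hM a ha⟩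
      rcases Nat.lt_succ_iff_lt_or_eq.1 hj with hj | rfl
      · exact g3 j hj hja
      · rw [← hja]; exact hb
  · refine (Runs.fillN (N := q) (fun a => min (σ₂.na 4 a) (z + 1)) (by decide)
      (by rw [hF₂.nv 3 rfl, hF₁.nv 3 rfl, hq]) ?_).conseq (by omega) fun σ₃ hF₃ h₃ => ?_
    · intro a σ' _ hF' hx h4
      have : σ'.nv 4 = z + 1 := by rw [hF'.nv 4 rfl, hF₂.nv 4 rfl, hF₁.nv 4 rfl, hz]
      simp only [NExp.eval, hx, h4, this]; omega
    · intro a ha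
      rw [h₃.1 a ha, hF₃.na 3 rfl, (h₂ a ha).2.2.2]
      exact ⟨(h₂ a ha).1, (h₂ a ha).2.1, (h₂ a ha).2.2.1, rfl⟩

end Coreset

/-! ### From indices to points -/

/-- A sum of at most `z` contains no term that was truncated at `z + 1`. -/
theorem sum_le_of_sum_min_le {ι : Type*} {s : Finset ι} {f : ι → ℕ} {z : ℕ}
    (h : ∑ i ∈ s, min (f i) (z + 1) ≤ z) : ∑ i ∈ s, f i ≤ z := by
  have : ∀ i ∈ s, min (f i) (z + 1) = f i := fun i hi => by
    have := (Finset.single_le_sum (f := fun i => min (f i) (z + 1)) (fun _ _ => Nat.zero_le _)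
      hi).trans h
    omega
  rwa [Finset.sum_congr rfl this] at h

/-- The points `p a` with indices `a < q` form the set `T`; `μ` and `m` are the multiplicities. -/
structure Indexing (I : RKCInstance) (q : ℕ) (p : ℕ → Fin I.n) (T : Finset (Fin I.n))
    (m : Fin I.n → ℕ) (δ : ℕ → ℕ → ℝ) (ω : ℕ → ℝ) (μ : ℕ → ℕ) : Prop where
  inj : ∀ a < q, ∀ b < q, p a = p b → a = b
  image : T = (Finset.range q).image p
  dist : ∀ a < q, ∀ b < q, δ a b = I.d (p a) (p b)
  weight : ∀ a < q, ω a = I.w (p a)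
  mult : ∀ a < q, μ a = min (m (p a)) (I.z + 1)
  total : I.z < ∑ i ∈ T, m i

namespace Indexing

variable {I : RKCInstance} {q : ℕ} {p : ℕ → Fin I.n} {T : Finset (Fin I.n)}
    {m : Fin I.n → ℕ} {δ : ℕ → ℕ → ℝ} {ω : ℕ → ℝ} {μ : ℕ → ℕ} {S : Finset ℕ}

theorem sum_image (h : Indexing I q p T m δ ω μ) {R : Type*} [AddCommMonoid R] (f : Fin I.n → R)
    {S : Finset ℕ} (hS : S ⊆ Finset.range q) : ∑ i ∈ S.image p, f i = ∑ a ∈ S, f (p a) :=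
  Finset.sum_image fun a ha b hb hab =>
    h.inj a (Finset.mem_range.1 (hS ha)) b (Finset.mem_range.1 (hS hb)) hab

theorem fits_iff (h : Indexing I q p T m δ ω μ) (hS : S ⊆ Finset.range q) :
    I.Fits (S.image p) ↔ ∑ a ∈ S, ω a ≤ 1 := by
  rw [RKCInstance.Fits, h.sum_image _ hS,
    Finset.sum_congr rfl fun a ha => h.weight a (Finset.mem_range.1 (hS ha))]

theorem uncovered_subset {R : ℝ} : uncovered q δ R S ⊆ Finset.range q :=
  fun _ ha => Finset.mem_range.2 (mem_uncovered.1 ha).1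

/-- The best `X` consists of all covered points, and truncation does not affect the comparison with
`z`. -/
theorem costMult_le_iff (h : Indexing I q p T m δ ω μ) (hS : S ⊆ Finset.range q) {R : ℝ}
    (hR : 0 ≤ R) :
    I.costMult T m (S.image p) ≤ ENNReal.ofReal R ↔ ∑ a ∈ uncovered q δ R S, μ a ≤ I.z := by
  classical
  have hu := uncovered_subset (q := q) (δ := δ) (S := S) (R := R)
  have hmin : ∑ a ∈ uncovered q δ R S, μ a
      = ∑ a ∈ uncovered q δ R S, min (m (p a)) (I.z + 1) :=
    Finset.sum_congr rfl fun a ha => h.mult a (Finset.mem_range.1 (hu ha))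
  rw [RKCInstance.costMult_le_iff hR, hmin]
  constructor
  · rintro ⟨X, ⟨hXT, hX⟩, hcov⟩
    calc ∑ a ∈ uncovered q δ R S, min (m (p a)) (I.z + 1)
        ≤ ∑ a ∈ uncovered q δ R S, m (p a) := Finset.sum_le_sum fun _ _ => min_le_left _ _
      _ = ∑ i ∈ (uncovered q δ R S).image p, m i := (h.sum_image _ hu).symm
      _ ≤ ∑ i ∈ T \ X, m i := by
          refine Finset.sum_le_sum_of_subset fun i hi => ?_
          obtain ⟨a, ha, rfl⟩ := Finset.mem_image.1 hi
          rw [mem_uncovered] at ha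
          rw [Finset.mem_sdiff, h.image]
          refine ⟨Finset.mem_image_of_mem _ (Finset.mem_range.2 ha.1), fun hpX => ?_⟩
          obtain ⟨c, hc, hle⟩ := hcov _ hpX
          obtain ⟨b, hb, rfl⟩ := Finset.mem_image.1 hc
          have := ha.2 b hb
          rw [h.dist a ha.1 b (Finset.mem_range.1 (hS hb))] at this
          linarith
      _ ≤ I.z := by
          have := Finset.sum_sdiff (f := m) hXT
          omega
  · intro hle
    have hle := sum_le_of_sum_min_le hle
    rw [← h.sum_image _ hu] at hle
    refine ⟨T \ (uncovered q δ R S).image p, ⟨Finset.sdiff_subset, ?_⟩, fun i hi => ?_⟩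
    · have hsub : (uncovered q δ R S).image p ⊆ T := by
        rw [h.image]; exact Finset.image_subset_image hu
      have := Finset.sum_sdiff (f := m) hsub
      omega
    · rw [Finset.mem_sdiff, h.image] at hi
      obtain ⟨a, ha, rfl⟩ := Finset.mem_image.1 hi.1
      rw [Finset.mem_range] at ha
      have hna : a ∉ uncovered q δ R S := fun hau => hi.2 (Finset.mem_image_of_mem _ hau)
      rw [mem_uncovered] at hna
      push Not at hna
      obtain ⟨c, hc, hle⟩ := hna ha
      refine ⟨p c, Finset.mem_image_of_mem _ hc, ?_⟩
      rwa [h.dist a ha c (Finset.mem_range.1 (hS hc))] at hle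

theorem feasible_iff (h : Indexing I q p T m δ ω μ) {R : ℝ} (hR : 0 ≤ R) :
    Feasible q δ ω μ I.z R S ↔ S ⊆ Finset.range q ∧ I.Fits (S.image p) ∧
      I.costMult T m (S.image p) ≤ ENNReal.ofReal R := by
  constructor
  · intro hf
    exact ⟨hf.sub, (h.fits_iff hf.sub).2 hf.weight, (h.costMult_le_iff hf.sub hR).2 hf.out⟩
  · rintro ⟨h1, h2, h3⟩
    exact ⟨h1, (h.fits_iff h1).1 h2, (h.costMult_le_iff h1 hR).1 h3⟩

theorem exists_eq_image (h : Indexing I q p T m δ ω μ) {S₀ : Finset (Fin I.n)} (hS : S₀ ⊆ T) :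
    ∃ S ⊆ Finset.range q, S.image p = S₀ := by
  classical
  refine ⟨(Finset.range q).filter fun a => p a ∈ S₀, Finset.filter_subset _ _, ?_⟩
  ext i
  simp only [Finset.mem_image, Finset.mem_filter]
  constructor
  · rintro ⟨a, ⟨-, ha⟩, rfl⟩; exact ha
  · intro hi
    have := hS hi
    rw [h.image] at this
    obtain ⟨a, ha, rfl⟩ := Finset.mem_image.1 this
    exact ⟨a, ⟨ha, hi⟩, rfl⟩

/-- The optimum is the distance of two of the points. -/
theorem exists_feasible_opt (h : Indexing I q p T m δ ω μ) : ∃ a < q, ∃ b < q, ∃ S,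
    Feasible q δ ω μ I.z (δ a b) S ∧ I.optMult T m = ENNReal.ofReal (δ a b) := by
  have hTne : T.Nonempty := by
    rw [Finset.nonempty_iff_ne_empty]
    rintro rfl
    have := h.total
    simp at this
  obtain ⟨t, ht⟩ := hTne
  have hfin : I.optMult T m < ⊤ := by
    obtain ⟨R, hR, hb⟩ := I.exists_bound
    refine lt_of_le_of_lt (RKCInstance.optMult_le_iff.2 ⟨{t}, ⟨by simpa using ht,
      RKCInstance.fits_singleton _⟩, (RKCInstance.costMult_le_iff hR).2 ⟨T, ⟨le_rfl, by omega⟩,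
      fun i _ => ⟨t, by simp, hb _ _⟩⟩⟩) (ENNReal.ofReal_lt_top (r := R))
  obtain ⟨S₀, ⟨hS₀T, hfit⟩, hS₀⟩ := exists_eq_iInf_of_prop (fun S => S ⊆ T ∧ I.Fits S)
    (fun S => I.costMult T m S) ⟨{t}, by simpa using ht, RKCInstance.fits_singleton _⟩
  obtain ⟨X, ⟨hXT, hX⟩, hXv⟩ := exists_eq_iInf_of_prop
    (fun X => X ⊆ T ∧ ∑ i ∈ T, m i ≤ ∑ i ∈ X, m i + I.z)
    (fun X => X.sup fun i => I.distTo i S₀) ⟨T, le_rfl, by omega⟩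
  -- By `total` not everything may be left out. So the maximum over `X` is taken at some point, and
  -- its distance to the solution at some center.
  have hXne : X.Nonempty := by
    rw [Finset.nonempty_iff_ne_empty]
    rintro rfl
    have := h.total
    simp at hX
    omega
  have hv : X.sup (fun i => I.distTo i S₀) = I.optMult T m := hXv.trans hS₀
  obtain ⟨i, hi, hiv⟩ := Finset.exists_mem_eq_sup X hXne fun i => I.distTo i S₀
  have hSne : S₀.Nonempty := by
    rw [Finset.nonempty_iff_ne_empty]
    rintro rfl
    rw [hiv] at hv
    simp only [RKCInstance.distTo, Finset.inf_empty] at hv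
    exact absurd hfin (by rw [← hv]; exact lt_irrefl _)
  obtain ⟨c, hc, hcv⟩ := Finset.exists_mem_eq_inf S₀ hSne fun c => ENNReal.ofReal (I.d i c)
  have hiT := hXT hi
  have hcT := hS₀T hc
  rw [h.image] at hiT hcT
  obtain ⟨a, ha, rfl⟩ := Finset.mem_image.1 hiT
  obtain ⟨b, hb, rfl⟩ := Finset.mem_image.1 hcT
  rw [Finset.mem_range] at ha hb
  have hval : I.optMult T m = ENNReal.ofReal (δ a b) := by
    rw [← hv, hiv, RKCInstance.distTo, hcv, h.dist a ha b hb]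
  obtain ⟨S, hS, rfl⟩ := h.exists_eq_image hS₀T
  refine ⟨a, ha, b, hb, S, (h.feasible_iff ?_).2 ⟨hS, hfit, ?_⟩, hval⟩
  · rw [h.dist a ha b hb]; exact RKCInstance.d_nonneg _ _
  · rw [← hval]; exact hS₀.le

/-- The optimum is one of the distances to which `hbest` applies, so `R` is at most the optimum. -/
theorem isApproxMult (h : Indexing I q p T m δ ω μ) {R : ℝ} (hR : 0 ≤ R)
    (hS : Feasible q δ ω μ I.z (3 * R) S)
    (hbest : ∀ a b, a < q ∧ b < q → ∀ S', Feasible q δ ω μ I.z (δ a b) S' → R ≤ δ a b) :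
    I.IsApproxMult 3 T m (S.image p) := by
  obtain ⟨a, ha, b, hb, S', hS', hopt⟩ := h.exists_feasible_opt
  obtain ⟨h1, h2, h3⟩ := (h.feasible_iff (by positivity)).1 hS
  refine ⟨by rw [h.image]; exact Finset.image_subset_image h1, h2, h3.trans ?_⟩
  rw [hopt, ← ENNReal.ofReal_mul (by norm_num)]
  exact ENNReal.ofReal_le_ofReal (by linarith [hbest a b ⟨ha, hb⟩ S' hS'])

/-- `E a` is the distance of `a` to the nearest index in `S`. -/
def IsNearest (q : ℕ) (δ : ℕ → ℕ → ℝ) (S : Finset ℕ) (E : ℕ → ℝ) : Prop :=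
  ∀ a < q, (∃ c ∈ S, E a = δ a c) ∧ ∀ c ∈ S, E a ≤ δ a c

theorem uncovered_eq {E : ℕ → ℝ} (hE : IsNearest q δ S E) (R : ℝ) :
    uncovered q δ R S = (Finset.range q).filter fun u => R < E u := by
  ext u
  rw [mem_uncovered, Finset.mem_filter, Finset.mem_range]
  refine and_congr_right fun hu => ⟨fun h => ?_, fun h c hc => h.trans_le ((hE u hu).2 c hc)⟩
  obtain ⟨c, hc, e⟩ := (hE u hu).1
  rw [e]; exact h c hc

/-- The uncovered set changes only at values of `E`. For the lower bound, rounding the cost down to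
the largest value of `E` below it leaves the same points uncovered. -/
theorem costMult_eq (h : Indexing I q p T m δ ω μ) (hS : S ⊆ Finset.range q) {E : ℕ → ℝ}
    (hE : IsNearest q δ S E) {a : ℕ} (ha : a < q)
    (ha1 : ∑ u ∈ Finset.range q with E a < E u, μ u ≤ I.z)
    (ha2 : ∀ b < q, ∑ u ∈ Finset.range q with E b < E u, μ u ≤ I.z → E a ≤ E b) :
    E a = (I.costMult T m (S.image p)).toReal := by
  have hE0 : ∀ u < q, 0 ≤ E u := fun u hu => by
    obtain ⟨c, hc, e⟩ := (hE u hu).1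
    rw [e, h.dist u hu c (Finset.mem_range.1 (hS hc))]; exact RKCInstance.d_nonneg _ _
  have hle : I.costMult T m (S.image p) ≤ ENNReal.ofReal (E a) := by
    rw [h.costMult_le_iff hS (hE0 a ha), uncovered_eq hE]; exact ha1
  have hfin := (hle.trans_lt ENNReal.ofReal_lt_top).ne
  refine le_antisymm ?_ ?_
  · set R := (I.costMult T m (S.image p)).toReal with hR
    have h1 := (h.costMult_le_iff hS (R := R) ENNReal.toReal_nonneg).1
      (ENNReal.ofReal_toReal hfin).ge
    rw [uncovered_eq hE] at h1
    have hne : ((Finset.range q).filter fun u => E u ≤ R).Nonempty := by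
      rw [Finset.nonempty_iff_ne_empty]
      intro hemp
      have hall : ((Finset.range q).filter fun u => R < E u) = Finset.range q := by
        refine Finset.filter_true_of_mem fun u hu => ?_
        by_contra hle
        have : u ∈ (Finset.range q).filter fun u => E u ≤ R :=
          Finset.mem_filter.2 ⟨hu, not_lt.1 hle⟩
        rw [hemp] at this
        simp at this
      rw [hall, Finset.sum_congr rfl fun u hu => h.mult u (Finset.mem_range.1 hu)] at h1
      have h1 := sum_le_of_sum_min_le h1
      rw [← h.sum_image _ le_rfl, ← h.image] at h1
      have := h.total
      omega
    obtain ⟨b, hb, hmax⟩ := Finset.exists_max_image _ E hne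
    rw [Finset.mem_filter, Finset.mem_range] at hb
    refine (ha2 b hb.1 (le_trans (Finset.sum_le_sum_of_subset fun u hu => ?_) h1)).trans hb.2
    rw [Finset.mem_filter] at hu ⊢
    refine ⟨hu.1, ?_⟩
    by_contra hle
    exact absurd (hmax u (Finset.mem_filter.2 ⟨hu.1, not_lt.1 hle⟩)) (not_le.2 hu.2)
  · exact ENNReal.toReal_le_of_le_ofReal (hE0 a ha) hle

end Indexing

/-! ### Cost and output of the solution -/

/-- Array `0`: the indicator of the solution. -/
def writeSolution : Cmd :=
  .seq (fillN 0 10 0 (.lit 0))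
    (forAll 10 3 (whenCmd (.not (.nle (.get 2 (.var 10)) (.lit 0)))
      (.putN 0 (.get 3 (.var 10)) (.lit 1))))

/-- Real array `2`: the distances to the solution. -/
def nearestCmd : Cmd :=
  forAll 10 3 (.seq
    (argmin 11 12 3 (.not (.nle (.get 2 (.var 12)) (.lit 0)))
      (.dist (.get 3 (.var 10)) (.get 3 (.var 12))) (.dist (.get 3 (.var 10)) (.get 3 (.var 11))))
    (.putR 2 (.var 10) (.dist (.get 3 (.var 10)) (.get 3 (.var 11)))))

/-- Array `10`: the total multiplicity of the points that are farther from the solution. -/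
def fartherMult : Cmd :=
  forAll 10 3 (.seq (.setN 11 (.lit 0)) (.seq
    (forAll 12 3 (whenCmd (.not (.rle (.get 2 (.var 12)) (.get 2 (.var 10))))
      (.setN 11 (.add (.var 11) (.get 4 (.var 12))))))
    (.putN 10 (.var 10) (.var 11))))

/-- Real register `2`: the cost of the solution. -/
def costCmd : Cmd :=
  .seq (argmin 11 12 3 (.nle (.get 10 (.var 12)) (.var 1)) (.get 2 (.var 12)) (.get 2 (.var 11)))
    (.setR 2 (.get 2 (.var 11)))

section Output

variable {I : RKCInstance} {σ : RAMState} {q z : ℕ}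

theorem writeSolution_spec (hn : σ.nv 0 = I.n) (hq : σ.nv 3 = q) :
    Runs I writeSolution σ ((I.n + 1) * (q + 1)) fun σ' =>
      ∀ j < I.n, σ'.na 0 j ≠ 0 ↔ ∃ a < q, σ.na 2 a ≠ 0 ∧ σ.na 3 a = j := by
  have hK : I.n + 1 ≤ (I.n + 1) * (q + 1) := Nat.le_mul_of_pos_right _ (by omega)
  have hK' : 1 * (q + 1) ≤ (I.n + 1) * (q + 1) := Nat.mul_le_mul_right _ (by omega)
  refine Runs.seq ((Runs.fillN (N := I.n) (fun _ => 0) (by decide) hn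
    (fun _ _ _ _ _ _ => rfl)).conseq hK fun σ₁ hF₁ h₁ => ?_)
  refine (Runs.forAll (K := 1) (N := q) (fun i σ' => ∀ j < I.n, σ'.na 0 j ≠ 0 ↔
    ∃ a < i, σ.na 2 a ≠ 0 ∧ σ.na 3 a = j) le_rfl ((hF₁.nv 3 rfl).trans hq) rfl rfl (by decide)
    ?_ ?_).conseq hK' fun _ _ h => h
  · intro j hj
    simpa using h₁.1 j hj
  · intro i σ₂ hi hF₂ hx hI
    have e2 : σ₂.na 2 = σ.na 2 := (hF₂.na 2 rfl).trans (hF₁.na 2 rfl)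
    have e3 : σ₂.na 3 = σ.na 3 := (hF₂.na 3 rfl).trans (hF₁.na 3 rfl)
    have hex : ∀ j, (∃ a < i + 1, σ.na 2 a ≠ 0 ∧ σ.na 3 a = j) ↔
        (∃ a < i, σ.na 2 a ≠ 0 ∧ σ.na 3 a = j) ∨ (σ.na 2 i ≠ 0 ∧ σ.na 3 i = j) := by
      intro j
      constructor
      · rintro ⟨a, ha, h⟩
        rcases Nat.lt_succ_iff_lt_or_eq.1 ha with ha | rfl
        · exact Or.inl ⟨a, ha, h⟩
        · exact Or.inr h
      · rintro (⟨a, ha, h⟩ | h)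
        · exact ⟨a, by omega, h⟩
        · exact ⟨i, by omega, h⟩
    refine Runs.when le_rfl (fun hb => Runs.putN le_rfl ?_) (fun hb => ?_)
    · simp only [BExp.Holds, NExp.eval, hx, e2, nonpos_iff_eq_zero] at hb
      intro j hj
      simp only [update₂_self, NExp.eval, hx, e3]
      rw [hex]
      by_cases hc : j = σ.na 3 i
      · subst hc
        simp [hb]
      · rw [Function.update_of_ne hc, hI j hj]
        simp [Ne.symm hc]
    · simp only [BExp.Holds, NExp.eval, hx, e2, nonpos_iff_eq_zero, not_not] at hb
      intro j hj
      rw [hex, hI j hj]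
      simp [hb]

theorem nearestCmd_spec (hq : σ.nv 3 = q) {S : Finset ℕ} (hSq : S ⊆ Finset.range q)
    (hne : S.Nonempty) (hS : ∀ a < q, σ.na 2 a ≠ 0 ↔ a ∈ S) :
    Runs I nearestCmd σ ((q + 1) * (q + 1)) fun σ' =>
      Indexing.IsNearest q (I.idxDist (σ.na 3)) S (σ'.ra 2) := by
  refine (Runs.forAll (K := q + 1) (N := q) (fun i σ' => ∀ a < i,
      (∃ c ∈ S, σ'.ra 2 a = I.idxDist (σ.na 3) a c) ∧ ∀ c ∈ S, σ'.ra 2 a ≤ I.idxDist (σ.na 3) a c)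
      (by omega) hq rfl rfl (by decide) (by simp) ?_).conseq le_rfl fun _ _ h => h
  intro i σ₁ hi hF₁ hx hI
  have e2 : σ₁.na 2 = σ.na 2 := hF₁.na 2 rfl
  have e3 : σ₁.na 3 = σ.na 3 := hF₁.na 3 rfl
  refine Runs.seq ((Runs.argmin (N := q) (fun c => c ∈ S) (fun c => I.idxDist (σ.na 3) i c)
    (by decide) (by decide) (by decide) (by decide) (by decide) (by decide)
    ((hF₁.nv 3 rfl).trans hq) ?_ ?_ ?_).conseq le_rfl fun σ₂ hF₂ h => ?_)
  · intro σ' hF' hlt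
    rw [← hS _ hlt]
    simp only [BExp.Holds, NExp.eval, hF'.na 2 rfl, e2, nonpos_iff_eq_zero]
  · intro σ' hF' _
    simp only [RExp.eval_dist, NExp.eval, hF'.na 3 rfl, hF'.nv 10 rfl, e3, hx]; rfl
  · intro σ' hF' _
    simp only [RExp.eval_dist, NExp.eval, hF'.na 3 rfl, hF'.nv 10 rfl, e3, hx]; rfl
  · refine Runs.putR (by omega) ?_
    have hx2 : σ₂.nv 10 = i := (hF₂.nv 10 rfl).trans hx
    have ev : RExp.eval I σ₂ (.dist (.get 3 (.var 10)) (.get 3 (.var 11)))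
        = I.idxDist (σ.na 3) i (σ₂.nv 11) := by
      simp only [RExp.eval_dist, NExp.eval, hF₂.na 3 rfl, e3, hx2]; rfl
    simp only [update₂_self, NExp.eval, hx2, ev, hF₂.ra 2 rfl]
    intro a ha
    rcases Nat.lt_succ_iff_lt_or_eq.1 ha with ha | rfl
    · rw [Function.update_of_ne (by omega)]; exact hI a ha
    · rw [Function.update_self]
      rcases h with ⟨-, h⟩ | ⟨h1, h2, h3⟩
      · obtain ⟨c, hc⟩ := hne
        exact absurd hc (h c (Finset.mem_range.1 (hSq hc)))
      · exact ⟨⟨_, h2, rfl⟩, fun c hc => h3 c (Finset.mem_range.1 (hSq hc)) hc⟩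

theorem fartherMult_spec (hq : σ.nv 3 = q) :
    Runs I fartherMult σ ((q + 1) * (q + 1)) fun σ' =>
      ∀ a < q, σ'.na 10 a = ∑ u ∈ Finset.range q with σ.ra 2 a < σ.ra 2 u, σ.na 4 u := by
  refine (Runs.forAll (K := q + 1) (N := q) (fun i σ' => ∀ a < i,
      σ'.na 10 a = ∑ u ∈ Finset.range q with σ.ra 2 a < σ.ra 2 u, σ.na 4 u)
      (by omega) hq rfl rfl (by decide) (by simp) ?_).conseq le_rfl fun _ _ h => h
  intro i σ₁ hi hF₁ hx hI
  have e2 : σ₁.ra 2 = σ.ra 2 := hF₁.ra 2 rfl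
  have e4 : σ₁.na 4 = σ.na 4 := hF₁.na 4 rfl
  refine Runs.seq (Runs.setN (by omega) (Runs.seq ((Runs.forAll (K := 1) (N := q) (fun k σ' =>
    σ'.nv 11 = ∑ u ∈ Finset.range k with σ.ra 2 i < σ.ra 2 u, σ.na 4 u) le_rfl
    (by simpa using (hF₁.nv 3 rfl).trans hq) rfl rfl (by decide) (by simp [NExp.eval])
    ?_).conseq (by omega) fun σ₂ hF₂ h => ?_)))
  · intro k σ₂ hk hF₂ hxk hIk
    have d2 : σ₂.ra 2 = σ.ra 2 := (hF₂.ra 2 rfl).trans e2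
    have d4 : σ₂.na 4 = σ.na 4 := (hF₂.na 4 rfl).trans e4
    have dx : σ₂.nv 10 = i := by rw [hF₂.nv 10 rfl]; simpa using hx
    refine Runs.when le_rfl (fun hb => Runs.setN le_rfl ?_) (fun hb => ?_)
    · simp only [BExp.Holds, RExp.eval, NExp.eval, d2, dx, hxk, not_le] at hb
      rw [Finset.range_add_one, Finset.filter_insert, if_pos hb, Finset.sum_insert (by simp)]
      simp [NExp.eval, hIk, hxk, d4, add_comm]
    · simp only [BExp.Holds, RExp.eval, NExp.eval, d2, dx, hxk, not_le] at hb
      rw [Finset.range_add_one, Finset.filter_insert, if_neg hb]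
      simpa using hIk
  · refine Runs.putN (by omega) ?_
    have hx2 : σ₂.nv 10 = i := by rw [hF₂.nv 10 rfl]; simpa using hx
    simp only [update₂_self, NExp.eval, hx2, h, hF₂.na 10 rfl]
    intro a ha
    rcases Nat.lt_succ_iff_lt_or_eq.1 ha with ha | rfl
    · rw [Function.update_of_ne (by omega)]; exact hI a ha
    · rw [Function.update_self]

theorem costCmd_spec (hz : σ.nv 1 = z) (hq : σ.nv 3 = q) (hq1 : 1 ≤ q) {s : ℕ → ℕ}
    (hs : ∀ a < q, σ.na 10 a = s a) (hmax : ∃ a < q, s a ≤ z) :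
    Runs I costCmd σ (q + 1) fun σ' => ∃ a < q, σ'.rv 2 = σ.ra 2 a ∧ s a ≤ z ∧
      ∀ b < q, s b ≤ z → σ.ra 2 a ≤ σ.ra 2 b := by
  refine Runs.seq ((Runs.argmin (N := q) (fun c => s c ≤ z) (σ.ra 2)
    (by decide) (by decide) (by decide) (by decide) (by decide) (by decide)
    hq ?_ ?_ ?_).conseq le_rfl fun σ₂ hF₂ h => ?_)
  · intro σ' hF' hlt
    simp only [BExp.Holds, NExp.eval, hF'.na 10 rfl, hF'.nv 1 rfl, hz, hs _ hlt]
  · intro σ' hF' _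
    simp only [RExp.eval, NExp.eval, hF'.ra 2 rfl]
  · intro σ' hF' _
    simp only [RExp.eval, NExp.eval, hF'.ra 2 rfl]
  · refine Runs.setR (by omega) ?_
    rcases h with ⟨-, h⟩ | ⟨h1, h2, h3⟩
    · obtain ⟨a, ha, hsa⟩ := hmax
      exact absurd hsa (h a ha)
    · exact ⟨_, h1, by simp [RExp.eval, NExp.eval, hF₂.ra 2 rfl], h2, h3⟩

end Output

/-! ### Farthest-first traversal and representatives as sets of points. -/

namespace RKCInstance

variable {I : RKCInstance}

/-- The point with a given number. -/
def pt (I : RKCInstance) (x : ℕ) : Fin I.n := ⟨x % I.n, Nat.mod_lt _ I.n_pos⟩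

theorem pt_val {x : ℕ} (hx : x < I.n) : (I.pt x : ℕ) = x := Nat.mod_eq_of_lt hx

theorem pt_fin (j : Fin I.n) : I.pt j = j := Fin.ext (pt_val j.2)

theorem pt_inj {x y : ℕ} (hx : x < I.n) (hy : y < I.n) (h : I.pt x = I.pt y) : x = y := by
  have := congrArg Fin.val h
  rwa [pt_val hx, pt_val hy] at this

theorem natDist_eq {x y : ℕ} (hx : x < I.n) (hy : y < I.n) :
    I.natDist x y = I.d (I.pt x) (I.pt y) := by
  rw [← natDist_fin, pt_val hx, pt_val hy]

theorem natWeight_eq {x : ℕ} (hx : x < I.n) : I.natWeight x = I.w (I.pt x) := by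
  rw [← natWeight_fin, pt_val hx]

theorem card_filter_fin (Q : ℕ → Prop) [DecidablePred Q] :
    (Finset.univ.filter fun j : Fin I.n => Q j).card = ((Finset.range I.n).filter Q).card := by
  refine Finset.card_bij (fun j _ => (j : ℕ)) (fun j hj => ?_) (fun a _ b _ h => Fin.ext h)
    fun x hx => ?_
  · simpa using hj
  · rw [Finset.mem_filter, Finset.mem_range] at hx
    exact ⟨⟨x, hx.1⟩, by simpa using hx.2, rfl⟩

end RKCInstance

/-- Lightest points of the clusters of a farthest-first traversal with `q` centers. -/
structure LightestReps (I : RKCInstance) (q : ℕ) (L P : ℕ → ℕ) : Prop where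
  lt : ∀ a < q, P a < I.n
  label : ∀ a < q, L (P a) = a
  le : ∀ a < q, ∀ j < I.n, L j = a → I.natWeight (P a) ≤ I.natWeight j

section Coreset

open RKCInstance

variable {I : RKCInstance} {q τ : ℕ} {P₀ P L : ℕ → ℕ} {E : ℕ → ℝ}

/-- The centers of a farthest-first traversal. -/
def centerSet (I : RKCInstance) (q : ℕ) (P₀ : ℕ → ℕ) : Finset (Fin I.n) :=
  (Finset.range q).image fun a => I.pt (P₀ a)

/-- The multiplicity of a representative. -/
def repMult (I : RKCInstance) (L P : ℕ → ℕ) (i : Fin I.n) : ℕ :=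
  (Finset.univ.filter fun j : Fin I.n => I.pt (P (L j)) = i).card

theorem FarthestFirst.radius_eq (h : FarthestFirst I q P₀ L E) {f : ℕ} (hf : f < I.n)
    (hmax : ∀ j < I.n, E j ≤ E f) : I.radius (centerSet I q P₀) = ENNReal.ofReal (E f) := by
  have hE : 0 ≤ E f := by rw [h.dist_eq f hf]; exact I.natDist_nonneg _ _
  apply le_antisymm
  · rw [radius_le_iff hE]
    intro j
    have hl := h.label_lt j j.2
    refine ⟨I.pt (P₀ (L j)), Finset.mem_image_of_mem _ (Finset.mem_range.2 hl), ?_⟩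
    rw [I.d_symm, ← I.pt_fin j, ← natDist_eq (h.lt _ (by rwa [I.pt_fin])) (by simp), I.pt_fin,
      ← h.dist_eq j j.2]
    exact hmax j j.2
  · refine le_trans ?_ (Finset.le_sup (f := fun j => I.distTo j (centerSet I q P₀))
      (Finset.mem_univ (I.pt f)))
    refine Finset.le_inf fun c hc => ?_
    obtain ⟨a, ha, rfl⟩ := Finset.mem_image.1 hc
    rw [Finset.mem_range] at ha
    refine ENNReal.ofReal_le_ofReal ?_
    rw [I.d_symm, ← natDist_eq (h.lt a ha) hf]
    exact h.dist_le a ha f hf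

theorem FarthestFirst.card_centerSet (h : FarthestFirst I q P₀ L E) :
    (centerSet I q P₀).card = q := by
  rw [centerSet, Finset.card_image_of_injOn, Finset.card_range]
  intro a ha b hb hab
  have ha := Finset.mem_range.1 (Finset.mem_coe.1 ha)
  have hb := Finset.mem_range.1 (Finset.mem_coe.1 hb)
  rw [← h.label_center a ha, ← h.label_center b hb, pt_inj (h.lt a ha) (h.lt b hb) hab]

/-- The `q` centers and the farthest point are `q + 1` points at mutual distances at least `E f`. By
pigeonhole two of them share a nearby center in an optimal set of `q` centers. -/
theorem FarthestFirst.radius_le_centerOpt (h : FarthestFirst I q P₀ L E) (hq : q = min τ I.n)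
    {f : ℕ} (hf : f < I.n) (hmax : ∀ j < I.n, E j ≤ E f) :
    I.radius (centerSet I q P₀) ≤ ENNReal.ofReal 2 * I.centerOpt τ := by
  obtain ⟨Γ, hΓ, hΓopt⟩ := exists_eq_iInf_of_prop
    (fun Γ : Finset (Fin I.n) => Γ.card = min τ I.n) (fun Γ => I.radius Γ)
    ⟨_, h.card_centerSet.trans hq⟩
  change I.radius Γ = I.centerOpt τ at hΓopt
  rw [← hΓopt]
  by_cases htop : I.radius Γ = ⊤
  · rw [htop, ENNReal.mul_top (by simp)]
    exact le_top
  set R := (I.radius Γ).toReal with hR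
  have hRn : 0 ≤ R := ENNReal.toReal_nonneg
  have hcov := (radius_le_iff hRn).1 (ENNReal.ofReal_toReal htop).ge
  rw [h.radius_eq hf hmax, ← ENNReal.ofReal_toReal htop, ← ENNReal.ofReal_mul (by norm_num)]
  apply ENNReal.ofReal_le_ofReal
  choose c hcΓ hcR using hcov
  -- Index `q` stands for the farthest point.
  set x : ℕ → ℕ := fun a => if a < q then P₀ a else f with hx
  have hxn : ∀ a, x a < I.n := fun a => by
    simp only [hx]; split_ifs with ha
    · exact h.lt a ha
    · exact hf
  have key : ∀ a b, a < b → b < q + 1 → c (I.pt (x a)) = c (I.pt (x b)) → E f ≤ 2 * R := by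
    intro a b hab hb hc
    have h1 : E f ≤ I.natDist (x a) (x b) := by
      have ha : a < q := by omega
      simp only [hx, if_pos ha]
      split_ifs with hbq
      · exact h.spread b hbq a hab f hf
      · exact h.dist_le a ha f hf
    rw [natDist_eq (hxn a) (hxn b)] at h1
    have h2 := I.d_triangle (I.pt (x a)) (c (I.pt (x a))) (I.pt (x b))
    have h3 := hcR (I.pt (x a))
    have h4 := hcR (I.pt (x b))
    rw [← hc, I.d_symm] at h4
    linarith
  obtain ⟨a, ha, b, hb, hne, hab⟩ := Finset.exists_ne_map_eq_of_card_lt_of_maps_to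
    (s := Finset.range (q + 1)) (t := Γ) (by simp [hΓ, hq]) (f := fun a => c (I.pt (x a)))
    (fun a _ => hcΓ _)
  rw [Finset.mem_range] at ha hb
  rcases lt_or_gt_of_ne hne with hlt | hlt
  · exact key a b hlt hb hab
  · exact key b a hlt ha hab.symm

/-- The result of the procedure from the results of its parts. -/
theorem FarthestFirst.isCoresetTest (h : FarthestFirst I q P₀ L E) (hq : q = min τ I.n)
    (hrep : LightestReps I q L P) {f : ℕ} (hf : f < I.n) (hmax : ∀ j < I.n, E j ≤ E f)
    {S : Finset (Fin I.n)} {r₂ : ℝ}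
    (hS : I.IsApproxMult 3 ((Finset.range q).image fun a => I.pt (P a)) (repMult I L P) S)
    (hr₂ : r₂ = (I.costMult ((Finset.range q).image fun a => I.pt (P a)) (repMult I L P) S).toReal) :
    I.IsCoresetTest 3 2 τ S (E f) r₂ := by
  have hE : 0 ≤ E f := by rw [h.dist_eq f hf]; exact I.natDist_nonneg _ _
  have hlab : ∀ j : Fin I.n, L j < q := fun j => h.label_lt j j.2
  have hLc : ∀ a < q, L (I.pt (P₀ a)) = a := fun a ha => by
    rw [pt_val (h.lt a ha), h.label_center a ha]
  refine ⟨centerSet I q P₀, fun j => I.pt (P₀ (L j)), fun c => I.pt (P (L c)), _, _,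
    h.card_centerSet.trans hq, h.radius_le_centerOpt hq hf hmax, fun j => ⟨?_, ?_⟩, ?_, ?_, ?_, hS,
    ?_, hr₂⟩
  · exact Finset.mem_image_of_mem _ (Finset.mem_range.2 (hlab j))
  · intro c hc
    obtain ⟨a, ha, rfl⟩ := Finset.mem_image.1 hc
    rw [Finset.mem_range] at ha
    have h1 := h.dist_le a ha j j.2
    rw [h.dist_eq j j.2, natDist_eq (h.lt _ (hlab j)) j.2, natDist_eq (h.lt a ha) j.2,
      I.pt_fin] at h1
    rwa [I.d_symm j, I.d_symm j]
  · intro c hc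
    obtain ⟨a, ha, rfl⟩ := Finset.mem_image.1 hc
    rw [Finset.mem_range] at ha
    simp only [hLc a ha]
    refine ⟨by rw [pt_val (hrep.lt a ha), hrep.label a ha], fun j hj => ?_⟩
    have : L j = a := by
      have := pt_inj (h.lt _ (hlab j)) (h.lt a ha) hj
      rw [← h.label_center _ (hlab j), this, h.label_center a ha]
    have := hrep.le a ha j j.2 this
    rwa [natWeight_eq (hrep.lt a ha), natWeight_eq j.2, I.pt_fin] at this
  · ext i
    simp only [Finset.mem_image, centerSet, Finset.mem_range]
    constructor
    · rintro ⟨a, ha, rfl⟩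
      exact ⟨_, ⟨a, ha, rfl⟩, by rw [hLc a ha]⟩
    · rintro ⟨_, ⟨a, ha, rfl⟩, rfl⟩
      exact ⟨a, ha, by rw [hLc a ha]⟩
  · intro i
    simp only [repMult]
    congr 1
    ext j
    simp only [Finset.mem_filter, Finset.mem_univ, true_and, hLc _ (hlab j)]
  · rw [h.radius_eq hf hmax, ENNReal.toReal_ofReal hE]

theorem LightestReps.indexing (hrep : LightestReps I q L P) (hL : ∀ j < I.n, L j < q) {M : ℕ → ℕ}
    (hM : ∀ a < q, M a = min ((Finset.range I.n).filter fun j => L j = a).card (I.z + 1)) :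
    Indexing I q (fun a => I.pt (P a)) ((Finset.range q).image fun a => I.pt (P a)) (repMult I L P)
      (I.idxDist P) (I.idxWeight P) M := by
  have hinj : ∀ a < q, ∀ b < q, I.pt (P a) = I.pt (P b) → a = b := fun a ha b hb hab => by
    rw [← hrep.label a ha, ← hrep.label b hb, pt_inj (hrep.lt a ha) (hrep.lt b hb) hab]
  have hmult : ∀ a < q, repMult I L P (I.pt (P a))
      = ((Finset.range I.n).filter fun j => L j = a).card := by
    intro a ha
    rw [repMult, ← card_filter_fin]
    congr 1
    ext j
    simp only [Finset.mem_filter, Finset.mem_univ, true_and]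
    exact ⟨fun hj => hinj _ (hL j j.2) a ha hj, fun hj => by rw [hj]⟩
  refine ⟨hinj, rfl, fun a ha b hb => natDist_eq (hrep.lt a ha) (hrep.lt b hb),
    fun a ha => natWeight_eq (hrep.lt a ha), fun a ha => by rw [hM a ha, hmult a ha], ?_⟩
  rw [Finset.sum_image fun a ha b hb hab => hinj a (by simpa using ha) b (by simpa using hb) hab,
    Finset.sum_congr rfl fun a ha => hmult a (Finset.mem_range.1 ha),
    ← Finset.card_eq_sum_card_fiberwise (f := L) (t := Finset.range q)
      (fun j hj => by simpa using hL j (by simpa using hj)), Finset.card_range]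
  exact I.z_lt

end Coreset

/-! ### Assembly of the procedure and the main theorem. -/

/-- CoresetComputeAndTest. -/
def coresetTest : Cmd :=
  .seq centersCmd (.seq (.setN 4 (.add (.var 1) (.lit 1))) (.seq repsCmd (.seq searchRadius
    (.seq writeSolution (.seq nearestCmd (.seq fartherMult costCmd))))))

theorem coresetTest_time {n τ z q : ℕ} (hn : 1 ≤ n) (hτ : 1 ≤ τ) (hq : q = min τ n) :
    stepTime q z * (stepBound q z * q + 2) * (q + 1) * (q + 1) ≤ n * (τ + z + 1) ^ 12 ∧
      (n + 1) * (q + 1) ≤ n * (τ + z + 1) ^ 12 ∧ (q + 1) * (q + 1) ≤ n * (τ + z + 1) ^ 12 := by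
  set s := τ + z + 1 with hs
  have hs2 : 2 ≤ s := by omega
  have hqτ : q ≤ τ := hq.le.trans (min_le_left _ _)
  have h1 : q + 1 ≤ s := by omega
  have h2 : z + 1 ≤ s := by omega
  have h3 : q + z + 3 ≤ s ^ 2 := by nlinarith
  have hpow : ∀ e, s ^ e + s ^ e ≤ s ^ (e + 1) := fun e => by
    rw [pow_succ, ← mul_two]; exact Nat.mul_le_mul_left _ hs2
  have hT : stepTime q z ≤ s ^ 3 :=
    (Nat.mul_le_mul h3 h1).trans (le_of_eq (by ring))
  have hB : stepBound q z * q ≤ s ^ 6 := by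
    have : q ≤ s := by omega
    calc stepBound q z * q ≤ (s * (s * s) ^ 2) * s := by unfold stepBound; gcongr
      _ = s ^ 6 := by ring
  have hL : stepBound q z * q + 2 ≤ s ^ 7 := by
    have h6 : s ≤ s ^ 6 := Nat.le_self_pow (by omega) s
    have h7 : s ^ 6 + s ^ 6 ≤ s ^ 7 := hpow 6
    omega
  have hmono : ∀ e ≤ 12, s ^ e ≤ n * s ^ 12 := fun e he =>
    (Nat.pow_le_pow_right (by omega) he).trans (Nat.le_mul_of_pos_left _ hn)
  have hn2 : n + 1 ≤ n * s := by nlinarith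
  refine ⟨?_, ?_, ?_⟩
  -- Time of one perceptron step, number of steps, and the two loops over the pairs that define the
  -- radii.
  · calc _ ≤ s ^ 3 * s ^ 7 * s * s := by gcongr
      _ = s ^ 12 := by ring
      _ ≤ _ := hmono 12 le_rfl
  · calc (n + 1) * (q + 1) ≤ (n * s) * s := Nat.mul_le_mul hn2 h1
      _ = n * s ^ 2 := by ring
      _ ≤ n * s ^ 12 := Nat.mul_le_mul_left _ (Nat.pow_le_pow_right (by omega) (by omega))
  · calc (q + 1) * (q + 1) ≤ s * s := Nat.mul_le_mul h1 h1
      _ = s ^ 2 := by ring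
      _ ≤ _ := hmono 2 (by omega)

theorem coresetTest_spec (I : RKCInstance) (τ : ℕ) (σ : RAMState) (hτ1 : 1 ≤ τ)
    (hn : σ.nv 0 = I.n) (hz : σ.nv 1 = I.z) (hτ : σ.nv 2 = τ) :
    Runs I coresetTest σ (I.n * (τ + I.z + 1) ^ 12) fun σ' =>
      I.IsCoresetTest 3 2 τ (σ'.sol I) (σ'.rv 1) (σ'.rv 2) := by
  obtain ⟨q, hq⟩ : ∃ q, q = min τ I.n := ⟨_, rfl⟩
  obtain ⟨hK1, hK2, hK3⟩ := coresetTest_time (z := I.z) I.n_pos hτ1 hq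
  set K := I.n * (τ + I.z + 1) ^ 12 with hKdef
  have hqn : q ≤ I.n := hq.le.trans (min_le_right _ _)
  have hq1 : 1 ≤ q := by rw [hq]; exact le_min hτ1 I.n_pos
  have hKn : I.n + 1 ≤ K := le_trans (Nat.le_mul_of_pos_right _ (by omega)) hK2
  have hKq : q + 1 ≤ K := by omega
  have hspec := centersCmd_spec hn hτ hτ1
  rw [← hq] at hspec
  refine Runs.seq (hspec.conseq hK2 fun σ₁ hF₁ h₁ => ?_)
  obtain ⟨hq₁, hff, f, hf, hr1, hmax⟩ := h₁
  refine Runs.seq (Runs.setN (by omega) ?_)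
  set σ₂ : RAMState := { σ₁ with
    nv := Function.update σ₁.nv 4 ((NExp.add (.var 1) (.lit 1)).eval σ₁) } with hσ₂
  have n2 : σ₂.nv 0 = I.n := (hF₁.nv 0 rfl).trans hn
  have y2 : σ₂.nv 1 = I.z := (hF₁.nv 1 rfl).trans hz
  have q2 : σ₂.nv 3 = q := hq₁
  have z2 : σ₂.nv 4 = I.z + 1 := by
    simp [hσ₂, NExp.eval, (hF₁.nv 1 rfl).trans hz]
  refine Runs.seq ((repsCmd_spec n2 q2 z2 hqn hff.lt hff.label_lt hff.label_center).conseq hKn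
    fun σ₃ hF₃ h₃ => ?_)
  have hrep : LightestReps I q (σ₁.na 1) (σ₃.na 3) :=
    ⟨fun a ha => (h₃ a ha).1, fun a ha => (h₃ a ha).2.1, fun a ha => (h₃ a ha).2.2.1⟩
  have hidx := hrep.indexing hff.label_lt fun a ha => (h₃ a ha).2.2.2
  have n3 : σ₃.nv 0 = I.n := (hF₃.nv 0 rfl).trans n2
  have y3 : σ₃.nv 1 = I.z := (hF₃.nv 1 rfl).trans y2
  have q3 : σ₃.nv 3 = q := (hF₃.nv 3 rfl).trans q2
  have z3 : σ₃.nv 4 = I.z + 1 := (hF₃.nv 4 rfl).trans z2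
  have hin : HoldsInput I σ₃ q I.z := ⟨y3, q3, z3, hrep.lt, fun a ha => by
    rw [(h₃ a ha).2.2.2]; exact min_le_right _ _⟩
  refine Runs.seq ((searchRadius_spec hin hq1).conseq hK1 fun σ₄ hF₄ h₄ => ?_)
  obtain ⟨a₀, ha₀, b₀, hb₀, S₀, hS₀, -⟩ := hidx.exists_feasible_opt
  rcases h₄ with ⟨-, h₄⟩ | ⟨-, hR, ⟨S, hS, hind⟩, hbest⟩
  -- The search cannot come back empty, as the optimal radius was among those tested.
  · exact absurd hS₀ (h₄ a₀ b₀ ⟨ha₀, hb₀⟩ S₀)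
  have happ := hidx.isApproxMult hR hS hbest
  have e3 : σ₄.na 3 = σ₃.na 3 := hF₄.na 3 rfl
  have n4 : σ₄.nv 0 = I.n := (hF₄.nv 0 rfl).trans n3
  have q4 : σ₄.nv 3 = q := (hF₄.nv 3 rfl).trans q3
  have hSsub := hS.sub
  -- An empty solution would leave everything uncovered, which exceeds `z`. Nonemptiness makes the
  -- distances to the solution well defined.
  have hSne : S.Nonempty := by
    rw [Finset.nonempty_iff_ne_empty]
    intro hemp
    have hle := ((hidx.feasible_iff (by positivity)).1 hS).2.2
    obtain ⟨X, ⟨-, hX⟩, hcov⟩ := (RKCInstance.costMult_le_iff (by positivity)).1 hle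
    have hX0 : X = ∅ := Finset.eq_empty_of_forall_notMem fun i hi => by
      obtain ⟨c, hc, -⟩ := hcov i hi
      simp [hemp] at hc
    have := hidx.total
    rw [hX0, Finset.sum_empty] at hX
    omega
  refine Runs.seq ((writeSolution_spec n4 q4).conseq hK2 fun σ₅ hF₅ h₅ => ?_)
  have hind5 : ∀ a < q, σ₅.na 2 a ≠ 0 ↔ a ∈ S := by rw [hF₅.na 2 rfl]; exact hind
  have e5 : σ₅.na 3 = σ₃.na 3 := (hF₅.na 3 rfl).trans e3
  refine Runs.seq ((nearestCmd_spec ((hF₅.nv 3 rfl).trans q4) hSsub hSne hind5).conseq hK3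
    fun σ₆ hF₆ h₆ => ?_)
  rw [e5] at h₆
  have q6 : σ₆.nv 3 = q := (hF₆.nv 3 rfl).trans ((hF₅.nv 3 rfl).trans q4)
  refine Runs.seq ((fartherMult_spec q6).conseq hK3 fun σ₇ hF₇ h₇ => ?_)
  have e7 : σ₇.ra 2 = σ₆.ra 2 := hF₇.ra 2 rfl
  have m6 : σ₆.na 4 = σ₃.na 4 := by rw [hF₆.na 4 rfl, hF₅.na 4 rfl, hF₄.na 4 rfl]
  have y7 : σ₇.nv 1 = I.z := by
    rw [hF₇.nv 1 rfl, hF₆.nv 1 rfl, hF₅.nv 1 rfl, hF₄.nv 1 rfl, y3]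
  rw [m6] at h₇
  refine (costCmd_spec y7 ((hF₇.nv 3 rfl).trans q6) hq1 h₇ ?_).conseq hKq fun σ₈ hF₈ h₈ => ?_
  -- No point is farther from the solution than the farthest one, so an admissible index exists.
  · obtain ⟨a, ha, hmaxa⟩ := Finset.exists_max_image (Finset.range q) (σ₆.ra 2)
      ⟨0, Finset.mem_range.2 hq1⟩
    refine ⟨a, Finset.mem_range.1 ha, ?_⟩
    rw [Finset.filter_false_of_mem fun u hu => not_lt.2 (hmaxa u hu)]
    simp
  · obtain ⟨a, ha, hr2, hs, hmin⟩ := h₈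
    rw [e7] at hr2 hmin
    have hcost := hidx.costMult_eq hSsub h₆ ha hs hmin
    have r1 : σ₈.rv 1 = σ₁.ra 0 f := by
      rw [hF₈.rv 1 rfl, hF₇.rv 1 rfl, hF₆.rv 1 rfl, hF₅.rv 1 rfl, hF₄.rv 1 rfl, hF₃.rv 1 rfl]
      exact hr1
    have hsol : σ₈.sol I = S.image fun a => I.pt (σ₃.na 3 a) := by
      have o : σ₈.na 0 = σ₅.na 0 := by rw [hF₈.na 0 rfl, hF₇.na 0 rfl, hF₆.na 0 rfl]
      ext j
      rw [RAMState.sol, Finset.mem_filter, o, h₅ j j.2, e3, Finset.mem_image]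
      simp only [Finset.mem_univ, true_and]
      constructor
      · rintro ⟨a, ha, h1, h2⟩
        exact ⟨a, (hind a ha).1 h1, by rw [h2, I.pt_fin]⟩
      · rintro ⟨a, ha, rfl⟩
        have haq := Finset.mem_range.1 (hSsub ha)
        exact ⟨a, haq, (hind a haq).2 ha, (RKCInstance.pt_val (hrep.lt a haq)).symm⟩
    rw [hsol, r1, hr2]
    exact hff.isCoresetTest hq hrep hf hmax happ hcost

theorem coresetTest_exec (I : RKCInstance) (τ : ℕ) (σ : RAMState) (hτ1 : 1 ≤ τ)
    (hn : σ.nv 0 = I.n) (hz : σ.nv 1 = I.z) (hτ : σ.nv 2 = τ) :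
    ∃ t σ', Exec I coresetTest σ t σ' ∧ t ≤ coresetTest.size * (I.n * (τ + I.z + 1) ^ 12) ∧
      σ'.nv 0 = I.n ∧ σ'.nv 1 = I.z ∧ σ'.nv 2 = τ ∧ σ'.rv 0 = σ.rv 0 ∧
      I.IsCoresetTest 3 2 τ (σ'.sol I) (σ'.rv 1) (σ'.rv 2) := by
  obtain ⟨t, σ', he, ht, h⟩ := coresetTest_spec I τ σ hτ1 hn hz hτ
  exact ⟨t, σ', he, ht, (he.frame.nv 0 rfl).trans hn, (he.frame.nv 1 rfl).trans hz,
    (he.frame.nv 2 rfl).trans hτ, he.frame.rv 0 rfl, h⟩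

theorem corollary2 :
    (∀ (β : ℝ) (body : Cmd), ImplementsCoresetTest 3 β body →
      ∀ ε : ℝ, 0 < ε → ε < 1 → ∀ I : RKCInstance,
        ∃ (t : ℕ) (σ : RAMState), Exec I (rknapCenter 3 body) (initState I ε) t σ ∧
          I.IsApprox (3 + ε) (σ.sol I)) ∧
    ∃ (body : Cmd) (c : ℕ), ImplementsCoresetTest 3 2 body ∧
      ∀ ε : ℝ, 0 < ε → ε < 1 → ∃ C : ℝ → ℝ, ∀ I : RKCInstance,
        ∃ (t : ℕ) (σ : RAMState), Exec I (rknapCenter 3 body) (initState I ε) t σ ∧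
          I.IsApprox (3 + ε) (σ.sol I) ∧
          ∀ D : ℝ, I.doublingDim ≤ D →
            (t : ℝ) ≤ C D * (I.n : ℝ) * ((I.minOptCard + I.z : ℕ) : ℝ) ^ c := by
  refine ⟨fun β body h ε hε _ I => rknapCenter_isApprox h hε I, coresetTest, 12 + 1, ?_, ?_⟩
  · intro I τ σ h1 h2 h3 h4
    obtain ⟨t, σ', he, -, h⟩ := coresetTest_exec I τ σ h1 h2 h3 h4
    exact ⟨t, σ', he, h⟩
  · intro ε hε hε1
    exact rknapCenter_time coresetTest_exec hε hε1
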